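/- All graphs are finite and simple. For a graph $G$ let $C^{j}(G)\in\mathbb N\cup\{\infty\}$ denote the minimum quantifier depth of a first-order sentence with counting quantifiers $\exists^{m}$ ("there are at least $m$ vertices such that"; each contributes $1$ to the quantifier depth, irrespective of $m$) in the language of adjacency and equality that uses at most $j$ variables (which may be requantified), is true on $G$, and is false on every graph not isomorphic to $G$; put $C^{j}(G)=\infty$ if there is no such sentence. Let $D^{j}(G)$ be the analogous number for first-order sentences without counting quantifiers, that is, with $\exists$ (and $\forall$) only. Let $k\ge 2$ be a constant and let $\mathcal C$ be a class of graphs. *Graph Isomorphism for $\mathcal C$* is the (promise) problem of deciding, given two graphs $G,H\in\mathcal C$, whether $G\cong H$. 1. If $C^{k+1}(G)=O(\log n)$ for the graphs $G\in\mathcal C$, where $n$ is the number of vertices of $G$ (that is, there are constants $c,n_0$ with $C^{k+1}(G)\le c\log n$ for all $G\in\mathcal C$ with $n\ge n_0$ vertices), then Graph Isomorphism for $\mathcal C$ is in $\mathrm{TC}^1$. 2. If $D^{k+1}(G)=O(\log n)$ for the graphs $G\in\mathcal C$, in the same sense, then Graph Isomorphism for $\mathcal C$ is in $\mathrm{AC}^1$.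 Here $\mathrm{AC}^1$ consists of the problems solved by a logspace uniform family of Boolean circuits $(B_N)_{N\ge0}$, with $B_N$ for the inputs of $N$ bits, of size polynomial in $N$ and depth $O(\log N)$, with NOT gates and with AND and OR gates of unbounded fan-in; for $\mathrm{TC}^1$ threshold gates of unbounded fan-in ("at least $m$ of the inputs are $1$") are allowed in addition. Two input graphs with $n$ and $m$ vertices are given as a bit string that consists of $n$ and $m$ in unary, followed by the two adjacency matrices. -/

import Mathlib

namespace GraphIso

/-! ### Finite-variable first order logic of graphs, with counting quantifiers -/

/-- Formulas in the variables `x₀, …, x_{k-1}` (which may be requantified) over the language of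
adjacency and equality; `ex m i φ` is the counting quantifier "there are at least `m` vertices
`x_i` with `φ`". -/
inductive Formula (k : ℕ) : Type
  | falsum : Formula k
  | eq (i j : Fin k) : Formula k
  | adj (i j : Fin k) : Formula k
  | neg (φ : Formula k) : Formula k
  | and (φ ψ : Formula k) : Formula k
  | ex (m : ℕ) (i : Fin k) (φ : Formula k) : Formula k

namespace Formula

variable {k : ℕ}

/-- Quantifier depth; a counting quantifier contributes 1 irrespective of its threshold. -/
def depth : Formula k → ℕ
  | falsum => 0
  | eq _ _ => 0
  | adj _ _ => 0
  | neg φ => φ.depth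
  | and φ ψ => max φ.depth ψ.depth
  | ex _ _ φ => φ.depth + 1

/-- The variables that occur free. -/
def freeVars : Formula k → Finset (Fin k)
  | falsum => ∅
  | eq i j => {i, j}
  | adj i j => {i, j}
  | neg φ => φ.freeVars
  | and φ ψ => φ.freeVars ∪ ψ.freeVars
  | ex _ i φ => φ.freeVars.erase i

def IsSentence (φ : Formula k) : Prop := φ.freeVars = ∅

/-- No proper counting quantifiers: every quantifier is "there is at least one", i.e. `∃`. -/
def CountFree : Formula k → Prop
  | falsum => True
  | eq _ _ => True
  | adj _ _ => True
  | neg φ => φ.CountFree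
  | and φ ψ => φ.CountFree ∧ ψ.CountFree
  | ex m _ φ => m = 1 ∧ φ.CountFree

/-- Satisfaction under a partial assignment (partial, so that sentences also have their
usual truth value in the graph without vertices). -/
def Sat {V : Type} (G : SimpleGraph V) : Formula k → (Fin k → Option V) → Prop
  | falsum, _ => False
  | eq i j, ν => ∃ u, ν i = some u ∧ ν j = some u
  | adj i j, ν => ∃ u v, ν i = some u ∧ ν j = some v ∧ G.Adj u v
  | neg φ, ν => ¬ φ.Sat G ν
  | and φ ψ, ν => φ.Sat G ν ∧ ψ.Sat G ν
  | ex m i φ, ν => ∃ s : Finset V, m ≤ s.card ∧ ∀ v ∈ s, φ.Sat G (Function.update ν i (some v))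

/-- Truth in a graph; used for sentences only. -/
def Holds {V : Type} (G : SimpleGraph V) (φ : Formula k) : Prop := φ.Sat G fun _ => none

/-- `φ` is a sentence, true on `G` and false on every finite graph not isomorphic to `G`. -/
def Defines {n : ℕ} (φ : Formula k) (G : SimpleGraph (Fin n)) : Prop :=
  φ.IsSentence ∧ φ.Holds G ∧
    ∀ (m : ℕ) (H : SimpleGraph (Fin m)), IsEmpty (G ≃g H) → ¬ φ.Holds H

end Formula

/-- The minimum quantifier depth of a sentence of `k`-variable logic with counting quantifiers
that defines `G`; it is `⊤` if there is no such sentence. -/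
noncomputable def countingDepth (k : ℕ) {n : ℕ} (G : SimpleGraph (Fin n)) : ℕ∞ :=
  ⨅ (φ : Formula k) (_ : φ.Defines G), (φ.depth : ℕ∞)

/-- The minimum quantifier depth of a sentence of `k`-variable logic (without counting) that
defines `G`; it is `⊤` if there is no such sentence. -/
noncomputable def logicalDepth (k : ℕ) {n : ℕ} (G : SimpleGraph (Fin n)) : ℕ∞ :=
  ⨅ (φ : Formula k) (_ : φ.Defines G ∧ φ.CountFree), (φ.depth : ℕ∞)

/-! ### Boolean circuits with gates of unbounded fan-in -/

/-- A gate number `s` of a circuit with `N` input bits; its predecessors are among the gates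
`0, …, s-1`, for gates of unbounded fan-in given by the row `w` of the adjacency matrix. -/
inductive Gate (N s : ℕ) : Type
  | input (a : Fin N) : Gate N s
  | not (j : Fin s) : Gate N s
  | and (w : Fin s → Bool) : Gate N s
  | or (w : Fin s → Bool) : Gate N s
  /-- outputs 1 iff at least `m` of the predecessors are 1 -/
  | threshold (m : ℕ) (w : Fin s → Bool) : Gate N s

/-- A circuit with `N` input bits: its gates in topological order, the last being the output. -/
structure Circuit (N : ℕ) : Type where
  size : ℕ
  size_pos : 0 < size
  gate : (i : Fin size) → Gate N i

namespace Circuit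

variable {N : ℕ}

/-- The gate number `j < i`. -/
def pred (C : Circuit N) (i : Fin C.size) (j : Fin i) : Fin C.size :=
  ⟨j, j.isLt.trans i.isLt⟩

theorem pred_lt (C : Circuit N) (i : Fin C.size) (j : Fin i) : (C.pred i j).val < i.val :=
  j.isLt

/-- The value of gate `i` on the input `x`. -/
def val (C : Circuit N) (x : Fin N → Bool) (i : Fin C.size) : Bool :=
  match C.gate i with
  | .input a => x a
  | .not j => !(C.val x (C.pred i j))
  | .and w => decide (∀ j : Fin i, w j = true → C.val x (C.pred i j) = true)
  | .or w => decide (∃ j : Fin i, w j = true ∧ C.val x (C.pred i j) = true)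
  | .threshold m w =>
      decide (m ≤ (Finset.univ.filter fun j : Fin i =>
        w j = true ∧ C.val x (C.pred i j) = true).card)
  termination_by i.val
  decreasing_by all_goals exact C.pred_lt i _

def eval (C : Circuit N) (x : Fin N → Bool) : Bool :=
  C.val x ⟨C.size - 1, Nat.sub_lt C.size_pos Nat.one_pos⟩

/-- The maximum length of a path that ends in gate `i`. -/
def gateDepth (C : Circuit N) (i : Fin C.size) : ℕ :=
  match C.gate i with
  | .input _ => 0
  | .not j => C.gateDepth (C.pred i j) + 1
  | .and w => (Finset.univ.sup fun j : Fin i =>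
      if w j = true then C.gateDepth (C.pred i j) else 0) + 1
  | .or w => (Finset.univ.sup fun j : Fin i =>
      if w j = true then C.gateDepth (C.pred i j) else 0) + 1
  | .threshold _ w => (Finset.univ.sup fun j : Fin i =>
      if w j = true then C.gateDepth (C.pred i j) else 0) + 1
  termination_by i.val
  decreasing_by all_goals exact C.pred_lt i _

def depth (C : Circuit N) : ℕ := Finset.univ.sup C.gateDepth

/-- No threshold gates: only NOT gates and AND and OR gates of unbounded fan-in. -/
def IsAC (C : Circuit N) : Prop :=
  ∀ (i : Fin C.size) (m : ℕ) (w : Fin i → Bool), C.gate i ≠ .threshold m w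

end Circuit

def unary (m : ℕ) : List Bool := List.replicate m true ++ [false]

/-- The code of a gate: its type, its parameter in unary, and its row of the adjacency matrix. -/
def Gate.encode {N s : ℕ} : Gate N s → List Bool
  | .input a => [false, false, false] ++ unary a
  | .not j => [false, false, true] ++ unary j
  | .and w => [false, true, false] ++ List.ofFn w
  | .or w => [false, true, true] ++ List.ofFn w
  | .threshold m w => [true, false, false] ++ unary m ++ List.ofFn w

/-- The description of a circuit as a bit string. -/
def Circuit.encode {N : ℕ} (C : Circuit N) : List Bool :=
  (List.ofFn fun i : Fin C.size => (C.gate i).encode).flatten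

/-! ### Logarithmic space -/

inductive Move : Type
  | left | stay | right

/-- The contents of a cell of the input tape; the input is enclosed by end markers. -/
inductive InputSymbol : Type
  | leftEnd | rightEnd
  | bit (b : Bool)

/-- What a machine does in one step: write and move on every work tape, move on the input tape,
and possibly append one bit to the output. -/
structure Action (State Symbol : Type) (tapes : ℕ) : Type where
  next : State
  inputMove : Move
  write : Fin tapes → Symbol
  move : Fin tapes → Move
  emit : Option Bool

/-- A deterministic Turing machine with a two-way read-only input tape, finitely many work tapes
(infinite to the right) and a one-way write-only output tape. It halts when `step` is `none`. -/
structure Transducer : Type 1 where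
  State : Type
  Symbol : Type
  finState : Finite State
  finSymbol : Finite Symbol
  tapes : ℕ
  blank : Symbol
  start : State
  step : State → InputSymbol → (Fin tapes → Symbol) → Option (Action State Symbol tapes)

namespace Transducer

structure Config (M : Transducer) : Type where
  state : M.State
  inputPos : ℕ
  head : Fin M.tapes → ℕ
  tape : Fin M.tapes → ℕ → M.Symbol
  output : List Bool

/-- The input `w` occupies the cells `1, …, |w|`; cell `0` and cell `|w| + 1` hold end markers. -/
def readInput (w : List Bool) : ℕ → InputSymbol
  | 0 => .leftEnd
  | p + 1 => match w[p]? with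
    | some b => .bit b
    | none => .rightEnd

/-- The input head does not leave the cells `0, …, |w| + 1`. -/
def moveInput (w : List Bool) (p : ℕ) : Move → ℕ
  | .left => p - 1
  | .stay => p
  | .right => min (p + 1) (w.length + 1)

/-- A work head that moves left from cell `0` stays there. -/
def moveHead (p : ℕ) : Move → ℕ
  | .left => p - 1
  | .stay => p
  | .right => p + 1

def init (M : Transducer) : M.Config where
  state := M.start
  inputPos := 0
  head := fun _ => 0
  tape := fun _ _ => M.blank
  output := []

def next (M : Transducer) (w : List Bool) (c : M.Config) : Option M.Config :=
  (M.step c.state (readInput w c.inputPos) fun t => c.tape t (c.head t)).map fun a =>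
    { state := a.next
      inputPos := moveInput w c.inputPos a.inputMove
      head := fun t => moveHead (c.head t) (a.move t)
      tape := fun t => Function.update (c.tape t) (c.head t) (a.write t)
      output := c.output ++ a.emit.toList }

/-- `c` occurs in the run on input `w`. -/
def Reaches (M : Transducer) (w : List Bool) (c : M.Config) : Prop :=
  Relation.ReflTransGen (fun a b => M.next w a = some b) M.init c

/-- On input `w` the machine halts with output `y`, and no work head ever leaves the
cells `0, …, s`. -/
def ComputesInSpace (M : Transducer) (w y : List Bool) (s : ℕ) : Prop :=
  (∃ c, M.Reaches w c ∧ M.next w c = none ∧ c.output = y) ∧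
    ∀ c, M.Reaches w c → ∀ t, c.head t ≤ s

end Transducer

/-- Logspace uniformity: a Turing machine with work space `O(log N)` writes, given the
word `1^N`, the description of the `N`-th circuit. -/
def LogspaceUniform (C : (N : ℕ) → Circuit N) : Prop :=
  ∃ (M : Transducer) (c : ℕ), ∀ N : ℕ,
    M.ComputesInSpace (List.replicate N true) (C N).encode (c * Nat.log 2 N + c)

/-! ### The circuit classes -/

/-- A promise problem on bit strings: accept the strings in `yes`, reject those in `no`. -/
structure PromiseProblem : Type where
  yes : Set (List Bool)
  no : Set (List Bool)

/-- The circuits have polynomial size and depth `O(log^i N)`, are logspace uniform, and decide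
the problem. -/
def Decides (i : ℕ) (C : (N : ℕ) → Circuit N) (P : PromiseProblem) : Prop :=
  LogspaceUniform C ∧
  (∃ d : ℕ, ∀ N, (C N).size ≤ N ^ d + d) ∧
  (∃ c : ℕ, ∀ N, (C N).depth ≤ c * Nat.log 2 N ^ i + c) ∧
  (∀ x ∈ P.yes, (C x.length).eval x.get = true) ∧
  (∀ x ∈ P.no, (C x.length).eval x.get = false)

/-- The class TC^i (of promise problems). -/
def TC (i : ℕ) : Set PromiseProblem := {P | ∃ C, Decides i C P}

/-- The class AC^i (of promise problems). -/
def AC (i : ℕ) : Set PromiseProblem := {P | ∃ C, (∀ N, (C N).IsAC) ∧ Decides i C P}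

/-! ### Graph Isomorphism for a class of graphs -/

open Classical in
/-- The rows of the adjacency matrix, one after the other. -/
noncomputable def adjBits {n : ℕ} (G : SimpleGraph (Fin n)) : List Bool :=
  (List.ofFn fun i => List.ofFn fun j => decide (G.Adj i j)).flatten

/-- A pair of graphs as a bit string: both orders in unary, then both adjacency matrices. -/
noncomputable def encodePair {n m : ℕ} (G : SimpleGraph (Fin n)) (H : SimpleGraph (Fin m)) :
    List Bool :=
  unary n ++ unary m ++ adjBits G ++ adjBits H

/-- Graph Isomorphism for `C`: given two graphs from `C`, are they isomorphic? -/
def graphIsomorphism (C : (n : ℕ) → Set (SimpleGraph (Fin n))) : PromiseProblem where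
  yes := {x | ∃ (n m : ℕ) (G : SimpleGraph (Fin n)) (H : SimpleGraph (Fin m)),
    G ∈ C n ∧ H ∈ C m ∧ Nonempty (G ≃g H) ∧ x = encodePair G H}
  no := {x | ∃ (n m : ℕ) (G : SimpleGraph (Fin n)) (H : SimpleGraph (Fin m)),
    G ∈ C n ∧ H ∈ C m ∧ IsEmpty (G ≃g H) ∧ x = encodePair G H}

end GraphIso

/-! The combinatorial core is the refinement of pebble positions, as in the Weisfeiler–Leman
algorithm. A position places `j` pebbles on one of the two graphs. In round 0 two positions differ
if their pebbled vertices disagree in some equality or adjacency. In round `t + 1` they also differ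
if, for some pebble and some class of round `t`, the numbers of ways to move the pebble into that
class disagree (without counting: if only one of them has such a way). A class is represented by a
position `C` in it, and the moves that lead out of the class are examined.

Positions that do not differ after `t` rounds satisfy the same formulas of depth at most `t`
(`Formula.sat_iff_of_not_differ`), and an isomorphism carries each position to one from which it
never differs (`Position.not_differ_of_iso`). Hence, if a sentence of depth at most `R` defines `G`,
then `R` rounds decide whether `G` and `H` are isomorphic (`Position.iso_of_accepts`,
`Position.accepts_of_iso`). The hypothesis says nothing of orders below `n₀`; these are absorbed by
`n₀` additional pebbles, since round 0 decides isomorphism once every vertex can be pebbled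
(`Position.iso_of_accepts_of_le`).

The number of pebbles is constant, so there are polynomially many tuples of positions. One round is
a circuit layer of constant depth: threshold gates compare the numbers of moves, and AND gates
suffice without counting. With `R = O(log N)` rounds the depth is `O(log N)`. This gives `TC 1` and
`AC 1`, apart from uniformity.

For uniformity, gates are named by tuples of numbers with a fixed number of entries and are numbered
in lexicographic order, and each wire is determined by a Boolean combination of comparisons between
entries. The description of the circuit is therefore written by nested loops with comparisons and
counting (`Net.encode_toCircuit`, `out_familyProg`). Such loop programs are compiled to a machine
with one work tape, whose cells hold one bit of each variable; as all variables are at most `K * (N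
+ 1)`, logarithmic space suffices (`Prog.exists_transducer`). -/

namespace GraphIso

/-! ### Machines that sweep over one work tape -/

/-- A cell of the work tape holds one bit of each of `T` binary numbers. -/
abbrev Column (T : ℕ) : Type := Fin T → Bool

inductive Cell (T : ℕ) : Type
  | blank | mark
  | col (c : Column T)

/-- The instructions of a sweeping machine; `sweep` runs a Mealy automaton over the work tape,
may append one cell, and branches on the final state. -/
inductive Op (T : ℕ) (S : Type) : Type
  | emit (b : Option Bool) (s : S)
  | sweep (δ : Ordering → Column T → Ordering × Column T) (q : Ordering)
      (app : Ordering → Option (Column T)) (nxt : Ordering → S)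
  | advance (more last : S)

def Op.map {T : ℕ} {S S' : Type} (f : S → S') : Op T S → Op T S'
  | .emit b s => .emit b (f s)
  | .sweep δ q app nxt => .sweep δ q app fun r => f (nxt r)
  | .advance a b => .advance (f a) (f b)

/-- The three values of `Ordering` are states enough for all automata needed: the verdict of a
comparison, a carry flag, or a count of ones up to "more than one". -/
def mealy {T : ℕ} (δ : Ordering → Column T → Ordering × Column T) :
    Ordering → List (Column T) → Ordering × List (Column T)
  | q, [] => (q, [])
  | q, c :: cs => ((mealy δ (δ q c).1 cs).1, (δ q c).2 :: (mealy δ (δ q c).1 cs).2)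

structure Data (T : ℕ) : Type where
  cols : List (Column T)
  inputPos : ℕ
  out : List Bool

def Op.exec {T : ℕ} {S : Type} (w : List Bool) : Op T S → Data T → S × Data T
  | .emit b s, d => (s, { d with out := d.out ++ b.toList })
  | .sweep δ q app nxt, d => (nxt (mealy δ q d.cols).1,
      { d with cols := (mealy δ q d.cols).2 ++ (app (mealy δ q d.cols).1).toList })
  | .advance a b, d => match Transducer.readInput w d.inputPos with
    | .rightEnd => (b, d)
    | _ => (a, { d with inputPos := Transducer.moveInput w d.inputPos .right })

theorem Op.exec_map {T : ℕ} {S S' : Type} (w : List Bool) (f : S → S') (o : Op T S) (d : Data T) :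
    (o.map f).exec w d = (f (o.exec w d).1, (o.exec w d).2) := by
  cases o with
  | emit b s => rfl
  | sweep δ q app nxt => rfl
  | advance a b =>
    simp only [Op.map, Op.exec]
    cases Transducer.readInput w d.inputPos <;> rfl

/-- A sweep takes two passes: `fwd` rewrites the tape, `back` returns to the left end and remembers
the final state of the automaton. `boot` writes the mark in cell `0` by which the returning head
recognises the left end. -/
inductive MachineState (S : Type) : Type
  | boot
  | rest (s : S)
  | fwd (s : S) (q : Ordering)
  | back (s : S) (q : Ordering)

instance : Finite Ordering :=
  Finite.of_surjective (fun i : Fin 3 => match i with | 0 => Ordering.lt | 1 => .eq | 2 => .gt) (by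
    intro o; cases o
    exacts [⟨0, rfl⟩, ⟨1, rfl⟩, ⟨2, rfl⟩])

instance {S : Type} [Finite S] : Finite (MachineState S) :=
  Finite.of_surjective (fun x : Option (S ⊕ (S × Ordering) ⊕ (S × Ordering)) => match x with
    | none => MachineState.boot
    | some (.inl s) => .rest s
    | some (.inr (.inl p)) => .fwd p.1 p.2
    | some (.inr (.inr p)) => .back p.1 p.2) (by
    intro o; cases o with
    | boot => exact ⟨none, rfl⟩
    | rest s => exact ⟨some (.inl s), rfl⟩
    | fwd s q => exact ⟨some (.inr (.inl (s, q))), rfl⟩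
    | back s q => exact ⟨some (.inr (.inr (s, q))), rfl⟩)

instance {T : ℕ} : Finite (Cell T) :=
  Finite.of_surjective (fun x : Option (Option (Column T)) => match x with
    | none => Cell.blank
    | some none => .mark
    | some (some c) => .col c) (by
    intro o; cases o with
    | blank => exact ⟨none, rfl⟩
    | mark => exact ⟨some none, rfl⟩
    | col c => exact ⟨some (some c), rfl⟩)

structure SweepMachine (T : ℕ) (S : Type) where
  start : S
  op : S → Option (Op T S)

/-! ### Simulation of sweeps by a Turing machine -/

namespace SweepMachine

variable {T : ℕ} {S : Type}

def step (M : SweepMachine T S) : MachineState S → InputSymbol → (Fin 1 → Cell T) →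
    Option (Action (MachineState S) (Cell T) 1)
  | .boot, _, _ => some ⟨.rest M.start, .stay, fun _ => .mark, fun _ => .stay, none⟩
  | .rest s, i, r => match M.op s with
    | none => none
    | some (.emit b s') => some ⟨.rest s', .stay, r, fun _ => .stay, b⟩
    | some (.sweep _ q _ _) => some ⟨.fwd s q, .stay, r, fun _ => .right, none⟩
    | some (.advance a b) => match i with
      | .rightEnd => some ⟨.rest b, .stay, r, fun _ => .stay, none⟩
      | _ => some ⟨.rest a, .right, r, fun _ => .stay, none⟩
  | .fwd s q, _, r => match M.op s with
    | some (.sweep δ _ app _) => match r 0 with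
      | .col c => some ⟨.fwd s (δ q c).1, .stay, fun _ => .col (δ q c).2, fun _ => .right, none⟩
      | _ => some ⟨.back s q, .stay, fun _ => match app q with | some c => .col c | none => .blank,
          fun _ => .left, none⟩
    | _ => none
  | .back s q, _, r => match M.op s with
    | some (.sweep _ _ _ nxt) => match r 0 with
      | .col _ => some ⟨.back s q, .stay, r, fun _ => .left, none⟩
      | _ => some ⟨.rest (nxt q), .stay, r, fun _ => .stay, none⟩
    | _ => none

def toTransducer [Finite S] (M : SweepMachine T S) : Transducer where
  State := MachineState S
  Symbol := Cell T
  finState := inferInstance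
  finSymbol := inferInstance
  tapes := 1
  blank := .blank
  start := .boot
  step := M.step

def tapeOf (cols : List (Column T)) : ℕ → Cell T
  | 0 => .mark
  | p + 1 => match cols[p]? with
    | some c => .col c
    | none => .blank

variable [Finite S]

def config (M : SweepMachine T S) (s : MachineState S) (h : ℕ) (d : Data T) :
    M.toTransducer.Config where
  state := s
  inputPos := d.inputPos
  head := fun _ => h
  tape := fun _ => tapeOf d.cols
  output := d.out

end SweepMachine

/-- The step relation between configurations whose work heads are within the space bound. -/
def Transducer.BoundedStep (M : Transducer) (w : List Bool) (s : ℕ) (a b : M.Config) : Prop :=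
  M.next w a = some b ∧ ∀ t, a.head t ≤ s

/-- The machine is deterministic, so every reachable configuration lies on the one run that leads to
the halting configuration. It is enough to exhibit that run with bounded heads. -/
theorem Transducer.computesInSpace_of_bounded {M : Transducer} {w y : List Bool} {s : ℕ}
    {c : M.Config} (h : Relation.ReflTransGen (M.BoundedStep w s) M.init c)
    (hc : M.next w c = none) (hs : ∀ t, c.head t ≤ s) (hy : c.output = y) :
    M.ComputesInSpace w y s := by
  refine ⟨⟨c, Relation.ReflTransGen.mono (fun a b hab => hab.1) _ _ h, hc, hy⟩,
    fun b hb => ?_⟩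
  have key : Relation.ReflTransGen (M.BoundedStep w s) b c := by
    induction hb with
    | refl => exact h
    | tail _ hbc ih =>
      rcases Relation.ReflTransGen.cases_head ih with rfl | ⟨e, he, hec⟩
      · rw [hc] at hbc; cases hbc
      · have := he.1.symm.trans hbc
        cases this
        exact hec
  rcases Relation.ReflTransGen.cases_head key with rfl | ⟨e, he, _⟩
  · exact hs
  · exact he.2

namespace SweepMachine

variable {T : ℕ} {S : Type}

theorem tapeOf_length (cs : List (Column T)) : tapeOf cs (cs.length + 1) = .blank := by
  simp [tapeOf]

theorem tapeOf_append (cs : List (Column T)) (c : Column T) (ds : List (Column T)) :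
    tapeOf (cs ++ c :: ds) (cs.length + 1) = .col c := by
  simp [tapeOf]

theorem update_tapeOf (cs : List (Column T)) (c c' : Column T) (ds : List (Column T)) :
    Function.update (tapeOf (cs ++ c :: ds)) (cs.length + 1) (.col c') =
      tapeOf (cs ++ c' :: ds) := by
  funext p
  rcases eq_or_ne p (cs.length + 1) with rfl | hp
  · simp [tapeOf]
  · rw [Function.update_of_ne hp]
    cases p with
    | zero => rfl
    | succ p =>
      have : p ≠ cs.length := fun h => hp (by rw [h])
      have e : (cs ++ c :: ds)[p]? = (cs ++ c' :: ds)[p]? := by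
        rcases Nat.lt_or_gt_of_ne this with h | h
        · rw [List.getElem?_append_left h, List.getElem?_append_left h]
        · rw [List.getElem?_append_right h.le, List.getElem?_append_right h.le]
          obtain ⟨r, hr⟩ : ∃ r, p - cs.length = r + 1 := ⟨p - cs.length - 1, by omega⟩
          rw [hr]; rfl
      simp [tapeOf, e]

theorem update_tapeOf_end (cs : List (Column T)) (o : Option (Column T)) :
    Function.update (tapeOf cs) (cs.length + 1)
      (match o with | some c => .col c | none => .blank) = tapeOf (cs ++ o.toList) := by
  funext p
  rcases eq_or_ne p (cs.length + 1) with rfl | hp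
  · cases o <;> simp [tapeOf]
  · rw [Function.update_of_ne hp]
    cases p with
    | zero => rfl
    | succ p =>
      have : p ≠ cs.length := fun h => hp (by rw [h])
      have e : cs[p]? = (cs ++ o.toList)[p]? := by
        rcases Nat.lt_or_gt_of_ne this with h | h
        · rw [List.getElem?_append_left h]
        · rw [List.getElem?_eq_none h.le, List.getElem?_eq_none]
          cases o <;> simp <;> omega
      simp [tapeOf, e]

variable [Finite S]

/-- Invariant of the forward pass: `cs` has been rewritten already, `ds` is still to be read. The
pass turns around at the first blank, where the new cell, if any, is written. -/
theorem fwd_path (M : SweepMachine T S) (w : List Bool) (s : S) {δ q₀ app nxt}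
    (hs : M.op s = some (.sweep δ q₀ app nxt)) (L ip : ℕ) (out : List Bool)
    (ds : List (Column T)) : ∀ (cs : List (Column T)) (q : Ordering),
    cs.length + ds.length ≤ L →
    Relation.ReflTransGen (M.toTransducer.BoundedStep w (L + 1))
      (M.config (.fwd s q) (cs.length + 1) ⟨cs ++ ds, ip, out⟩)
      (M.config (.back s (mealy δ q ds).1) (cs.length + ds.length)
        ⟨cs ++ (mealy δ q ds).2 ++ (app (mealy δ q ds).1).toList, ip, out⟩) := by
  induction ds with
  | nil =>
    intro cs q h
    refine Relation.ReflTransGen.single ⟨?_, fun _ => ?_⟩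
    · simp only [Transducer.next, config, toTransducer, step, hs, List.append_nil, mealy,
        tapeOf_length, Option.map_some, Transducer.moveInput, Transducer.moveHead, List.length_nil,
        Option.toList_none]
      rw [update_tapeOf_end]
      simp
    · simpa [config] using h
  | cons d ds ih =>
    intro cs q h
    have h' : (cs ++ [(δ q d).2]).length + ds.length ≤ L := by simp at h ⊢; omega
    have := ih (cs ++ [(δ q d).2]) (δ q d).1 h'
    refine Relation.ReflTransGen.head (b := M.config (.fwd s (δ q d).1)
      ((cs ++ [(δ q d).2]).length + 1) ⟨cs ++ [(δ q d).2] ++ ds, ip, out⟩) ⟨?_, fun _ => ?_⟩ ?_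
    · simp only [Transducer.next, config, toTransducer, step, hs, tapeOf_append, Option.map_some,
        Transducer.moveInput, Transducer.moveHead, Option.toList_none]
      rw [update_tapeOf]
      simp
    · simp [config] at h ⊢; omega
    · convert this using 2
      all_goals first
        | (simp [mealy]; done)
        | (simp; omega)

theorem back_path (M : SweepMachine T S) (w : List Bool) (s : S) {δ q₀ app nxt}
    (hs : M.op s = some (.sweep δ q₀ app nxt)) (L : ℕ) (d : Data T) (q : Ordering) :
    ∀ h : ℕ, h ≤ d.cols.length → h ≤ L + 1 →
    Relation.ReflTransGen (M.toTransducer.BoundedStep w (L + 1))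
      (M.config (.back s q) h d) (M.config (.rest (nxt q)) 0 d) := by
  intro h
  induction h with
  | zero =>
    intro _ _
    refine Relation.ReflTransGen.single ⟨?_, fun _ => by simp [config]⟩
    simp [Transducer.next, config, toTransducer, step, hs, tapeOf, Transducer.moveInput,
      Transducer.moveHead]
    funext t p; rcases eq_or_ne p 0 with rfl | hp <;> simp [tapeOf, *]
  | succ h ih =>
    intro h1 h2
    refine Relation.ReflTransGen.head ⟨?_, fun _ => by simpa [config] using h2⟩
      (ih (by omega) (by omega))
    have e : d.cols[h]? = some d.cols[h] := List.getElem?_eq_getElem (by omega)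
    simp [Transducer.next, config, toTransducer, step, hs, tapeOf, Transducer.moveInput,
      Transducer.moveHead, e]
    funext t p; rcases eq_or_ne p (h + 1) with rfl | hp <;> simp [tapeOf, *]

theorem exec_path (M : SweepMachine T S) (w : List Bool) (s : S) {o : Op T S}
    (hs : M.op s = some o) (L : ℕ) (d : Data T) (h1 : d.cols.length ≤ L) :
    Relation.ReflTransGen (M.toTransducer.BoundedStep w (L + 1))
      (M.config (.rest s) 0 d) (M.config (.rest (o.exec w d).1) 0 (o.exec w d).2) := by
  have hup : ∀ t : ℕ → Cell T, Function.update t 0 (t 0) = t := fun t => Function.update_eq_self 0 t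
  cases o with
  | emit b s' =>
    refine Relation.ReflTransGen.single ⟨?_, fun _ => by simp [config]⟩
    simp [Transducer.next, config, toTransducer, step, hs, Op.exec, Transducer.moveInput,
      Transducer.moveHead]
  | advance a b =>
    refine Relation.ReflTransGen.single ⟨?_, fun _ => by simp [config]⟩
    cases e : Transducer.readInput w d.inputPos <;>
    simp [Transducer.next, config, toTransducer, step, hs, Op.exec, Transducer.moveInput,
      Transducer.moveHead, e]
  | sweep δ q app nxt =>
    obtain ⟨cols, ip, out⟩ := d
    refine Relation.ReflTransGen.head (b := M.config (.fwd s q) 1 ⟨cols, ip, out⟩)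
      ⟨?_, fun _ => by simp [config]⟩ ?_
    · simp [Transducer.next, config, toTransducer, step, hs, Transducer.moveInput,
        Transducer.moveHead]
    · have p1 := fwd_path M w s hs L ip out cols [] q (by simpa using h1)
      have hl : ∀ (cs : List (Column T)) q, (mealy δ q cs).2.length = cs.length := by
        intro cs; induction cs with
        | nil => intro q; rfl
        | cons c cs ih => intro q; simp [mealy, ih]
      have p2 := back_path M w s hs L
        ⟨(mealy δ q cols).2 ++ (app (mealy δ q cols).1).toList, ip, out⟩ (mealy δ q cols).1
        cols.length (by simp [hl]) (by simp at h1; omega)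
      simpa [Op.exec] using p1.trans (by simpa using p2)

end SweepMachine

/-! ### Fragments of sweeping machines -/

/-- A sweeping machine with exits in `E`. -/
structure Frag (T : ℕ) (E : Type) : Type 1 where
  S : Type
  fin : Finite S
  start : S
  op : S → Op T (S ⊕ E)

namespace Frag

variable {T : ℕ} {E E' : Type}

/-- The tape length is bounded after every instruction, so that a run carries its space bound along
with the computation. -/
inductive Run (w : List Bool) (L : ℕ) (F : Frag T E) :
    F.S ⊕ E → Data T → E → Data T → Prop
  | exit (e : E) (d : Data T) : Run w L F (.inr e) d e d
  | step (s : F.S) (d : Data T) (e : E) (d' : Data T)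
      (hl : ((F.op s).exec w d).2.cols.length ≤ L)
      (h : Run w L F ((F.op s).exec w d).1 ((F.op s).exec w d).2 e d') : Run w L F (.inl s) d e d'

def atom (o : Op T E) : Frag T E := ⟨Unit, inferInstance, (), fun _ => o.map .inr⟩

theorem atom_run (w : List Bool) (L : ℕ) (o : Op T E) (d : Data T)
    (hl : (o.exec w d).2.cols.length ≤ L) :
    Run w L (atom o) (.inl (atom o).start) d (o.exec w d).1 (o.exec w d).2 := by
  refine Run.step _ _ _ _ ?_ ?_
  · simpa [atom, Op.exec_map] using hl
  · simp only [atom, Op.exec_map]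
    exact Run.exit _ _

/-- Run `F`, and then the fragment that the exit of `F` selects. -/
def bind [Finite E] (F : Frag T E) (K : E → Frag T E') : Frag T E' where
  S := F.S ⊕ Σ e, (K e).S
  fin := by
    have := F.fin
    have := fun e => (K e).fin
    infer_instance
  start := .inl F.start
  op := fun
    | .inl s => (F.op s).map fun
      | .inl s' => .inl (.inl s')
      | .inr e => .inl (.inr ⟨e, (K e).start⟩)
    | .inr ⟨e, s⟩ => ((K e).op s).map fun
      | .inl s' => .inl (.inr ⟨e, s'⟩)
      | .inr e' => .inr e'

theorem bind_run [Finite E] {w : List Bool} {L : ℕ} {F : Frag T E} {K : E → Frag T E'}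
    {d d' d'' : Data T} {e : E} {e' : E'} (h : Run w L F (.inl F.start) d e d')
    (h' : Run w L (K e) (.inl (K e).start) d' e' d'') :
    Run w L (F.bind K) (.inl (F.bind K).start) d e' d'' := by
  have key' : ∀ x d, Run w L (K e) x d e' d'' → Run w L (F.bind K) (match x with
      | .inl s' => .inl (.inr ⟨e, s'⟩)
      | .inr e' => .inr e') d e' d'' := by
    clear h h'
    intro x d h
    induction h with
    | exit e d => exact Run.exit _ _
    | step s d e' d' hl _ ih =>
      refine Run.step (F := F.bind K) _ _ _ _ ?_ ?_
      · simpa [bind, Op.exec_map] using hl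
      · simpa [bind, Op.exec_map] using ih
  have h2 := key' _ _ h'
  clear key' h'
  have key : ∀ x d f d1, Run w L F x d f d1 → f = e → d1 = d' → Run w L (F.bind K) (match x with
      | .inl s' => .inl (.inl s')
      | .inr e => .inl (.inr ⟨e, (K e).start⟩)) d e' d'' := by
    clear h
    intro x d f d1 h
    induction h with
    | exit f d => rintro rfl rfl; exact h2
    | step s d f d1 hl _ ih =>
      intro hf hd
      refine Run.step (F := F.bind K) _ _ _ _ ?_ ?_
      · simpa [bind, Op.exec_map] using hl
      · simpa [bind, Op.exec_map] using ih hf hd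
  exact key _ _ _ _ h rfl rfl

def iterExit (F : Frag T (Unit ⊕ E)) : F.S ⊕ (Unit ⊕ E) → F.S ⊕ E
  | .inl s' => .inl s'
  | .inr (.inl _) => .inl F.start
  | .inr (.inr e) => .inr e

/-- Repeat `F` until it takes an exit in `E`. -/
def iter (F : Frag T (Unit ⊕ E)) : Frag T E where
  S := F.S
  fin := F.fin
  start := F.start
  op := fun s => (F.op s).map F.iterExit

theorem iter_run_aux {w : List Bool} {L : ℕ} {F : Frag T (Unit ⊕ E)} {d d' d'' : Data T}
    {x : F.S ⊕ (Unit ⊕ E)} {f : Unit ⊕ E} {e : E} (h : Run w L F x d f d') :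
    Run w L F.iter (iterExit F (.inr f)) d' e d'' → Run w L F.iter (iterExit F x) d e d'' := by
  induction h with
  | exit f d => intro h'; cases f <;> exact h'
  | step s d f d1 hl _ ih =>
    intro h'
    refine Run.step (F := F.iter) _ _ _ _ ?_ ?_
    · simpa [iter, Op.exec_map] using hl
    · simpa [iter, Op.exec_map] using ih h'

theorem iter_run_continue {w : List Bool} {L : ℕ} {F : Frag T (Unit ⊕ E)} {d d' d'' : Data T}
    {e : E} (h : Run w L F (.inl F.start) d (.inl ()) d')
    (h' : Run w L F.iter (.inl F.iter.start) d' e d'') :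
    Run w L F.iter (.inl F.iter.start) d e d'' :=
  iter_run_aux h h'

theorem iter_run_break {w : List Bool} {L : ℕ} {F : Frag T (Unit ⊕ E)} {d d' : Data T}
    {e : E} (h : Run w L F (.inl F.start) d (.inr e) d') :
    Run w L F.iter (.inl F.iter.start) d e d' :=
  iter_run_aux h (Run.exit _ _)

def machine (F : Frag T E) : SweepMachine T (F.S ⊕ E) where
  start := .inl F.start
  op := fun
    | .inl s => some (F.op s)
    | .inr _ => none

theorem exists_transducer [Finite E] (F : Frag T E) : ∃ M : Transducer, ∀ (w y : List Bool) (L : ℕ)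
    (e : E) (d : Data T), d.out = y → Run w L F (.inl F.start) ⟨[], 0, []⟩ e d →
    M.ComputesInSpace w y (L + 1) := by
  have := F.fin
  refine ⟨F.machine.toTransducer, fun w y L e d hd h => ?_⟩
  have key : ∀ x d0 e d, Run w L F x d0 e d → d0.cols.length ≤ L →
      Relation.ReflTransGen (F.machine.toTransducer.BoundedStep w (L + 1))
        (F.machine.config (.rest x) 0 d0) (F.machine.config (.rest (.inr e)) 0 d) := by
    clear h
    intro x d0 e d h
    induction h with
    | exit e d => intro _; exact .refl
    | step s d0 e d hl _ ih =>
      intro h0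
      exact (SweepMachine.exec_path F.machine w (.inl s) rfl L d0 h0).trans (ih hl)
  -- The head of the path is the `boot` step, which turns the blank cell `0` into the mark.
  refine Transducer.computesInSpace_of_bounded (Relation.ReflTransGen.head ⟨?_, ?_⟩
    (key _ _ _ _ h (Nat.zero_le _))) ?_ ?_ hd
  · simp only [Transducer.next, Transducer.init, SweepMachine.toTransducer, SweepMachine.step,
      SweepMachine.config, Option.map_some, machine, Transducer.moveInput, Transducer.moveHead,
      Option.toList_none, List.append_nil]
    congr 2
    funext t p
    rcases eq_or_ne p 0 with rfl | hp
    · simp [SweepMachine.tapeOf]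
    · obtain ⟨p, rfl⟩ := Nat.exists_eq_succ_of_ne_zero hp
      simp [SweepMachine.tapeOf]
  · intro t; simp [Transducer.init]
  · simp [Transducer.next, SweepMachine.config, SweepMachine.toTransducer, SweepMachine.step,
      machine]
  · intro t; simp [SweepMachine.config]

end Frag

/-! ### Binary numbers on tracks -/

namespace Column

variable {T : ℕ}

def bit (c : Column T) (x : ℕ) : Bool := if h : x < T then c ⟨x, h⟩ else false

def setBit (c : Column T) (x : ℕ) (b : Bool) : Column T := fun i => if i.val = x then b else c i

theorem bit_setBit (c : Column T) {x : ℕ} (hx : x < T) (b : Bool) (y : ℕ) :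
    bit (setBit c x b) y = if y = x then b else bit c y := by
  unfold bit setBit
  by_cases hy : y < T
  · simp [hy]
  · have : y ≠ x := by omega
    simp [hy, this]

theorem bit_setBit_false (c : Column T) (x y : ℕ) :
    bit (setBit c x false) y = if y = x then false else bit c y := by
  unfold bit setBit
  by_cases hy : y < T <;> simp [hy]

/-- The number on track `x`, least significant bit first. -/
def value : List (Column T) → ℕ → ℕ
  | [], _ => 0
  | c :: cs, x => (bit c x).toNat + 2 * value cs x

/-- State `.gt` means that a carry is pending, `.lt` that it has been absorbed. -/
def incStep (x : ℕ) : Ordering → Column T → Ordering × Column T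
  | .gt, c => if bit c x then (.gt, setBit c x false) else (.lt, setBit c x true)
  | q, c => (q, c)

def incEnd (x : ℕ) : Ordering → Option (Column T)
  | .gt => some (setBit (fun _ => false) x true)
  | _ => none

theorem mealy_incStep_lt (x : ℕ) (cs : List (Column T)) :
    mealy (incStep x) .lt cs = (.lt, cs) := by
  induction cs with
  | nil => rfl
  | cons c cs ih => simp [mealy, incStep, ih]

theorem value_inc {x : ℕ} (hx : x < T) (cs : List (Column T)) :
    value ((mealy (incStep x) .gt cs).2 ++ (incEnd x (mealy (incStep x) .gt cs).1).toList) =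
      Function.update (value cs) x (value cs x + 1) := by
  funext y
  induction cs with
  | nil =>
    simp only [mealy, incEnd, value, Option.toList_some, List.nil_append, bit_setBit _ hx]
    by_cases h : y = x <;> simp [bit, h]
  | cons c cs ih =>
    by_cases hc : bit c x
    · simp [mealy, incStep, hc, value, bit_setBit_false, Function.update_apply] at ih ⊢
      rw [ih]
      by_cases h : y = x
      · simp [h]; ring
      · simp [h]
    · simp [mealy, incStep, hc, value, bit_setBit _ hx, Function.update_apply,
        mealy_incStep_lt, incEnd]
      by_cases h : y = x
      · subst h; simp [hc]; ring
      · simp [h]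

/-- The tape grows only if the carry survives, that is, if all bits of track `x` are 1. Then the new
value is `2 ^ cs.length`, and as it is at most `B`, the old length is at most `Nat.log 2 B`. -/
theorem length_inc {x : ℕ} (cs : List (Column T)) {B : ℕ}
    (hl : cs.length ≤ Nat.log 2 B + 1) (hB : value cs x + 1 ≤ B) :
    ((mealy (incStep x) .gt cs).2 ++ (incEnd x (mealy (incStep x) .gt cs).1).toList).length ≤
      Nat.log 2 B + 1 := by
  have key : (mealy (incStep x) .gt cs).2.length = cs.length ∧
      ((mealy (incStep x) .gt cs).1 = .lt ∨ (mealy (incStep x) .gt cs).1 = .gt ∧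
        value cs x + 1 = 2 ^ cs.length) := by
    clear hl hB
    induction cs with
    | nil => simp [mealy, value]
    | cons c cs ih =>
      by_cases hc : bit c x
      · simp only [mealy, incStep, hc, if_true, List.length_cons, value, Bool.toNat_true]
        refine ⟨by rw [ih.1], ih.2.imp id fun h => ⟨h.1, ?_⟩⟩
        rw [pow_succ, ← h.2]; ring
      · simp [mealy, incStep, hc, mealy_incStep_lt]
  rcases key with ⟨h1, h2 | ⟨h2, h3⟩⟩
  · rw [h2]; simpa [incEnd, h1] using hl
  · rw [h2]
    have : cs.length ≤ Nat.log 2 B := Nat.le_log_of_pow_le one_lt_two (h3 ▸ hB)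
    simpa [incEnd, h1] using this

/-- The least significant bits come first, so a later difference overrides the verdict of the
earlier ones. -/
def cmpStep (x y : ℕ) (q : Ordering) (c : Column T) : Ordering × Column T :=
  (if bit c x = bit c y then q else if bit c y then .lt else .gt, c)

theorem mealy_cmpStep (x y : ℕ) (cs : List (Column T)) (q : Ordering) :
    mealy (cmpStep x y) q cs = (if value cs x < value cs y then .lt
      else if value cs y < value cs x then .gt else q, cs) := by
  induction cs generalizing q with
  | nil => simp [mealy, value]
  | cons c cs ih =>
    simp only [mealy, cmpStep, ih, value]
    refine congrArg (·, c :: cs) ?_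
    have key : ∀ (a b : Bool) (u v : ℕ), (if u < v then Ordering.lt else if v < u then .gt else
        if a = b then q else if b then .lt else .gt) = if a.toNat + 2 * u < b.toNat + 2 * v then .lt
          else if b.toNat + 2 * v < a.toNat + 2 * u then .gt else q := by
      intro a b u v
      cases a <;> cases b <;> simp only [Bool.toNat_true, Bool.toNat_false] <;>
        split_ifs <;> first | rfl | omega | simp_all
    exact key _ _ _ _

/-- The states count the ones seen so far: `.lt` none, `.eq` exactly one, `.gt` more. Powers of two
are the numbers with exactly one binary digit 1. -/
def powStep (x : ℕ) (q : Ordering) (c : Column T) : Ordering × Column T :=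
  (if bit c x then (if q = .lt then .eq else .gt) else q, c)

theorem mealy_powStep_snd (x : ℕ) (cs : List (Column T)) (q : Ordering) :
    (mealy (powStep x) q cs).2 = cs := by
  induction cs generalizing q with
  | nil => rfl
  | cons c cs ih => simp [mealy, powStep, ih]

theorem mealy_powStep_gt (x : ℕ) (cs : List (Column T)) :
    (mealy (powStep x) .gt cs).1 = .gt := by
  induction cs with
  | nil => rfl
  | cons c cs ih => simp [mealy, powStep, ih]

theorem mealy_powStep_eq (x : ℕ) (cs : List (Column T)) :
    (mealy (powStep x) .eq cs).1 = .eq ↔ value cs x = 0 := by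
  induction cs with
  | nil => simp [mealy, value]
  | cons c cs ih =>
    cases hb : bit c x
    · simp [mealy, powStep, hb, value, ih]
    · simp [mealy, powStep, hb, value, mealy_powStep_gt]

theorem mealy_powStep_lt (x : ℕ) (cs : List (Column T)) :
    (mealy (powStep x) .lt cs).1 = .eq ↔ ∃ i, value cs x = 2 ^ i := by
  induction cs with
  | nil => simpa [mealy, value] using fun i => (Nat.two_pow_pos i).ne
  | cons c cs ih =>
    cases hb : bit c x
    · have e : (mealy (powStep x) .lt (c :: cs)).1 = (mealy (powStep x) .lt cs).1 := by
        simp [mealy, powStep, hb]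
      rw [e, ih]
      simp only [hb, value, Bool.toNat_false, zero_add]
      constructor
      · rintro ⟨i, hi⟩; exact ⟨i + 1, by rw [hi, pow_succ]; ring⟩
      · rintro ⟨i, hi⟩
        cases i with
        | zero => omega
        | succ i => exact ⟨i, by rw [pow_succ] at hi; omega⟩
    · have e : (mealy (powStep x) .lt (c :: cs)).1 = (mealy (powStep x) .eq cs).1 := by
        simp [mealy, powStep, hb]
      rw [e, mealy_powStep_eq]
      simp only [hb, value, Bool.toNat_true]
      constructor
      · intro h; exact ⟨0, by simp [h]⟩
      · rintro ⟨i, hi⟩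
        cases i with
        | zero => omega
        | succ i => rw [pow_succ] at hi; omega

def clearStep (x : ℕ) (q : Ordering) (c : Column T) : Ordering × Column T := (q, setBit c x false)

theorem mealy_clearStep (x : ℕ) (cs : List (Column T)) (q : Ordering) :
    value (mealy (clearStep x) q cs).2 = Function.update (value cs) x 0 ∧
      (mealy (clearStep x) q cs).2.length = cs.length := by
  induction cs with
  | nil => refine ⟨?_, rfl⟩; funext y; simp [mealy, value, Function.update_apply]
  | cons c cs ih =>
    refine ⟨?_, by simp [mealy, clearStep, ih.2]⟩
    funext y
    simp only [mealy, clearStep, value, bit_setBit_false, Function.update_apply] at ih ⊢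
    rw [ih.1]
    simp only [Function.update_apply]
    split_ifs <;> simp

def moveStep (x y : ℕ) (q : Ordering) (c : Column T) : Ordering × Column T :=
  (q, setBit (setBit c y (bit c x)) x false)

theorem mealy_moveStep (x : ℕ) {y : ℕ} (hy : y < T) (cs : List (Column T)) (q : Ordering) :
    value (mealy (moveStep x y) q cs).2 =
        Function.update (Function.update (value cs) y (value cs x)) x 0 ∧
      (mealy (moveStep x y) q cs).2.length = cs.length := by
  induction cs with
  | nil => refine ⟨?_, rfl⟩; funext z; simp [mealy, value, Function.update_apply]
  | cons c cs ih =>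
    refine ⟨?_, by simp [mealy, moveStep, ih.2]⟩
    funext z
    simp only [mealy, moveStep, value, bit_setBit_false, bit_setBit _ hy, Function.update_apply]
    rw [ih.1]
    simp only [Function.update_apply]
    split_ifs <;> simp

end Column

/-! ### A language of loops -/

inductive Test : Type
  | lt (x y : ℕ) | eq (x y : ℕ) | pow2 (x : ℕ)

namespace Test

def Holds (ρ : ℕ → ℕ) : Test → Prop
  | lt x y => ρ x < ρ y
  | eq x y => ρ x = ρ y
  | pow2 x => ∃ i, ρ x = 2 ^ i

def map (f : ℕ → ℕ) : Test → Test
  | lt x y => lt (f x) (f y)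
  | eq x y => eq (f x) (f y)
  | pow2 x => pow2 (f x)

theorem holds_map (f : ℕ → ℕ) (ρ : ℕ → ℕ) (t : Test) :
    (t.map f).Holds ρ ↔ t.Holds fun x => ρ (f x) := by
  cases t <;> rfl

end Test

/-- Programs that write bits. In a program at level `n` the variables `0, …, n-1` are bound;
`loop y P` and `count P Q` bind the variable `n`, to the numbers below `y` one after the other, and
to the number of bits that `P` writes (truncated to the value of variable `0`). -/
inductive Prog : Type
  | skip
  | emit (b : Bool)
  | seq (P Q : Prog)
  | ite (t : Test) (P Q : Prog)
  | loop (y : ℕ) (P : Prog)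
  | count (P Q : Prog)

namespace Prog

-- The truncation in `count` keeps every variable within the space bound, whatever the length of the
-- counted output. The counted program runs one level higher, so that its own loops leave variable
-- `n` alone.
open Classical in
noncomputable def out : Prog → ℕ → (ℕ → ℕ) → List Bool
  | skip, _, _ => []
  | emit b, _, _ => [b]
  | seq P Q, n, ρ => P.out n ρ ++ Q.out n ρ
  | ite t P Q, n, ρ => if t.Holds ρ then P.out n ρ else Q.out n ρ
  | loop y P, n, ρ => (List.range (ρ y)).flatMap fun v => P.out (n + 1) (Function.update ρ n v)
  | count P Q, n, ρ =>
      Q.out (n + 1) (Function.update ρ n (min (P.out (n + 1) ρ).length (ρ 0)))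

/-- The nesting depth of binders, which determines how many tracks the compiled program needs. -/
def levels : Prog → ℕ
  | skip => 0
  | emit _ => 0
  | seq P Q => max P.levels Q.levels
  | ite _ P Q => max P.levels Q.levels
  | loop _ P => P.levels + 1
  | count P Q => max P.levels Q.levels + 1

end Prog

/-! ### Machine fragments for arithmetic on tracks -/

namespace Frag

open Column

variable {T : ℕ}

def emitF (b : Option Bool) : Frag T Unit := atom (.emit b ())

def incF (x : ℕ) : Frag T Unit := atom (.sweep (incStep x) .gt (incEnd x) fun _ => ())

def clearF (x : ℕ) : Frag T Unit := atom (.sweep (clearStep x) .eq (fun _ => none) fun _ => ())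

def moveF (x y : ℕ) : Frag T Unit :=
  atom (.sweep (moveStep x y) .eq (fun _ => none) fun _ => ())

def testF : Test → Frag T Bool
  | .lt x y => atom (.sweep (cmpStep x y) .eq (fun _ => none) fun q => q = .lt)
  | .eq x y => atom (.sweep (cmpStep x y) .eq (fun _ => none) fun q => q = .eq)
  | .pow2 x => atom (.sweep (powStep x) .lt (fun _ => none) fun q => q = .eq)

def advanceF : Frag T Bool := atom (.advance true false)

/-- A run in terms of the numbers on the tracks. -/
def Runs {E : Type} (w : List Bool) (B : ℕ) (F : Frag T E) (s : (ℕ → ℕ) × List Bool) (p : ℕ)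
    (e : E) (s' : (ℕ → ℕ) × List Bool) (p' : ℕ) : Prop :=
  ∀ cols, value cols = s.1 → cols.length ≤ Nat.log 2 B + 1 →
    ∃ cols', value cols' = s'.1 ∧ cols'.length ≤ Nat.log 2 B + 1 ∧
      Run w (Nat.log 2 B + 1) F (.inl F.start) ⟨cols, p, s.2⟩ e ⟨cols', p', s'.2⟩

variable {E E' : Type} {w : List Bool} {B : ℕ} {s s' s'' : (ℕ → ℕ) × List Bool} {p p' p'' : ℕ}

theorem Runs.bind [Finite E] {F : Frag T E} {K : E → Frag T E'} {e e'} (h : F.Runs w B s p e s' p')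
    (h' : (K e).Runs w B s' p' e' s'' p'') : (F.bind K).Runs w B s p e' s'' p'' := by
  intro cols hv hl
  obtain ⟨c1, h1, l1, r1⟩ := h cols hv hl
  obtain ⟨c2, h2, l2, r2⟩ := h' c1 h1 l1
  exact ⟨c2, h2, l2, bind_run r1 r2⟩

theorem Runs.iter_continue {F : Frag T (Unit ⊕ E)} {e : E} (h : F.Runs w B s p (.inl ()) s' p')
    (h' : F.iter.Runs w B s' p' e s'' p'') : F.iter.Runs w B s p e s'' p'' := by
  intro cols hv hl
  obtain ⟨c1, h1, l1, r1⟩ := h cols hv hl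
  obtain ⟨c2, h2, l2, r2⟩ := h' c1 h1 l1
  exact ⟨c2, h2, l2, iter_run_continue r1 r2⟩

theorem Runs.iter_break {F : Frag T (Unit ⊕ E)} {e : E} (h : F.Runs w B s p (.inr e) s' p') :
    F.iter.Runs w B s p e s' p' := by
  intro cols hv hl
  obtain ⟨c1, h1, l1, r1⟩ := h cols hv hl
  exact ⟨c1, h1, l1, iter_run_break r1⟩

theorem atom_runs {o : Op T E} {e : E} (h : ∀ cols, value cols = s.1 →
    cols.length ≤ Nat.log 2 B + 1 → ∃ cols', value cols' = s'.1 ∧ cols'.length ≤ Nat.log 2 B + 1 ∧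
      o.exec w ⟨cols, p, s.2⟩ = (e, ⟨cols', p', s'.2⟩)) : (atom o).Runs w B s p e s' p' := by
  intro cols hv hl
  obtain ⟨c1, h1, l1, r1⟩ := h cols hv hl
  have := atom_run w (Nat.log 2 B + 1) o ⟨cols, p, s.2⟩ (by rw [r1]; exact l1)
  rw [r1] at this
  exact ⟨c1, h1, l1, this⟩

theorem emitF_runs (b : Option Bool) :
    (emitF (T := T) b).Runs w B s p () (s.1, s.2 ++ b.toList) p :=
  atom_runs fun cols hv hl => ⟨cols, hv, hl, rfl⟩

theorem incF_runs {x : ℕ} (hx : x < T) (hB : s.1 x + 1 ≤ B) :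
    (incF (T := T) x).Runs w B s p () (Function.update s.1 x (s.1 x + 1), s.2) p :=
  atom_runs fun cols hv hl => ⟨_, by rw [value_inc hx, hv], length_inc cols hl (by rwa [hv]), rfl⟩

theorem clearF_runs (x : ℕ) :
    (clearF (T := T) x).Runs w B s p () (Function.update s.1 x 0, s.2) p :=
  atom_runs fun cols hv hl => ⟨(mealy (clearStep x) .eq cols).2,
    by rw [(mealy_clearStep x cols _).1, hv], by rwa [(mealy_clearStep x cols _).2],
    by simp [Op.exec]⟩

theorem moveF_runs (x : ℕ) {y : ℕ} (hy : y < T) : (moveF (T := T) x y).Runs w B s p ()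
    (Function.update (Function.update s.1 y (s.1 x)) x 0, s.2) p :=
  atom_runs fun cols hv hl => ⟨(mealy (moveStep x y) .eq cols).2,
    by rw [(mealy_moveStep x hy cols _).1, hv], by rwa [(mealy_moveStep x hy cols _).2],
    by simp [Op.exec]⟩

open Classical in
theorem testF_runs (t : Test) : (testF (T := T) t).Runs w B s p (decide (t.Holds s.1)) s p := by
  cases t with
  | lt x y =>
    refine atom_runs fun cols hv hl => ⟨cols, hv, hl, ?_⟩
    have hs : decide (Test.Holds s.1 (.lt x y)) = decide (value cols x < value cols y) := by
      rw [hv]; exact decide_eq_decide.2 Iff.rfl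
    simp only [Op.exec, mealy_cmpStep, hs, Option.toList_none, List.append_nil]
    congr 1
    split_ifs <;> simp <;> omega
  | eq x y =>
    refine atom_runs fun cols hv hl => ⟨cols, hv, hl, ?_⟩
    simp only [Op.exec, mealy_cmpStep, Test.Holds, Option.toList_none, List.append_nil, ← hv]
    congr 1
    split_ifs <;> simp <;> omega
  | pow2 x =>
    refine atom_runs fun cols hv hl => ⟨cols, hv, hl, ?_⟩
    simp only [Op.exec, mealy_powStep_lt, mealy_powStep_snd, Test.Holds, Option.toList_none,
      List.append_nil, ← hv]

theorem advanceF_runs_true (h : Transducer.readInput w p ≠ .rightEnd) :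
    (advanceF (T := T)).Runs w B s p true s (Transducer.moveInput w p .right) :=
  atom_runs fun cols hv hl => ⟨cols, hv, hl, by
    simp only [Op.exec]⟩

theorem advanceF_runs_false (h : Transducer.readInput w p = .rightEnd) :
    (advanceF (T := T)).Runs w B s p false s p :=
  atom_runs fun cols hv hl => ⟨cols, hv, hl, by simp [Op.exec, h]⟩

end Frag

/-! ### Compilation of loop programs -/

namespace Prog

open Frag

/-- What happens to the bits that a program writes: they are written, or they are counted on
track `2 * x + 1`. -/
def deliver (mode : Option ℕ) (l : List Bool) (s : (ℕ → ℕ) × List Bool) :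
    (ℕ → ℕ) × List Bool :=
  match mode with
  | none => (s.1, s.2 ++ l)
  | some x => (Function.update s.1 (2 * x + 1) (min (s.1 (2 * x + 1) + l.length) (s.1 0)), s.2)

def emitMode (T : ℕ) (b : Bool) : Option ℕ → Frag T Unit
  | none => emitF (some b)
  | some x => (testF (.lt (2 * x + 1) 0)).bind fun r => if r then incF (2 * x + 1) else emitF none

/-- The value of variable `x` is on track `2 * x`. -/
def compile (T : ℕ) : Prog → ℕ → Option ℕ → Frag T Unit
  | skip, _, _ => emitF none
  | emit b, _, mode => emitMode T b mode
  | seq P Q, n, mode => (P.compile T n mode).bind fun _ => Q.compile T n mode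
  | ite t P Q, n, mode => (testF (t.map (2 * ·))).bind fun r =>
      if r then P.compile T n mode else Q.compile T n mode
  | loop y P, n, mode => Frag.iter ((testF (.lt (2 * n) (2 * y))).bind fun r =>
      if r then ((P.compile T (n + 1) mode).bind fun _ => (incF (2 * n)).bind fun _ =>
        atom (.emit none (.inl ())))
      else (clearF (2 * n)).bind fun _ => atom (.emit none (.inr ())))
  | count P Q, n, mode => (P.compile T (n + 1) (some n)).bind fun _ =>
      (moveF (2 * n + 1) (2 * n)).bind fun _ => (Q.compile T (n + 1) mode).bind fun _ =>
        clearF (2 * n)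

/-- The tracks of a program at level `n`. -/
structure Ready (B n : ℕ) (mode : Option ℕ) (σ : ℕ → ℕ) : Prop where
  pos : 0 < n
  val : ∀ x, n ≤ x → σ (2 * x) = 0
  scratch : ∀ x, n ≤ x → σ (2 * x + 1) = 0
  le : ∀ x, σ x ≤ B
  mode_lt : ∀ x, mode = some x → x < n ∧ σ (2 * x + 1) ≤ σ 0

theorem Ready.deliver {B n : ℕ} {mode : Option ℕ} {s : (ℕ → ℕ) × List Bool}
    (h : Ready B n mode s.1) (l : List Bool) : Ready B n mode (deliver mode l s).1 := by
  cases mode with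
  | none => exact h
  | some y =>
    have hy := h.mode_lt y rfl
    refine ⟨h.pos, fun x hx => ?_, fun x hx => ?_, fun x => ?_, fun x hx => ?_⟩
    · simp only [Prog.deliver]
      rw [Function.update_of_ne (by omega)]; exact h.val x hx
    · simp only [Prog.deliver]
      rw [Function.update_of_ne (by omega)]; exact h.scratch x hx
    · simp only [Prog.deliver, Function.update_apply]
      have := h.le 0
      have := h.le x
      split_ifs <;> omega
    · cases hx
      simp [Prog.deliver, hy.1]

theorem Ready.update {B n v : ℕ} {mode : Option ℕ} {σ : ℕ → ℕ}
    (h : Ready B n mode σ) (hv : v ≤ B) : Ready B (n + 1) mode (Function.update σ (2 * n) v) := by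
  have hp := h.pos
  refine ⟨by omega, fun x hx => ?_, fun x hx => ?_, fun x => ?_, fun x hx => ?_⟩
  · rw [Function.update_of_ne (by omega)]; exact h.val x (by omega)
  · rw [Function.update_of_ne (by omega)]; exact h.scratch x (by omega)
  · rw [Function.update_apply]; split_ifs
    · exact hv
    · exact h.le x
  · have := h.mode_lt x hx
    rw [Function.update_of_ne (by omega), Function.update_of_ne (by omega)]
    exact ⟨by omega, this.2⟩

theorem Ready.le_zero {B n : ℕ} {mode : Option ℕ} {σ : ℕ → ℕ} (h : Ready B n mode σ) (x : ℕ)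
    (hx : mode = some x) : σ (2 * x + 1) ≤ σ 0 := (h.mode_lt x hx).2

theorem deliver_nil {B n : ℕ} {mode : Option ℕ} {s : (ℕ → ℕ) × List Bool}
    (h : Ready B n mode s.1) : deliver mode [] s = s := by
  cases mode with
  | none => simp [deliver]
  | some x =>
    have := h.le_zero x rfl
    simp [deliver, min_eq_left this]

theorem deliver_append (mode : Option ℕ) (l l' : List Bool) (s : (ℕ → ℕ) × List Bool) :
    deliver mode (l ++ l') s = deliver mode l' (deliver mode l s) := by
  cases mode with
  | none => simp [deliver]
  | some x =>
    simp only [deliver, List.length_append, Function.update_self, Function.update_idem]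
    rw [Function.update_of_ne (by omega)]
    congr 2
    omega

theorem deliver_update {mode : Option ℕ} {n : ℕ} (hn : 0 < n) (l : List Bool)
    (s : (ℕ → ℕ) × List Bool) (v : ℕ) :
    deliver mode l (Function.update s.1 (2 * n) v, s.2) =
      (Function.update (deliver mode l s).1 (2 * n) v, (deliver mode l s).2) := by
  cases mode with
  | none => rfl
  | some x =>
    simp only [deliver]
    rw [Function.update_comm (by omega), Function.update_of_ne (by omega),
      Function.update_of_ne (by omega)]

theorem deliver_even {mode : Option ℕ} (l : List Bool) (s : (ℕ → ℕ) × List Bool) (x : ℕ) :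
    (deliver mode l s).1 (2 * x) = s.1 (2 * x) := by
  cases mode with
  | none => rfl
  | some y => simp only [deliver]; rw [Function.update_of_ne (by omega)]

theorem emitMode_runs {T B n : ℕ} {w : List Bool} {p : ℕ} {mode : Option ℕ}
    {s : (ℕ → ℕ) × List Bool} (h : Ready B n mode s.1) (hT : 2 * n ≤ T) (b : Bool) :
    (emitMode T b mode).Runs w B s p () (deliver mode [b] s) p := by
  cases mode with
  | none => exact emitF_runs _
  | some x =>
    have hx := h.mode_lt x rfl
    refine (testF_runs _).bind ?_
    by_cases hlt : s.1 (2 * x + 1) < s.1 0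
    · simp only [Test.Holds, hlt, decide_true, if_true, deliver]
      rw [min_eq_left (by simp; omega)]
      exact incF_runs (by omega) (by have := h.le 0; omega)
    · simp only [Test.Holds, hlt, decide_false, deliver]
      rw [min_eq_right (by simp; omega)]
      have : s.1 0 = s.1 (2 * x + 1) := by omega
      rw [this, Function.update_eq_self]
      simpa using emitF_runs (T := T) (w := w) (B := B) (s := s) (p := p) none

/-- Induction on the program with the invariant `Ready`: all tracks from level `n` on are zero at
the start, and every binder clears its track at the end. Hence a loop body can be entered again
without initialisation, and the only lasting effect is that of `deliver`. -/
theorem compile_runs {T B : ℕ} {w : List Bool} {p : ℕ} (P : Prog) :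
    ∀ (n : ℕ) (mode : Option ℕ) (s : (ℕ → ℕ) × List Bool), Ready B n mode s.1 →
      2 * (n + P.levels) ≤ T →
      (P.compile T n mode).Runs w B s p () (deliver mode (P.out n fun x => s.1 (2 * x)) s) p := by
  induction P with
  | skip =>
    intro n mode s h hT
    simp only [out, deliver_nil h, compile]
    simpa using emitF_runs (T := T) (w := w) (B := B) (s := s) (p := p) none
  | emit b => intro n mode s h hT; exact emitMode_runs h (by omega) b
  | seq P Q ihP ihQ =>
    intro n mode s h hT
    simp only [levels] at hT
    have h2 := ihQ n mode _ (h.deliver (P.out n fun x => s.1 (2 * x))) (by omega)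
    simp only [deliver_even] at h2
    simp only [out, deliver_append]
    exact (ihP n mode s h (by omega)).bind h2
  | ite t P Q ihP ihQ =>
    intro n mode s h hT
    simp only [levels] at hT
    refine (testF_runs _).bind ?_
    by_cases ht : t.Holds fun x => s.1 (2 * x)
    · have ht' := (Test.holds_map (2 * ·) s.1 t).2 ht
      simp only [ht', decide_true, if_true, out, if_pos ht]; exact ihP n mode s h (by omega)
    · have ht' := mt (Test.holds_map (2 * ·) s.1 t).1 ht
      simp only [ht', decide_false, out, if_neg ht]; exact ihQ n mode s h (by omega)
  | loop y P ih =>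
    intro n mode s h hT
    simp only [levels] at hT
    have hn := h.pos
    simp only [out, compile]
    have hexit : ∀ (s : (ℕ → ℕ) × List Bool) (v : ℕ), s.1 (2 * n) = 0 →
        ((clearF (T := T) (2 * n)).bind fun _ => atom (.emit none (.inr ()))).Runs w B
          (Function.update s.1 (2 * n) v, s.2) p (.inr () : Unit ⊕ Unit) s p := by
      intro s v hs
      refine (clearF_runs _).bind (atom_runs fun cols hv hl => ⟨cols, ?_, hl, by simp [Op.exec]⟩)
      rw [hv]
      simp only [Function.update_idem]
      conv_lhs => rw [← hs, Function.update_eq_self]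
    have hs0 : s.1 (2 * n) = 0 := h.val n le_rfl
    -- A loop may be bounded by its own variable. Its track is zero on entry, so program and machine
    -- agree on no iterations. In the other case the loop does not change its bound.
    by_cases hy : y = n
    · subst hy
      rw [hs0, List.range_zero, List.flatMap_nil, deliver_nil h]
      refine Runs.iter_break ((testF_runs _).bind ?_)
      simp only [Test.Holds, lt_self_iff_false, decide_false]
      have := hexit s 0 hs0
      rwa [← hs0, Function.update_eq_self] at this
    -- Loop invariant: the loop variable is `v`, and `r` iterations are left.
    · have key : ∀ (r v : ℕ) (s : (ℕ → ℕ) × List Bool), Ready B n mode s.1 →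
          v + r = s.1 (2 * y) → (compile T (loop y P) n mode).Runs w B
            (Function.update s.1 (2 * n) v, s.2) p ()
            (deliver mode ((List.range' v r).flatMap fun v =>
              P.out (n + 1) (Function.update (fun x => s.1 (2 * x)) n v)) s) p := by
        intro r
        induction r with
        | zero =>
          intro v s h hv
          refine Runs.iter_break ((testF_runs _).bind ?_)
          have : ¬ Test.Holds (Function.update s.1 (2 * n) v, s.2).1 (.lt (2 * n) (2 * y)) := by
            simp only [Test.Holds, Function.update_self]
            rw [Function.update_of_ne (by omega)]; omega
          simp only [this, decide_false, List.range'_zero, List.flatMap_nil, deliver_nil h]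
          exact hexit s v (h.val n le_rfl)
        | succ r ihr =>
          intro v s h hv
          have hB := h.le (2 * y)
          have ht : Test.Holds (Function.update s.1 (2 * n) v, s.2).1 (.lt (2 * n) (2 * y)) := by
            simp only [Test.Holds, Function.update_self]
            rw [Function.update_of_ne (by omega)]; omega
          have h1 := ih (n + 1) mode (Function.update s.1 (2 * n) v, s.2)
            (h.update (by omega)) (by omega)
          have he : (fun x => Function.update s.1 (2 * n) v (2 * x)) =
              Function.update (fun x => s.1 (2 * x)) n v := by
            funext x
            simp only [Function.update_apply]
            split_ifs <;> first | rfl | omega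
          simp only [he] at h1
          rw [deliver_update hn] at h1
          have h2 := ihr (v + 1) _ (h.deliver (P.out (n + 1)
            (Function.update (fun x => s.1 (2 * x)) n v))) (by rw [deliver_even]; omega)
          simp only [deliver_even] at h2
          rw [List.range'_succ, List.flatMap_cons, deliver_append]
          refine Runs.iter_continue ((testF_runs _).bind ?_) h2
          simp only [ht, decide_true, if_true]
          refine h1.bind ((incF_runs (by omega) ?_).bind
            (atom_runs fun cols hv hl => ⟨cols, ?_, hl, by simp [Op.exec]⟩))
          · simp; omega
          · rw [hv]; simp
      have := key (s.1 (2 * y)) 0 s h (by omega)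
      rw [List.range_eq_range']
      rwa [← hs0, Function.update_eq_self, hs0] at this
  | count P Q ihP ihQ =>
    intro n mode s h hT
    simp only [levels] at hT
    have hn := h.pos
    have hs0 : s.1 (2 * n) = 0 := h.val n le_rfl
    have hs1 : s.1 (2 * n + 1) = 0 := h.scratch n le_rfl
    set c := min (P.out (n + 1) fun x => s.1 (2 * x)).length (s.1 0) with hc
    -- The bits of `P` are counted on track `2 * n + 1`, which is still zero at this level; the mode
    -- of the surrounding program is suspended meanwhile, so nested counts do not interfere.
    have h1 := ihP (n + 1) (some n) s ⟨by omega, fun x hx => h.val x (by omega),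
      fun x hx => h.scratch x (by omega), h.le, by rintro x hx; cases hx; exact ⟨by omega, by omega⟩⟩
      (by omega)
    have hcB : c ≤ B := by have := h.le 0; omega
    have h3 := ihQ (n + 1) mode (Function.update s.1 (2 * n) c, s.2) (h.update hcB) (by omega)
    have he : (fun x => Function.update s.1 (2 * n) c (2 * x)) =
        Function.update (fun x => s.1 (2 * x)) n c := by
      funext x
      simp only [Function.update_apply]
      split_ifs <;> first | rfl | omega
    simp only [he] at h3
    rw [deliver_update hn] at h3
    have h4 := clearF_runs (T := T) (w := w) (B := B) (p := p) (s := (Function.update (deliver mode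
      (Q.out (n + 1) (Function.update (fun x => s.1 (2 * x)) n c)) s).1 (2 * n) c, (deliver mode
      (Q.out (n + 1) (Function.update (fun x => s.1 (2 * x)) n c)) s).2)) (2 * n)
    simp only [Function.update_idem] at h4
    have hz := deliver_even (mode := mode)
      (Q.out (n + 1) (Function.update (fun x => s.1 (2 * x)) n c)) s n
    rw [hs0] at hz
    rw [← hz, Function.update_eq_self] at h4
    refine h1.bind ((moveF_runs (2 * n + 1) (by omega)).bind (Runs.bind (e := ()) ?_ h4))
    convert h3 using 2
    · simp only [deliver, Function.update_self, hs1, zero_add]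
      funext x
      simp only [Function.update_apply]
      split_ifs <;> simp_all
    · rfl

/-- Increment track `x` `m` times. -/
def addF (T x : ℕ) : ℕ → Frag T Unit
  | 0 => emitF none
  | m + 1 => (incF x).bind fun _ => addF T x m

theorem addF_runs {T B x : ℕ} {w : List Bool} {p : ℕ} (hx : x < T) (m : ℕ) :
    ∀ s : (ℕ → ℕ) × List Bool, s.1 x + m ≤ B →
      (addF T x m).Runs w B s p () (Function.update s.1 x (s.1 x + m), s.2) p := by
  induction m with
  | zero =>
    intro s _
    simpa [addF] using emitF_runs (T := T) (w := w) (B := B) (s := s) (p := p) none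
  | succ m ih =>
    intro s h
    refine (incF_runs hx (by omega)).bind ?_
    have := ih (Function.update s.1 x (s.1 x + 1), s.2) (by simp; omega)
    simp only [Function.update_self, Function.update_idem] at this
    rwa [show s.1 x + (m + 1) = s.1 x + 1 + m by ring]

/-- Set variable `1` to the length of the input plus one, and variable `0` to `K` times that. -/
def loadF (T K : ℕ) : Frag T Unit := Frag.iter (advanceF.bind fun r =>
  if r then (addF T 0 K).bind fun _ => (addF T 2 1).bind fun _ => atom (.emit none (.inl ()))
  else atom (.emit none (.inr ())))

def loaded (K m : ℕ) : ℕ → ℕ := Function.update (Function.update (fun _ => 0) 0 (K * m)) 2 m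

/-- The head starts on the left end marker and advances from each of the cells `0, …, |w|`;
therefore the counts are for `|w| + 1` and not for `|w|`. -/
theorem loadF_runs {T B K : ℕ} (hT : 4 ≤ T) (hK : 0 < K) (w : List Bool)
    (hB : K * (w.length + 1) ≤ B) :
    ∀ r v, v + r = w.length + 1 → (loadF T K).Runs w B (loaded K v, []) v ()
      (loaded K (w.length + 1), []) (w.length + 1) := by
  intro r
  induction r with
  | zero =>
    intro v hv
    obtain rfl : v = w.length + 1 := by omega
    refine Runs.iter_break ((advanceF_runs_false ?_).bind
      (atom_runs fun cols hv hl => ⟨cols, hv, hl, by simp [Op.exec]⟩))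
    simp [Transducer.readInput]
  | succ r ih =>
    intro v hv
    refine Runs.iter_continue ((advanceF_runs_true ?_).bind ?_) (ih (v + 1) (by omega))
    · cases v with
      | zero => simp [Transducer.readInput]
      | succ v =>
        have : w[v]? = some w[v] := List.getElem?_eq_getElem (by omega)
        simp [Transducer.readInput, this]
    · have hv' : Transducer.moveInput w v .right = v + 1 := by
        simp only [Transducer.moveInput]; omega
      rw [hv']
      have hle : K * v + K ≤ B :=
        le_trans (by rw [← Nat.mul_succ]; exact Nat.mul_le_mul_left K (by omega)) hB
      have hle' : v + 1 ≤ K * (w.length + 1) :=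
        le_trans (by omega : v + 1 ≤ 1 * (w.length + 1)) (Nat.mul_le_mul_right _ hK)
      refine (addF_runs (by omega) K _ (by simpa [loaded] using hle)).bind
        ((addF_runs (by omega) 1 _ (by simp [loaded]; omega)).bind
          (atom_runs fun cols hv hl => ⟨cols, ?_, hl, by simp [Op.exec]⟩))
      rw [hv]
      funext x
      simp only [loaded, Function.update_apply]
      split_ifs <;> simp_all; ring

/-- The initial values of the variables of a program, for input length `N`. -/
def initial (K N : ℕ) : ℕ → ℕ
  | 0 => K * (N + 1)
  | 1 => N + 1
  | _ => 0

/-- All tracks stay at most `K * (N + 1)`, so apart from the mark the tape needs at most `Nat.log 2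
(K * (N + 1)) + 1` cells, which is logarithmic in `N` because `K` is fixed. -/
theorem exists_transducer (P : Prog) {K : ℕ} (hK : 0 < K) : ∃ (M : Transducer) (c : ℕ), ∀ N : ℕ,
    M.ComputesInSpace (List.replicate N true) (P.out 2 (initial K N)) (c * Nat.log 2 N + c) := by
  let T := 2 * (2 + P.levels)
  have hT : 4 ≤ T := by simp only [T]; omega
  obtain ⟨M, hM⟩ := Frag.exists_transducer ((loadF T K).bind fun _ => P.compile T 2 none)
  refine ⟨M, Nat.log 2 K + 5, fun N => ?_⟩
  set w := List.replicate N true with hw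
  have hN : w.length = N := by simp [hw]
  have hKN : 0 < K * (N + 1) := by positivity
  have h1 := loadF_runs (B := K * (N + 1)) hT hK w (by rw [hN]) (w.length + 1) 0 (by omega)
  have hready : Ready (K * (N + 1)) 2 none (loaded K (w.length + 1)) := by
    refine ⟨by omega, fun x hx => ?_, fun x hx => ?_, fun x => ?_, by simp⟩
    · rw [loaded, Function.update_of_ne (by omega), Function.update_of_ne (by omega)]
    · rw [loaded, Function.update_of_ne (by omega), Function.update_of_ne (by omega)]
    · simp only [loaded, Function.update_apply, hN]; split_ifs
      · exact Nat.le_mul_of_pos_left _ hK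
      · exact le_rfl
      · exact Nat.zero_le _
  have h2 := compile_runs (T := T) (w := w) (p := w.length + 1) P 2 none
    (loaded K (w.length + 1), []) hready le_rfl
  have he : (fun x => loaded K (w.length + 1) (2 * x)) = initial K N := by
    funext x
    match x with
    | 0 => simp [loaded, initial, hN]
    | 1 => simp [loaded, initial, hN]
    | x + 2 => simp [loaded, initial]
  simp only [he] at h2
  obtain ⟨cols, -, -, hrun⟩ := h1.bind (K := fun _ => P.compile T 2 none) h2 [] (by
    funext x; simp [Column.value, loaded, Function.update_apply]) (Nat.zero_le _)
  have := hM w (P.out 2 (initial K N)) _ _ _ (by simp [deliver]) hrun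
  refine ⟨this.1, fun c hc t => (this.2 c hc t).trans ?_⟩
  have hlog : Nat.log 2 (K * (N + 1)) ≤ Nat.log 2 K + Nat.log 2 N + 2 := by
    refine Nat.lt_succ_iff.1 (Nat.log_lt_of_lt_pow hKN.ne' ?_)
    have hk := Nat.lt_pow_succ_log_self one_lt_two K
    have hn : N + 1 ≤ 2 ^ (Nat.log 2 N + 1) := Nat.lt_pow_succ_log_self one_lt_two N
    calc K * (N + 1) < 2 ^ (Nat.log 2 K + 1) * 2 ^ (Nat.log 2 N + 1) :=
          Nat.mul_lt_mul_of_lt_of_le hk hn (by omega)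
      _ ≤ 2 ^ (Nat.log 2 K + Nat.log 2 N + 2 + 1) := by
          rw [← pow_add]; exact Nat.pow_le_pow_right (by omega) (by omega)
  nlinarith [Nat.zero_le (Nat.log 2 K * Nat.log 2 N), Nat.zero_le (Nat.log 2 N)]

end Prog

/-! ### Tuples in lexicographic order -/

def tuples : List ℕ → List (List ℕ)
  | [] => [[]]
  | b :: bs => (List.range b).flatMap fun v => (tuples bs).map (v :: ·)

theorem tuples_append (bs cs : List ℕ) :
    tuples (bs ++ cs) = (tuples bs).flatMap fun x => (tuples cs).map (x ++ ·) := by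
  induction bs with
  | nil => simp [tuples]
  | cons b bs ih =>
    simp [tuples, ih, List.flatMap_assoc, List.map_flatMap, List.flatMap_map, Function.comp_def]

theorem length_tuples (bs : List ℕ) : (tuples bs).length = bs.prod := by
  induction bs with
  | nil => rfl
  | cons b bs ih => simp [tuples, List.length_flatMap, ih]

theorem length_of_mem_tuples {bs ds : List ℕ} (h : ds ∈ tuples bs) : ds.length = bs.length := by
  induction bs generalizing ds with
  | nil => simp [tuples] at h; simp [h]
  | cons b bs ih =>
    simp only [tuples, List.mem_flatMap, List.mem_map] at h
    obtain ⟨v, -, es, hes, rfl⟩ := h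
    simp [ih hes]

/-- Nested loops list tuples in lexicographic order. So the numbers of two gates can be compared
through their tuples, without computing the numbers. -/
theorem pairwise_tuples (bs : List ℕ) : (tuples bs).Pairwise (· < ·) := by
  induction bs with
  | nil => simp [tuples]
  | cons b bs ih =>
    rw [tuples, List.pairwise_flatMap]
    refine ⟨fun v _ => ?_, ?_⟩
    · rw [List.pairwise_map]
      exact ih.imp fun h => List.cons_lt_cons_iff.2 (.inr ⟨rfl, h⟩)
    · refine List.pairwise_lt_range.imp fun {u v} huv x hx y hy => ?_
      simp only [List.mem_map] at hx hy
      obtain ⟨x, -, rfl⟩ := hx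
      obtain ⟨y, -, rfl⟩ := hy
      exact List.cons_lt_cons_iff.2 (.inl huv)

/-- A bijection between `α` and the tuples with the bounds `bs`. -/
structure Coding (α : Type) (bs : List ℕ) : Type where
  enc : α → List ℕ
  inj : Function.Injective enc
  mem_iff : ∀ ds, ds ∈ tuples bs ↔ ∃ a, enc a = ds

namespace Coding

variable {α β : Type} {bs cs : List ℕ}

def fin (b : ℕ) : Coding (Fin b) [b] where
  enc a := [a.val]
  inj a b h := by simpa [Fin.ext_iff] using h
  mem_iff ds := by
    simp only [tuples, List.mem_flatMap, List.mem_range, List.map_cons, List.map_nil,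
      List.mem_singleton]
    constructor
    · rintro ⟨v, hv, rfl⟩; exact ⟨⟨v, hv⟩, rfl⟩
    · rintro ⟨a, rfl⟩; exact ⟨a, a.isLt, rfl⟩

theorem length_enc (c : Coding α bs) (a : α) : (c.enc a).length = bs.length :=
  length_of_mem_tuples ((c.mem_iff _).2 ⟨a, rfl⟩)

def prod (c : Coding α bs) (d : Coding β cs) : Coding (α × β) (bs ++ cs) where
  enc p := c.enc p.1 ++ d.enc p.2
  inj p q h := by
    have := List.append_inj h (by rw [c.length_enc, c.length_enc])
    exact Prod.ext (c.inj this.1) (d.inj this.2)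
  mem_iff ds := by
    simp only [tuples_append, List.mem_flatMap, List.mem_map, c.mem_iff, d.mem_iff]
    constructor
    · rintro ⟨_, ⟨a, rfl⟩, _, ⟨b, rfl⟩, rfl⟩; exact ⟨(a, b), rfl⟩
    · rintro ⟨p, rfl⟩; exact ⟨_, ⟨p.1, rfl⟩, _, ⟨p.2, rfl⟩, rfl⟩

def ofEquiv (c : Coding α bs) (e : β ≃ α) : Coding β bs where
  enc b := c.enc (e b)
  inj := c.inj.comp e.injective
  mem_iff ds := by rw [c.mem_iff]; exact e.symm.exists_congr_left.trans (by simp)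

def pi (n : ℕ) (j : ℕ) : Coding (Fin j → Fin n) (List.replicate j n) where
  enc f := List.ofFn fun l => (f l).val
  inj f g h := by
    have := List.ofFn_injective h
    funext l
    exact Fin.ext (congrFun this l)
  mem_iff := by
    induction j with
    | zero => intro ds; simp [tuples]
    | succ j ih =>
      intro ds
      simp only [List.replicate_succ, tuples, List.mem_flatMap, List.mem_map, List.mem_range, ih]
      constructor
      · rintro ⟨v, hv, _, ⟨f, rfl⟩, rfl⟩
        exact ⟨Fin.cons ⟨v, hv⟩ f, by simp [List.ofFn_succ]⟩
      · rintro ⟨f, rfl⟩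
        exact ⟨f 0, (f 0).isLt, _, ⟨fun l => f l.succ, rfl⟩, by simp [List.ofFn_succ]⟩

theorem enc_mem (c : Coding α bs) (a : α) : c.enc a ∈ tuples bs := (c.mem_iff _).2 ⟨a, rfl⟩

noncomputable def index (c : Coding α bs) (a : α) : Fin (tuples bs).length :=
  ⟨(tuples bs).idxOf (c.enc a), List.idxOf_lt_length_of_mem (c.enc_mem a)⟩

noncomputable def decode (c : Coding α bs) (i : Fin (tuples bs).length) : α :=
  ((c.mem_iff _).1 (List.get_mem (tuples bs) i)).choose

theorem enc_decode (c : Coding α bs) (i : Fin (tuples bs).length) :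
    c.enc (c.decode i) = (tuples bs).get i :=
  ((c.mem_iff _).1 (List.get_mem (tuples bs) i)).choose_spec

theorem get_index (c : Coding α bs) (a : α) : (tuples bs).get (c.index a) = c.enc a := by
  simp [index]

theorem decode_index (c : Coding α bs) (a : α) : c.decode (c.index a) = a :=
  c.inj (by rw [enc_decode, get_index])

theorem strictMono_get (bs : List ℕ) : StrictMono (tuples bs).get :=
  fun _ _ h => List.pairwise_iff_get.1 (pairwise_tuples bs) _ _ h

theorem index_decode (c : Coding α bs) (i : Fin (tuples bs).length) : c.index (c.decode i) = i :=
  (strictMono_get bs).injective (by rw [get_index, enc_decode])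

theorem decode_injective (c : Coding α bs) : Function.Injective c.decode := fun i j h => by
  rw [← c.index_decode i, h, c.index_decode]

theorem enc_lt_iff (c : Coding α bs) {a b : α} : c.enc a < c.enc b ↔ c.index a < c.index b := by
  rw [← c.get_index a, ← c.get_index b]; exact (strictMono_get bs).lt_iff_lt

end Coding

/-- In a sorted list the entries before `I[i]` are those below it. An initial segment is thus listed
by a full loop with a comparison, which the loop language can express. -/
theorem map_take_eq_flatMap {β : Type} {I : List (List ℕ)} (hI : I.Pairwise (· < ·))
    (f : List ℕ → β) (i : ℕ) (hi : i < I.length) :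
    (I.take i).map f = I.flatMap fun d => if d < I[i] then [f d] else [] := by
  have hs : StrictMono I.get := fun _ _ h => List.pairwise_iff_get.1 hI _ _ h
  have h1 : ((I.take i).flatMap fun d => if d < I[i] then [f d] else []) = (I.take i).map f := by
    rw [List.map_eq_flatMap]
    refine List.flatMap_congr fun d hd => if_pos ?_
    obtain ⟨j, hj, rfl⟩ := List.getElem_of_mem hd
    simp only [List.length_take] at hj
    rw [List.getElem_take]
    exact hs (a := ⟨j, by omega⟩) (b := ⟨i, hi⟩) (by simp; omega)
  have h2 : ((I.drop i).flatMap fun d => if d < I[i] then [f d] else []) = [] := by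
    rw [List.flatMap_eq_nil_iff]
    intro d hd
    rw [if_neg]
    obtain ⟨j, hj, rfl⟩ := List.getElem_of_mem hd
    simp only [List.length_drop] at hj
    rw [List.getElem_drop]
    exact (hs.monotone (a := ⟨i, hi⟩) (b := ⟨i + j, by omega⟩) (by simp)).not_gt
  have h3 : ∀ g : List ℕ → List β,
      I.flatMap g = (I.take i).flatMap g ++ (I.drop i).flatMap g := fun g => by
    rw [← List.flatMap_append, List.take_append_drop]
  rw [h3, h1, h2, List.append_nil]

/-! ### Circuits whose gates are indexed by tuples -/

inductive GateKind (N : ℕ) (α : Type) : Type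
  | input (a : Fin N)
  | not (b : α)
  | and
  | or
  | threshold (m : ℕ)

structure Net (N : ℕ) (α : Type) : Type where
  kind : α → GateKind N α
  wire : α → α → Prop

namespace Circuit

variable {N : ℕ} {C : Circuit N} {x : Fin N → Bool} {i : Fin C.size}

theorem val_input {a} (h : C.gate i = .input a) : C.val x i = x a := by rw [Circuit.val, h]

theorem val_not {j} (h : C.gate i = .not j) : C.val x i = !(C.val x (C.pred i j)) := by
  rw [Circuit.val, h]

theorem val_and {w} (h : C.gate i = .and w) :
    C.val x i = true ↔ ∀ j : Fin i, w j = true → C.val x (C.pred i j) = true := by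
  rw [Circuit.val, h, decide_eq_true_eq]

theorem val_or {w} (h : C.gate i = .or w) :
    C.val x i = true ↔ ∃ j : Fin i, w j = true ∧ C.val x (C.pred i j) = true := by
  rw [Circuit.val, h, decide_eq_true_eq]

theorem val_threshold {m w} (h : C.gate i = .threshold m w) :
    C.val x i = true ↔ m ≤ (Finset.univ.filter fun j : Fin i =>
        w j = true ∧ C.val x (C.pred i j) = true).card := by
  rw [Circuit.val, h, decide_eq_true_eq]

theorem gateDepth_le {d : ℕ} (h1 : ∀ j, C.gate i = .not j → C.gateDepth (C.pred i j) ≤ d)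
    (h2 : ∀ w, (C.gate i = .and w ∨ C.gate i = .or w ∨ ∃ m, C.gate i = .threshold m w) →
      ∀ j, w j = true → C.gateDepth (C.pred i j) ≤ d) : C.gateDepth i ≤ d + 1 := by
  have hsup : ∀ w, (C.gate i = .and w ∨ C.gate i = .or w ∨ ∃ m, C.gate i = .threshold m w) →
      (Finset.univ.sup fun j : Fin i =>
        if w j = true then C.gateDepth (C.pred i j) else 0) ≤ d := fun w hw => by
    refine Finset.sup_le fun j _ => ?_
    split_ifs with hj
    · exact h2 w hw j hj
    · exact Nat.zero_le _
  rw [Circuit.gateDepth]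
  cases hg : C.gate i with
  | input a => exact Nat.zero_le _
  | not j => exact Nat.succ_le_succ (h1 j hg)
  | and w => exact Nat.succ_le_succ (hsup w (.inl hg))
  | or w => exact Nat.succ_le_succ (hsup w (.inr (.inl hg)))
  | threshold m w => exact Nat.succ_le_succ (hsup w (.inr (.inr ⟨m, hg⟩)))

end Circuit

/-! ### Values, depth and description of the circuit of a net -/

namespace Net

variable {N : ℕ} {α : Type} {bs : List ℕ}

-- A negation of a gate that does not come earlier is replaced by a dummy, and wires from such gates
-- are dropped. Neither happens in a `Topological` net.
open Classical in
noncomputable def gateOf (net : Net N α) (c : Coding α bs) (i : Fin (tuples bs).length) :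
    GateKind N α → Gate N i
  | .input a => .input a
  | .not b => if h : (c.index b).val < i.val then .not ⟨c.index b, h⟩ else .and fun _ => false
  | .and => .and fun j => decide (net.wire (c.decode i) (c.decode ⟨j, j.isLt.trans i.isLt⟩))
  | .or => .or fun j => decide (net.wire (c.decode i) (c.decode ⟨j, j.isLt.trans i.isLt⟩))
  | .threshold m =>
    .threshold m fun j => decide (net.wire (c.decode i) (c.decode ⟨j, j.isLt.trans i.isLt⟩))

noncomputable def gate (net : Net N α) (c : Coding α bs) (i : Fin (tuples bs).length) : Gate N i :=
  net.gateOf c i (net.kind (c.decode i))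

noncomputable def toCircuit (net : Net N α) (c : Coding α bs) (h : 0 < (tuples bs).length) :
    Circuit N where
  size := (tuples bs).length
  size_pos := h
  gate := net.gate c

/-- Wires and negations lead to gates that come earlier. -/
structure Topological (net : Net N α) (c : Coding α bs) : Prop where
  wire_lt : ∀ a b, net.wire a b → c.enc b < c.enc a
  not_lt : ∀ a b, net.kind a = .not b → c.enc b < c.enc a

/-- The value that a gate `a` of the given kind gets from the values `v` of the other gates. -/
def LocalValue (wire : α → α → Prop) (x : Fin N → Bool) (v : α → Prop) (a : α) :
    GateKind N α → Prop
  | .input p => x p = true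
  | .not b => ¬ v b
  | .and => ∀ b, wire a b → v b
  | .or => ∃ b, wire a b ∧ v b
  | .threshold m => m ≤ {b | wire a b ∧ v b}.ncard

/-- `v` is the set of the gates that are true on input `x`. -/
def Consistent (net : Net N α) (x : Fin N → Bool) (v : α → Prop) : Prop :=
  ∀ a, v a ↔ LocalValue net.wire x v a (net.kind a)

variable {net : Net N α} {c : Coding α bs} {h0 : 0 < (tuples bs).length}

/-- All predecessors of a gate have smaller numbers, so by strong induction a consistent valuation
is the one that the circuit computes. -/
theorem val_iff (ht : net.Topological c) {x : Fin N → Bool} {v : α → Prop}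
    (hv : net.Consistent x v) (i : Fin (tuples bs).length) :
    (net.toCircuit c h0).val x i = true ↔ v (c.decode i) := by
  induction hi : i.val using Nat.strong_induction_on generalizing i with
  | _ k ih =>
    subst hi
    have ih' : ∀ j : Fin i.val, (net.toCircuit c h0).val x ((net.toCircuit c h0).pred i j) = true ↔
        v (c.decode ⟨j, j.isLt.trans i.isLt⟩) := fun j => ih j j.isLt ⟨j, j.isLt.trans i.isLt⟩ rfl
    have hex : ∀ b, net.wire (c.decode i) b → ∃ j : Fin i.val,
        c.decode ⟨j, j.isLt.trans i.isLt⟩ = b := fun b hb => by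
      have := c.enc_lt_iff.1 (ht.wire_lt _ _ hb)
      rw [c.index_decode] at this
      exact ⟨⟨c.index b, this⟩, c.decode_index b⟩
    rw [hv (c.decode i)]
    have hg : (net.toCircuit c h0).gate i = net.gateOf c i (net.kind (c.decode i)) := rfl
    cases hk : net.kind (c.decode i) with
    | input a =>
      rw [hk] at hg
      rw [Circuit.val_input hg, LocalValue]
    | not b =>
      have hlt := c.enc_lt_iff.1 (ht.not_lt _ _ hk)
      rw [c.index_decode] at hlt
      have hlt' : (c.index b).val < i.val := hlt
      rw [hk, gateOf, dif_pos hlt'] at hg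
      rw [Circuit.val_not hg, LocalValue, Bool.not_eq_true', ← Bool.not_eq_true, ih']
      rw [show (⟨(c.index b).val, _⟩ : Fin (tuples bs).length) = c.index b from rfl, c.decode_index]
    | and =>
      rw [hk] at hg
      rw [Circuit.val_and hg]
      simp only [LocalValue, decide_eq_true_eq, ih']
      constructor
      · intro h b hb
        obtain ⟨j, rfl⟩ := hex b hb
        exact h j hb
      · intro h j hj; exact h _ hj
    | or =>
      rw [hk] at hg
      rw [Circuit.val_or hg]
      simp only [LocalValue, decide_eq_true_eq, ih']
      constructor
      · rintro ⟨j, hj⟩; exact ⟨_, hj⟩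
      · rintro ⟨b, hb, hvb⟩
        obtain ⟨j, rfl⟩ := hex b hb
        exact ⟨j, hb, hvb⟩
    | threshold m =>
      rw [hk] at hg
      rw [Circuit.val_threshold hg]
      simp only [LocalValue, decide_eq_true_eq, ih']
      -- The threshold counts gate numbers, `LocalValue` counts gates; `decode` is a bijection
      -- between the two sets.
      have : {b | net.wire (c.decode i) b ∧ v b} =
          (fun j : Fin i.val => c.decode ⟨j, j.isLt.trans i.isLt⟩) '' {j : Fin i.val |
            net.wire (c.decode i) (c.decode ⟨j, j.isLt.trans i.isLt⟩) ∧
              v (c.decode ⟨j, j.isLt.trans i.isLt⟩)} := by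
        ext b
        constructor
        · rintro ⟨hb, hvb⟩
          obtain ⟨j, rfl⟩ := hex b hb
          exact ⟨j, ⟨hb, hvb⟩, rfl⟩
        · rintro ⟨j, hj, rfl⟩; exact hj
      rw [this, Set.ncard_image_of_injective _ (fun j l hjl => by
        have := c.decode_injective hjl
        simpa [Fin.ext_iff] using this), ← Set.ncard_coe_finset]
      simp only [decide_eq_true_eq, Finset.coe_filter, Finset.mem_univ, true_and]
      exact iff_of_eq (congrArg (m ≤ Set.ncard ·) (Set.ext fun j => and_congr_right fun _ => ih' j))

theorem gateDepth_le {h : α → ℕ} (hw : ∀ a b, net.wire a b → h b < h a)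
    (hn : ∀ a b, net.kind a = .not b → h b < h a) (i : Fin (tuples bs).length) :
    (net.toCircuit c h0).gateDepth i ≤ h (c.decode i) + 1 := by
  induction hi : i.val using Nat.strong_induction_on generalizing i with
  | _ k ih =>
    subst hi
    have ih' : ∀ j : Fin i.val, (net.toCircuit c h0).gateDepth ((net.toCircuit c h0).pred i j) ≤
        h (c.decode ⟨j, j.isLt.trans i.isLt⟩) + 1 :=
      fun j => ih j j.isLt ⟨j, j.isLt.trans i.isLt⟩ rfl
    have hg : (net.toCircuit c h0).gate i = net.gateOf c i (net.kind (c.decode i)) := rfl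
    have hwd : ∀ w : Fin i.val → Bool, (∀ j : Fin i.val, w j = true →
        net.wire (c.decode i) (c.decode ⟨j, j.isLt.trans i.isLt⟩)) → ∀ j, w j = true →
        (net.toCircuit c h0).gateDepth ((net.toCircuit c h0).pred i j) ≤ h (c.decode i) := by
      intro w hw' j hj
      exact (ih' j).trans (hw _ _ (hw' j hj))
    cases hk : net.kind (c.decode i) with
    | input a =>
      rw [hk] at hg
      exact Circuit.gateDepth_le (by simp [hg, gateOf]) (by simp [hg, gateOf])
    | not b =>
      by_cases hlt : (c.index b).val < i.val
      · rw [hk, gateOf, dif_pos hlt] at hg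
        refine Circuit.gateDepth_le (fun j hj => ?_) (by simp [hg])
        rw [hg] at hj
        cases hj
        have := ih' ⟨c.index b, hlt⟩
        rw [show (⟨(c.index b).val, _⟩ : Fin (tuples bs).length) = c.index b from rfl,
          c.decode_index] at this
        exact this.trans (hn _ _ hk)
      · rw [hk, gateOf, dif_neg hlt] at hg
        refine Circuit.gateDepth_le (by simp [hg]) fun w hw' j hj => ?_
        simp only [hg, Gate.and.injEq, reduceCtorEq, exists_false, or_false] at hw'
        rw [← hw'] at hj
        cases hj
    | and =>
      rw [hk] at hg
      refine Circuit.gateDepth_le (by simp [hg, gateOf]) fun w hw' => hwd w fun j hj => ?_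
      simp only [hg, gateOf, Gate.and.injEq, reduceCtorEq, exists_false, or_false] at hw'
      rw [← hw'] at hj
      simpa using hj
    | or =>
      rw [hk] at hg
      refine Circuit.gateDepth_le (by simp [hg, gateOf]) fun w hw' => hwd w fun j hj => ?_
      simp only [hg, gateOf, Gate.or.injEq, reduceCtorEq, exists_false, or_false, false_or] at hw'
      rw [← hw'] at hj
      simpa using hj
    | threshold m =>
      rw [hk] at hg
      refine Circuit.gateDepth_le (by simp [hg, gateOf]) fun w hw' => hwd w fun j hj => ?_
      simp only [hg, gateOf, Gate.threshold.injEq, reduceCtorEq, false_or] at hw'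
      obtain ⟨_, -, hw'⟩ := hw'
      rw [← hw'] at hj
      simpa using hj

theorem toCircuit_isAC (hk : ∀ a m, net.kind a ≠ .threshold m) : (net.toCircuit c h0).IsAC := by
  intro i m w
  have hg : (net.toCircuit c h0).gate i = net.gateOf c i (net.kind (c.decode i)) := rfl
  rw [hg]
  cases hk' : net.kind (c.decode i) with
  | input a => simp [gateOf]
  | not b => simp only [gateOf]; split_ifs <;> simp
  | and => simp [gateOf]
  | or => simp [gateOf]
  | threshold m => exact absurd hk' (hk _ _)

open Classical in
/-- The bits of the adjacency matrix in the row of gate `a`. -/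
noncomputable def row (net : Net N α) (c : Coding α bs) (a : α) : List Bool :=
  (tuples bs).flatMap fun ds =>
    if ds < c.enc a then [decide (∃ b, c.enc b = ds ∧ net.wire a b)] else []

/-- The number of gate `b` in unary is written as one `true` for each tuple below `c.enc b`. -/
noncomputable def gateCode (net : Net N α) (c : Coding α bs) (a : α) : List Bool :=
  match net.kind a with
  | .input p => [false, false, false] ++ unary p
  | .not b => [false, false, true] ++
      (((tuples bs).flatMap fun ds => if ds < c.enc b then [true] else []) ++ [false])
  | .and => [false, true, false] ++ net.row c a
  | .or => [false, true, true] ++ net.row c a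
  | .threshold m => [true, false, false] ++ unary m ++ net.row c a

theorem ofFn_wire (i : Fin (tuples bs).length) :
    (List.ofFn fun j : Fin i.val => open Classical in
      decide (net.wire (c.decode i) (c.decode ⟨j, j.isLt.trans i.isLt⟩))) =
      net.row c (c.decode i) := by
  rw [row, c.enc_decode]
  have := map_take_eq_flatMap (pairwise_tuples bs) (fun ds => open Classical in
    decide (∃ b, c.enc b = ds ∧ net.wire (c.decode i) b)) i i.isLt
  simp only [List.get_eq_getElem]
  rw [← this]
  refine List.ext_getElem (by simp) fun j h1 h2 => ?_
  simp only [List.getElem_ofFn, List.getElem_map, List.getElem_take, decide_eq_decide]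
  simp only [List.length_ofFn] at h1
  have he : c.enc (c.decode ⟨j, h1.trans i.isLt⟩) = (tuples bs)[j]'(h1.trans i.isLt) :=
    c.enc_decode _
  constructor
  · intro h; exact ⟨_, he, h⟩
  · rintro ⟨b, hb, h⟩
    rw [← he, c.inj.eq_iff] at hb
    rwa [← hb]

theorem encode_gate (ht : net.Topological c) (i : Fin (tuples bs).length) :
    (net.gate c i).encode = net.gateCode c (c.decode i) := by
  rw [gate, gateCode]
  cases hk : net.kind (c.decode i) with
  | input a => rfl
  | not b =>
    have hlt := c.enc_lt_iff.1 (ht.not_lt _ _ hk)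
    rw [c.index_decode] at hlt
    have hlt' : (c.index b).val < i.val := hlt
    simp only [gateOf, dif_pos hlt', Gate.encode, unary]
    have := map_take_eq_flatMap (pairwise_tuples bs) (fun _ => true) (c.index b) (c.index b).isLt
    have he : (tuples bs)[(c.index b).val] = c.enc b := c.get_index b
    rw [he] at this
    rw [← this, List.map_const']
    simp [(c.index b).isLt.le]
  | and => simp only [gateOf, Gate.encode, ofFn_wire]
  | or => simp only [gateOf, Gate.encode, ofFn_wire]
  | threshold m => simp only [gateOf, Gate.encode, ofFn_wire]

theorem encode_toCircuit (ht : net.Topological c) {g : List ℕ → List Bool}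
    (hg : ∀ a, g (c.enc a) = net.gateCode c a) :
    (net.toCircuit c h0).encode = (tuples bs).flatMap g := by
  rw [Circuit.encode, List.flatMap_def]
  congr 1
  refine List.ext_getElem (by simp [toCircuit]) fun j h1 h2 => ?_
  simp only [List.length_map] at h2
  simp only [List.getElem_ofFn, List.getElem_map]
  have he : c.enc (c.decode ⟨j, h2⟩) = (tuples bs)[j] := c.enc_decode _
  rw [← he, hg]
  exact encode_gate ht ⟨j, h2⟩

end Net

/-! ### The pebble game on two graphs -/

/-- A position of `j` pebbles on one of two graphs on `Fin n`. -/
abbrev Position (j n : ℕ) : Type := Fin 2 × (Fin j → Fin n)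

namespace Position

variable {j n : ℕ}

def place (A : Position j n) (i : Fin j) (v : Fin n) : Position j n :=
  (A.1, Function.update A.2 i v)

/-- Many (more than `m` or, without counting, all) ways to place pebble `i` lead from `A` to a
position that is `D`-related to `C`. -/
def Many (counting : Bool) (D : Position j n → Position j n → Prop) (A : Position j n) (i : Fin j)
    (C : Position j n) (m : ℕ) : Prop :=
  if counting then m + 1 ≤ {v | D (A.place i v) C}.ncard else ∀ v, D (A.place i v) C

/-- The positions can be distinguished in `t` rounds. -/
def Differ (counting : Bool) (adj : Fin 2 → Fin n → Fin n → Prop) :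
    ℕ → Position j n → Position j n → Prop
  | 0, A, B => (∃ l l', ¬ (A.2 l = A.2 l' ↔ B.2 l = B.2 l')) ∨
      ∃ l l', ¬ (adj A.1 (A.2 l) (A.2 l') ↔ adj B.1 (B.2 l) (B.2 l'))
  | t + 1, A, B => Differ counting adj t A B ∨ ∃ (i : Fin j) (C : Position j n) (m : Fin n),
      ¬ (Many counting (Differ counting adj t) A i C m ↔ Many counting (Differ counting adj t) B i C m)

variable {counting : Bool} {adj : Fin 2 → Fin n → Fin n → Prop} {t : ℕ} {A B C : Position j n}

theorem differ_refl (A : Position j n) : ¬ Differ counting adj t A A := by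
  induction t with
  | zero => simp [Differ]
  | succ t ih => simp [Differ, ih]

theorem differ_symm (h : Differ counting adj t A B) : Differ counting adj t B A := by
  induction t with
  | zero =>
    simp only [Differ] at h ⊢
    exact h.imp (fun ⟨l, l', h⟩ => ⟨l, l', fun h' => h h'.symm⟩)
      fun ⟨l, l', h⟩ => ⟨l, l', fun h' => h h'.symm⟩
  | succ t ih =>
    simp only [Differ] at h ⊢
    exact h.imp ih fun ⟨i, C, m, h⟩ => ⟨i, C, m, fun h' => h h'.symm⟩

theorem not_differ_trans (h : ¬ Differ counting adj t A B) (h' : ¬ Differ counting adj t B C) :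
    ¬ Differ counting adj t A C := by
  induction t with
  | zero =>
    simp only [Differ, not_or, not_exists, not_not] at h h' ⊢
    exact ⟨fun l l' => (h.1 l l').trans (h'.1 l l'), fun l l' => (h.2 l l').trans (h'.2 l l')⟩
  | succ t ih =>
    simp only [Differ, not_or, not_exists, not_not] at h h' ⊢
    exact ⟨ih h.1 h'.1, fun i C m => (h.2 i C m).trans (h'.2 i C m)⟩

theorem differ_congr_left (h : ¬ Differ counting adj t A B) :
    Differ counting adj t A C ↔ Differ counting adj t B C :=
  ⟨fun hA => by_contra fun hB => not_differ_trans h hB hA,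
    fun hB => by_contra fun hA => not_differ_trans (fun h' => h (differ_symm h')) hA hB⟩

theorem not_differ_mono {s : ℕ} (hst : s ≤ t) (h : ¬ Differ counting adj t A B) :
    ¬ Differ counting adj s A B := by
  induction t with
  | zero => obtain rfl := Nat.le_zero.1 hst; exact h
  | succ t ih =>
    rcases Nat.lt_or_eq_of_le hst with hlt | rfl
    · exact ih (Nat.lt_succ_iff.1 hlt) fun h' => h (.inl h')
    · exact h

def setoid (counting : Bool) (adj : Fin 2 → Fin n → Fin n → Prop) (j t : ℕ) :
    Setoid (Position j n) where
  r A B := ¬ Differ counting adj t A B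
  iseqv := ⟨differ_refl, fun h h' => h (differ_symm h'), not_differ_trans⟩

/-- Families with equally many members in every class have equally many members in every union of
classes. -/
theorem ncard_eq_of_classes {α : Type} [Finite α] (S : Setoid α) {f g : Fin n → α}
    (h : ∀ c, {v | S.r (f v) c}.ncard = {v | S.r (g v) c}.ncard) {P : α → Prop}
    (hP : ∀ a b, S.r a b → (P a ↔ P b)) : {v | P (f v)}.ncard = {v | P (g v)}.ncard := by
  classical
  have := Fintype.ofFinite α
  -- The property `P` selects whole classes, so the count is the sum of the sizes of the selected
  -- classes.
  have key : ∀ f : Fin n → α, {v | P (f v)}.ncard =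
      ∑ b : Quotient S, (if ∃ c, ⟦c⟧ = b ∧ P c then
        {v | (⟦f v⟧ : Quotient S) = b}.ncard else 0) := by
    intro f
    have e : {v | P (f v)} = ↑(Finset.univ.filter fun v => P (f v)) := by simp
    rw [e, Set.ncard_coe_finset, Finset.card_eq_sum_card_fiberwise
      (f := fun v => (⟦f v⟧ : Quotient S)) (t := Finset.univ) (fun _ _ => Finset.mem_univ _)]
    refine Finset.sum_congr rfl fun b _ => ?_
    split_ifs with hb
    · obtain ⟨c, rfl, hc⟩ := hb
      rw [← Set.ncard_coe_finset]
      congr 1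
      ext v
      simp only [Finset.coe_filter, Finset.mem_filter, Finset.mem_univ, true_and, Set.mem_ofPred_eq,
        and_iff_right_iff_imp]
      exact fun hv => (hP _ _ (Quotient.exact hv)).2 hc
    · rw [Finset.card_eq_zero, Finset.filter_eq_empty_iff]
      intro v hv hvb
      exact hb ⟨f v, hvb, by simpa using hv⟩
  rw [key f, key g]
  refine Finset.sum_congr rfl fun b _ => ?_
  induction b using Quotient.inductionOn with
  | h c =>
    have e : ∀ f : Fin n → α, {v | (⟦f v⟧ : Quotient S) = ⟦c⟧} = {v | S.r (f v) c} := fun f =>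
      Set.ext fun v => Quotient.eq
    rw [e, e, h]

/-- A number between `0` and `n` is determined by which of the thresholds `1, …, n` it reaches.
Complements then turn the numbers of moves out of the class of `C` into the numbers of moves into
it. -/
theorem ncard_differ_eq (h : ∀ m : Fin n, (m.val + 1 ≤ {v | Differ counting adj t (A.place i v) C}.ncard ↔
      m.val + 1 ≤ {v | Differ counting adj t (B.place i v) C}.ncard)) :
    {v | ¬ Differ counting adj t (A.place i v) C}.ncard =
      {v | ¬ Differ counting adj t (B.place i v) C}.ncard := by
  have hA := Set.ncard_add_ncard_compl {v | Differ counting adj t (A.place i v) C}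
  have hB := Set.ncard_add_ncard_compl {v | Differ counting adj t (B.place i v) C}
  simp only [Nat.card_eq_fintype_card, Fintype.card_fin] at hA hB
  have : {v | Differ counting adj t (A.place i v) C}.ncard =
      {v | Differ counting adj t (B.place i v) C}.ncard := by
    rcases lt_trichotomy {v | Differ counting adj t (A.place i v) C}.ncard
      {v | Differ counting adj t (B.place i v) C}.ncard with hlt | heq | hlt
    -- The smaller number is the index of a separating threshold; it is below `n` because the larger
    -- one is at most `n`.
    · have := h ⟨_, hlt.trans_le (by omega)⟩
      simp only at this
      omega
    · exact heq
    · have := h ⟨_, hlt.trans_le (by omega)⟩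
      simp only at this
      omega
  simp only [Set.compl_ofPred] at hA hB
  omega

end Position

/-! ### Formulas of bounded depth and the pebble game -/

namespace Formula

variable {k j n : ℕ}

/-- Variables are embedded into the pebbles, since the game may have more pebbles than the formula
has variables. -/
def assign {V : Type} (ι : Fin k → Fin j) (f : Fin j → V) : Fin k → Option V :=
  fun x => some (f (ι x))

theorem update_assign {V : Type} {ι : Fin k → Fin j} (hι : Function.Injective ι) (f : Fin j → V)
    (i : Fin k) (v : V) :
    Function.update (assign ι f) i (some v) = assign ι (Function.update f (ι i) v) := by
  funext x
  simp only [assign, Function.update_apply, hι.eq_iff]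
  split_ifs <;> rfl

theorem sat_congr {V : Type} (G : SimpleGraph V) (φ : Formula k) : ∀ ν ν' : Fin k → Option V,
    (∀ x ∈ φ.freeVars, ν x = ν' x) → (φ.Sat G ν ↔ φ.Sat G ν') := by
  induction φ with
  | falsum => simp [Sat]
  | eq a b => intro ν ν' h; simp only [Sat, h a (by simp [freeVars]), h b (by simp [freeVars])]
  | adj a b => intro ν ν' h; simp only [Sat, h a (by simp [freeVars]), h b (by simp [freeVars])]
  | neg φ ih => intro ν ν' h; simp only [Sat, ih ν ν' h]
  | and φ ψ ih1 ih2 =>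
    intro ν ν' h
    simp only [Sat]
    rw [ih1 ν ν' fun x hx => h x (Finset.mem_union_left _ hx),
      ih2 ν ν' fun x hx => h x (Finset.mem_union_right _ hx)]
  | ex m i φ ih =>
    intro ν ν' h
    simp only [Sat]
    refine exists_congr fun s => and_congr_right fun _ => forall₂_congr fun v _ => ?_
    refine ih _ _ fun x hx => ?_
    rcases eq_or_ne x i with rfl | hxi
    · simp
    · rw [Function.update_of_ne hxi, Function.update_of_ne hxi]
      exact h x (Finset.mem_erase.2 ⟨hxi, hx⟩)

theorem holds_iff {V : Type} {G : SimpleGraph V} {φ : Formula k} (h : φ.IsSentence)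
    (ν : Fin k → Option V) : φ.Holds G ↔ φ.Sat G ν :=
  sat_congr G φ _ _ fun x hx => by rw [IsSentence] at h; simp [h] at hx

theorem sat_ex {G : SimpleGraph (Fin n)} {m : ℕ} {i : Fin k} {φ : Formula k}
    {ν : Fin k → Option (Fin n)} : (ex m i φ).Sat G ν ↔
      m ≤ {v | φ.Sat G (Function.update ν i (some v))}.ncard := by
  classical
  simp only [Sat]
  constructor
  · rintro ⟨s, hs, h⟩
    refine hs.trans ?_
    rw [← Set.ncard_coe_finset]
    exact Set.ncard_le_ncard fun v hv => h v hv
  · intro h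
    refine ⟨Finset.univ.filter fun v => φ.Sat G (Function.update ν i (some v)), ?_, by simp⟩
    rw [← Set.ncard_coe_finset]
    simpa using h

open Position

/-- Induction on the formula. For a quantifier, the truth of the body is constant on the classes of
depth `t`, so the witnesses are the vertices that lead into a certain union of classes. The two
positions have equally many moves into every class, or, without counting, have moves into the same
classes. -/
theorem sat_iff_of_not_differ {ι : Fin k → Fin j} (hι : Function.Injective ι)
    {G : Fin 2 → SimpleGraph (Fin n)} {counting : Bool} (φ : Formula k) :
    (counting = false → φ.CountFree) → ∀ (t : ℕ) (A B : Position j n), φ.depth ≤ t →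
      ¬ Differ counting (fun s => (G s).Adj) t A B →
      (φ.Sat (G A.1) (assign ι A.2) ↔ φ.Sat (G B.1) (assign ι B.2)) := by
  induction φ with
  | falsum => simp [Sat]
  | eq a b =>
    intro _ t A B _ h
    have := not_differ_mono (Nat.zero_le t) h
    simp only [Differ, not_or, not_exists, not_not] at this
    simpa [Sat, assign, eq_comm] using this.1 (ι a) (ι b)
  | adj a b =>
    intro _ t A B _ h
    have := not_differ_mono (Nat.zero_le t) h
    simp only [Differ, not_or, not_exists, not_not] at this
    simpa [Sat, assign] using this.2 (ι a) (ι b)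
  | neg φ ih => intro hc t A B hd h; simp only [Sat, ih hc t A B hd h]
  | and φ ψ ih1 ih2 =>
    intro hc t A B hd h
    simp only [depth] at hd
    simp only [Sat]
    rw [ih1 (fun e => (hc e).1) t A B (by omega) h, ih2 (fun e => (hc e).2) t A B (by omega) h]
  | ex m i φ ih =>
    intro hc t A B hd h
    cases t with
    | zero => simp [depth] at hd
    | succ t =>
      simp only [depth] at hd
      simp only [Differ, not_or, not_exists, not_not] at h
      have ih' := ih (fun e => (hc e).2) t
      rw [sat_ex, sat_ex]
      simp only [update_assign hι]
      cases hcount : counting with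
      | true =>
        subst hcount
        have h2 := h.2 (ι i)
        simp only [Many, if_true] at h2
        have := ncard_eq_of_classes (setoid true (fun s => (G s).Adj) j t)
          (f := fun v => A.place (ι i) v) (g := fun v => B.place (ι i) v)
          (fun C => ncard_differ_eq (h2 C))
          (P := fun X => φ.Sat (G X.1) (assign ι X.2))
          (fun X Y hXY => ih' X Y (by omega) hXY)
        simp only [place] at this
        rw [this]
      | false =>
        subst hcount
        obtain rfl : m = 1 := (hc rfl).1
        have key : ∀ A B : Position j n, (∀ C (m : Fin n),
            Many false (Differ false (fun s => (G s).Adj) t) A (ι i) C m ↔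
              Many false (Differ false (fun s => (G s).Adj) t) B (ι i) C m) →
            1 ≤ {v | φ.Sat (G A.1) (assign ι (Function.update A.2 (ι i) v))}.ncard →
            1 ≤ {v | φ.Sat (G B.1) (assign ι (Function.update B.2 (ι i) v))}.ncard := by
          intro A B hAB hA
          rw [Nat.one_le_iff_ne_zero, ← Nat.pos_iff_ne_zero, Set.ncard_pos] at hA ⊢
          obtain ⟨v, hv⟩ := hA
          -- The class to look at is that of the witness position itself: not all moves from `A`
          -- leave it, hence not all moves from `B` do. Without counting the threshold plays no
          -- role, so `v` merely fills the argument.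
          have := hAB (A.place (ι i) v) v
          simp only [Many, Bool.false_eq_true, if_false] at this
          have hne : ¬ ∀ w, Differ false (fun s => (G s).Adj) t (B.place (ι i) w) (A.place (ι i) v) :=
            fun hw => differ_refl _ (this.2 hw v)
          push Not at hne
          obtain ⟨w, hw⟩ := hne
          exact ⟨w, (ih' _ _ (by omega) hw).2 hv⟩
        exact ⟨key A B fun C m => h.2 (ι i) C m, key B A fun C m => (h.2 (ι i) C m).symm⟩

end Formula

/-! ### Acceptance and isomorphism -/

namespace Position

variable {j n : ℕ}

/-- The isomorphism maps the moves on one graph bijectively to the moves on the other, and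
corresponding moves lead to the same class by induction. -/
theorem not_differ_of_iso {counting : Bool} {G : Fin 2 → SimpleGraph (Fin n)} {s s' : Fin 2}
    (e : G s ≃g G s') (t : ℕ) : ∀ f : Fin j → Fin n,
      ¬ Differ counting (fun s => (G s).Adj) t (s, f) (s', fun l => e (f l)) := by
  induction t with
  | zero => intro f; simp [Differ, SimpleGraph.Iso.map_adj_iff]
  | succ t ih =>
    intro f
    simp only [Differ, not_or, not_exists, not_not]
    refine ⟨ih f, fun i C m => ?_⟩
    have key : ∀ v, Differ counting (fun s => (G s).Adj) t (place (s, f) i v) C ↔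
        Differ counting (fun s => (G s).Adj) t (place (s', fun l => e (f l)) i (e v)) C := by
      intro v
      refine differ_congr_left ?_
      have hpl : place (s', fun l => e (f l)) i (e v) =
          (s', fun l => e (Function.update f i v l)) := by
        refine Prod.ext rfl (funext fun l => ?_)
        simp only [place, Function.update_apply]
        split_ifs <;> rfl
      rw [hpl]
      exact ih (Function.update f i v)
    simp only [Many]
    cases counting with
    | true =>
      simp only [if_true]
      have : {w | Differ true (fun s => (G s).Adj) t (place (s', fun l => e (f l)) i w) C} =
          e '' {v | Differ true (fun s => (G s).Adj) t (place (s, f) i v) C} := by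
        ext w
        constructor
        · intro hw; exact ⟨e.symm w, (key _).2 (by simpa using hw), by simp⟩
        · rintro ⟨v, hv, rfl⟩; exact (key v).1 hv
      rw [this, Set.ncard_image_of_injective _ e.injective]
    | false =>
      simp only [Bool.false_eq_true, if_false]
      exact ⟨fun h w => by simpa using (key (e.symm w)).1 (h _), fun h v => (key v).2 (h _)⟩

/-- Every position on the first graph is indistinguishable from one on the second. -/
def Accepts (counting : Bool) (adj : Fin 2 → Fin n → Fin n → Prop) (j R : ℕ) : Prop :=
  ∀ f : Fin j → Fin n, ∃ g : Fin j → Fin n, ¬ Differ counting adj R (0, f) (1, g)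

theorem accepts_of_iso {counting : Bool} {G : Fin 2 → SimpleGraph (Fin n)} (e : G 0 ≃g G 1)
    (R : ℕ) : Accepts counting (fun s => (G s).Adj) j R :=
  fun f => ⟨_, not_differ_of_iso e R f⟩

/-- Pebble all vertices of the first graph, with the spare pebbles on vertex `0`. Agreement in
equalities and adjacencies makes the answering position an isomorphism. This settles the small
orders, for which no defining sentence is assumed. -/
theorem iso_of_accepts_of_le {counting : Bool} {G : Fin 2 → SimpleGraph (Fin n)} {R : ℕ}
    (hn : 0 < n) (hnj : n ≤ j) (h : Accepts counting (fun s => (G s).Adj) j R) :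
    Nonempty (G 0 ≃g G 1) := by
  obtain ⟨g, hg⟩ := h fun l => if hl : l.val < n then ⟨l, hl⟩ else ⟨0, hn⟩
  have := not_differ_mono (Nat.zero_le R) hg
  simp only [Differ, not_or, not_exists, not_not] at this
  have he : ∀ u : Fin n, (if hl : (Fin.castLE hnj u).val < n then
    (⟨(Fin.castLE hnj u).val, hl⟩ : Fin n) else ⟨0, hn⟩) = u := fun u => by simp
  have hinj : Function.Injective fun u => g (Fin.castLE hnj u) := fun u v huv => by
    have := (this.1 (Fin.castLE hnj u) (Fin.castLE hnj v)).2 huv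
    rwa [he, he] at this
  refine ⟨⟨Equiv.ofBijective _ (Finite.injective_iff_bijective.1 hinj), fun {u v} => ?_⟩⟩
  have := this.2 (Fin.castLE hnj u) (Fin.castLE hnj v)
  rw [he, he] at this
  exact this.symm

/-- The starting position is immaterial, because a sentence has no free variables: any position on
the second graph that does not differ from it transfers `φ`. -/
theorem iso_of_accepts {counting : Bool} {G : Fin 2 → SimpleGraph (Fin n)} {R k : ℕ}
    (hn : 0 < n) (hkj : k ≤ j) {φ : Formula k} (hφ : φ.Defines (G 0)) (hd : φ.depth ≤ R)
    (hc : counting = false → φ.CountFree) (h : Accepts counting (fun s => (G s).Adj) j R) :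
    Nonempty (G 0 ≃g G 1) := by
  by_contra hne
  obtain ⟨g, hg⟩ := h fun _ => ⟨0, hn⟩
  refine hφ.2.2 n (G 1) (not_nonempty_iff.1 hne) ?_
  have := Formula.sat_iff_of_not_differ (Fin.castLE_injective hkj) φ hc R _ _ hd hg
  exact (Formula.holds_iff hφ.1 _).2 (this.1 ((Formula.holds_iff hφ.1 _).1 hφ.2.1))

end Position

/-- Depths are natural numbers: if all of them exceeded `d`, the infimum would be at least `d + 1`.
In particular a finite bound excludes the empty infimum `⊤`. -/
theorem exists_defines_of_countingDepth_le {k n d : ℕ} {G : SimpleGraph (Fin n)}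
    (h : countingDepth k G ≤ (d : ℕ∞)) : ∃ φ : Formula k, φ.Defines G ∧ φ.depth ≤ d := by
  by_contra! hne
  have : ((d + 1 : ℕ) : ℕ∞) ≤ countingDepth k G :=
    le_iInf₂ fun φ hφ => by exact_mod_cast hne φ hφ
  exact absurd (Nat.cast_le.1 (this.trans h)) (by omega)

theorem exists_defines_of_logicalDepth_le {k n d : ℕ} {G : SimpleGraph (Fin n)}
    (h : logicalDepth k G ≤ (d : ℕ∞)) :
    ∃ φ : Formula k, (φ.Defines G ∧ φ.CountFree) ∧ φ.depth ≤ d := by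
  by_contra! hne
  have : ((d + 1 : ℕ) : ℕ∞) ≤ logicalDepth k G :=
    le_iInf₂ fun φ hφ => by exact_mod_cast hne φ hφ
  exact absurd (Nat.cast_le.1 (this.trans h)) (by omega)

open Position

/-! ### The circuit for the pebble game -/

/-- A gate of the circuit: its layer `t`, its role `kind` in the layer, and its parameters. -/
@[ext]
structure Code (R j n : ℕ) : Type where
  t : Fin (R + 2)
  kind : Fin 5
  i : Fin j
  A : Position j n
  B : Position j n
  C : Position j n
  m : Fin n

namespace Code

def positionBounds (j n : ℕ) : List ℕ := [2] ++ List.replicate j n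

def bounds (R j n : ℕ) : List ℕ :=
  [R + 2] ++ ([5] ++ ([j] ++ (positionBounds j n ++ (positionBounds j n ++
    (positionBounds j n ++ [n])))))

def positionCoding (j n : ℕ) : Coding (Position j n) (positionBounds j n) :=
  (Coding.fin 2).prod (Coding.pi n j)

def equivProd (R j n : ℕ) : Code R j n ≃ Fin (R + 2) × Fin 5 × Fin j × Position j n ×
    Position j n × Position j n × Fin n where
  toFun a := (a.t, a.kind, a.i, a.A, a.B, a.C, a.m)
  invFun p := ⟨p.1, p.2.1, p.2.2.1, p.2.2.2.1, p.2.2.2.2.1, p.2.2.2.2.2.1, p.2.2.2.2.2.2⟩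
  left_inv _ := rfl
  right_inv _ := rfl

def coding (R j n : ℕ) : Coding (Code R j n) (bounds R j n) :=
  ((Coding.fin (R + 2)).prod ((Coding.fin 5).prod ((Coding.fin j).prod ((positionCoding j n).prod
    ((positionCoding j n).prod ((positionCoding j n).prod (Coding.fin n))))))).ofEquiv
      (equivProd R j n)

/-- Layer and role are the first two entries of the tuple, so the wires have to descend in these
only. -/
theorem enc_lt {R j n : ℕ} {a b : Code R j n} (h : b.t < a.t ∨ b.t = a.t ∧ b.kind < a.kind) :
    (coding R j n).enc b < (coding R j n).enc a := by
  refine List.cons_lt_cons_iff.2 (h.imp id fun h => ⟨congrArg _ h.1, ?_⟩)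
  exact List.cons_lt_cons_iff.2 (.inl h.2)

variable {N n R J : ℕ}

/-- The number of the input bit for the vertices `u` and `v` of graph `s`. -/
def adjBit (hN : 2 * n * n + 2 * n + 2 = N) (s : Fin 2) (u v : Fin n) : Fin N :=
  ⟨2 * n + 2 + s * (n * n) + u * n + v, by
    have h1 : s.val * (n * n) ≤ 1 * (n * n) := Nat.mul_le_mul_right _ (by omega)
    have h2 : (u.val + 1) * n ≤ n * n := Nat.mul_le_mul_right _ u.isLt
    have h3 := v.isLt
    nlinarith⟩

/-- The input bits in the unary code of the order of the first graph. -/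
def headerBit (hN : 2 * n * n + 2 * n + 2 = N) (s : Fin 2) (u : Fin n) : Fin N :=
  ⟨if s = 0 then u else n, by split_ifs <;> nlinarith [u.isLt]⟩

/-- This depends on the positions alone and not on the input, so it is settled when the circuit is
written. -/
def Mismatch {j : ℕ} (A B : Position j n) : Prop := ∃ l l', ¬ (A.2 l = A.2 l' ↔ B.2 l = B.2 l')

/-- The first two pebbles of `P` and `Q` are at the places of pebbles `l` and `l'` of `A` and `B`. -/
def Projects (A B P Q : Position (J + 2) n) : Prop :=
  P.1 = A.1 ∧ Q.1 = B.1 ∧ ∃ l l', P.2 0 = A.2 l ∧ P.2 1 = A.2 l' ∧ Q.2 0 = B.2 l ∧ Q.2 1 = B.2 l'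

def SameParams {j : ℕ} (a b : Code R j n) : Prop := b.i = a.i ∧ b.C = a.C ∧ b.m = a.m

def SamePositions {j : ℕ} (a b : Code R j n) : Prop := b.A = a.A ∧ b.B = a.B

def Swapped {j : ℕ} (a b : Code R j n) : Prop := b.A = a.B ∧ b.B = a.A

/-- The wires into the gates that are not in the last layer. -/
def InnerWire (a b : Code R (J + 2) n) : Prop :=
  (a.kind = 0 ∧ b.kind = 3 ∧ b.t.val + 1 = a.t ∧ b.B = a.C ∧ SameParams a b ∧ b.A.1 = a.A.1 ∧
      ∀ l, l = a.i ∨ b.A.2 l = a.A.2 l) ∨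
  (a.kind = 2 ∧ b.t = a.t ∧ SameParams a b ∧ b.B = a.B ∧
      (b.kind = 0 ∧ b.A = a.A ∨ b.kind = 1 ∧ b.A = a.B)) ∨
  (a.kind = 3 ∧ b.kind = 2 ∧ b.t = a.t ∧ a.t = 0 ∧ ¬ Mismatch a.A a.B ∧
      (Projects a.A a.B b.A b.B ∨ Projects a.B a.A b.A b.B)) ∨
  (a.kind = 3 ∧ b.kind = 2 ∧ b.t = a.t ∧ a.t ≠ 0 ∧ (SamePositions a b ∨ Swapped a b)) ∨
  (a.kind = 3 ∧ b.kind = 3 ∧ b.t.val + 1 = a.t ∧ SameParams a b ∧ SamePositions a b)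

/-- The wires into the gates of the last layer. -/
def LastWire {j : ℕ} (a b : Code R j n) : Prop :=
  b.t = a.t ∧
    ((a.kind = 3 ∧ b.kind = 2 ∧ b.A = a.A ∧ b.B.1 = 1) ∨
    (a.kind = 4 ∧ b.kind = 3 ∧ b.A.1 = 0) ∨
    (a.kind = 4 ∧ b.kind = 0 ∧ b.A.1 = 0) ∨
    (a.kind = 4 ∧ b.kind = 1 ∧ b.A.1 = 1))

def Wire (a b : Code R (J + 2) n) : Prop :=
  if a.t = Fin.last (R + 1) then LastWire a b else InnerWire a b

def predLayer (t : Fin (R + 2)) : Fin (R + 2) := ⟨t - 1, by omega⟩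

-- The roles in the layers `1, …, R`: kind 0 tests whether enough moves from `A` leave the class of
-- `C`, kind 1 negates this, kind 2 tests that it holds for `A` but not for `B`, and kind 3 collects
-- the reasons why `A` and `B` differ after `t` rounds. Layer 0 uses input bits in place of move
-- counts. The last layer negates the result of round `R`, takes an OR over the positions on the
-- second graph, and in kind 4 an AND over those on the first graph and over the header bits. Every
-- gate carries all parameters; those that its role ignores only produce copies.
open Classical in
noncomputable def gateKind (counting : Bool) (hN : 2 * n * n + 2 * n + 2 = N)
    (a : Code R (J + 2) n) : GateKind N (Code R (J + 2) n) :=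
  if a.kind = 0 then
    if a.t = 0 then .input (adjBit hN a.A.1 (a.A.2 0) (a.A.2 1))
    else if a.t = Fin.last (R + 1) then .input (headerBit hN a.A.1 (a.A.2 0))
    else if counting then .threshold (a.m + 1) else .and
  else if a.kind = 1 then .not { a with kind := 0 }
  else if a.kind = 2 then
    if a.t = Fin.last (R + 1) then .not { a with t := predLayer a.t, kind := 3 } else .and
  else if a.kind = 3 then
    if a.t = 0 ∧ Mismatch a.A a.B then .and else .or
  else .and

section

variable {counting : Bool} {hN : 2 * n * n + 2 * n + 2 = N} {a : Code R (J + 2) n}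

theorem gateKind_zero (hk : a.kind = 0) : gateKind counting hN a =
    if a.t = 0 then .input (adjBit hN a.A.1 (a.A.2 0) (a.A.2 1))
    else if a.t = Fin.last (R + 1) then .input (headerBit hN a.A.1 (a.A.2 0))
    else if counting then .threshold (a.m + 1) else .and := by
  rw [gateKind, if_pos hk]

theorem gateKind_one (hk : a.kind = 1) : gateKind counting hN a = .not { a with kind := 0 } := by
  rw [gateKind, if_neg (by rw [hk]; decide), if_pos hk]

open Classical in
theorem gateKind_two (hk : a.kind = 2) : gateKind counting hN a =
    if a.t = Fin.last (R + 1) then .not { a with t := predLayer a.t, kind := 3 } else .and := by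
  rw [gateKind, if_neg (by rw [hk]; decide), if_neg (by rw [hk]; decide), if_pos hk]

open Classical in
theorem gateKind_three (hk : a.kind = 3) : gateKind counting hN a =
    if a.t = 0 ∧ Mismatch a.A a.B then .and else .or := by
  rw [gateKind, if_neg (by rw [hk]; decide), if_neg (by rw [hk]; decide),
    if_neg (by rw [hk]; decide), if_pos hk]

theorem gateKind_four (hk : a.kind = 4) : gateKind counting hN a = .and := by
  rw [gateKind, if_neg (by rw [hk]; decide), if_neg (by rw [hk]; decide),
    if_neg (by rw [hk]; decide), if_neg (by rw [hk]; decide)]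

end

noncomputable def net (counting : Bool) (hN : 2 * n * n + 2 * n + 2 = N) (R J : ℕ) :
    Net N (Code R (J + 2) n) where
  kind := gateKind counting hN
  wire := Wire

theorem wire_lt {a b : Code R (J + 2) n} (h : Wire a b) :
    b.t < a.t ∨ b.t = a.t ∧ b.kind < a.kind := by
  unfold Wire at h
  split_ifs at h
  · refine .inr ⟨h.1, ?_⟩
    rcases h.2 with h | h | h | h <;> (rw [h.1, h.2.1]; decide)
  · rcases h with h | h | h | h | h
    · exact .inl (by rw [Fin.lt_def]; omega)
    · refine .inr ⟨h.2.1, ?_⟩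
      rcases h.2.2.2.2 with h' | h' <;> (rw [h.1, h'.1]; decide)
    · exact .inr ⟨h.2.2.1, by rw [h.1, h.2.1]; decide⟩
    · exact .inr ⟨h.2.2.1, by rw [h.1, h.2.1]; decide⟩
    · exact .inl (by rw [Fin.lt_def]; omega)

theorem not_lt {counting : Bool} {hN : 2 * n * n + 2 * n + 2 = N} {a b : Code R (J + 2) n}
    (h : gateKind counting hN a = .not b) : b.t < a.t ∨ b.t = a.t ∧ b.kind < a.kind := by
  unfold gateKind at h
  split_ifs at h with h0 h1 h2 h3 h4 h5 h6 h7 h8 <;> cases h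
  · exact .inr ⟨rfl, by rw [h4]; exact Fin.zero_lt_one⟩
  · refine .inl ?_
    rw [Fin.lt_def, h6]; simp [predLayer]

theorem topological (counting : Bool) (hN : 2 * n * n + 2 * n + 2 = N) (R J : ℕ) :
    (net counting hN R J).Topological (coding R (J + 2) n) :=
  ⟨fun _ _ h => enc_lt (wire_lt h), fun _ _ h => enc_lt (not_lt h)⟩

/-- The factor 5 is the number of roles, so a gate in a lower layer always has smaller height. -/
def height {j : ℕ} (a : Code R j n) : ℕ := 5 * a.t + a.kind

theorem height_lt {j : ℕ} {a b : Code R j n} (h : b.t < a.t ∨ b.t = a.t ∧ b.kind < a.kind) :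
    height b < height a := by
  unfold height
  rcases h with h | h
  · rw [Fin.lt_def] at h; omega
  · rw [h.1]; have := h.2; rw [Fin.lt_def] at this; omega

/-! ### The values of the gates -/

section Value

variable (counting : Bool) (hN : 2 * n * n + 2 * n + 2 = N) (x : Fin N → Bool)

def inputAdj (s : Fin 2) (u v : Fin n) : Prop := x (adjBit hN s u v) = true

def differ (t : ℕ) (A B : Position (J + 2) n) : Prop := Differ counting (inputAdj hN x) t A B

def Base (t : Fin (R + 2)) (i : Fin (J + 2)) (A C : Position (J + 2) n) (m : Fin n) : Prop :=
  if t = 0 then inputAdj hN x A.1 (A.2 0) (A.2 1)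
  else if t = Fin.last (R + 1) then x (headerBit hN A.1 (A.2 0)) = true
  else Many counting (differ counting hN x (t - 1)) A i C m

/-- The first unary block of the input has length exactly `n`. Together with the length of the input
this forces the second graph to have order `n` as well. -/
def Header : Prop := (∀ u : Fin n, x (headerBit hN 0 u) = true) ∧
  ∀ u : Fin n, x (headerBit hN 1 u) = false

def Value (a : Code R (J + 2) n) : Prop :=
  if a.kind = 0 then Base counting hN x a.t a.i a.A a.C a.m
  else if a.kind = 1 then ¬ Base counting hN x a.t a.i a.A a.C a.m
  else if a.kind = 2 then
    if a.t = Fin.last (R + 1) then ¬ differ counting hN x R a.A a.B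
    else Base counting hN x a.t a.i a.A a.C a.m ∧ ¬ Base counting hN x a.t a.i a.B a.C a.m
  else if a.kind = 3 then
    if a.t = Fin.last (R + 1) then
      ∃ g : Fin (J + 2) → Fin n, ¬ differ counting hN x R a.A (1, g)
    else differ counting hN x a.t a.A a.B
  else a.t = Fin.last (R + 1) →
    Accepts counting (inputAdj hN x) (J + 2) R ∧ Header hN x

variable {counting hN x}

theorem predLayer_ne_last (t : Fin (R + 2)) : predLayer t ≠ Fin.last (R + 1) := by
  have := t.isLt
  simp only [predLayer, Fin.last, ne_eq, Fin.mk.injEq]; omega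

/-- The wires fix even the parameters that are irrelevant to the predecessor. So there is exactly
one predecessor for each move of the pebble, and a threshold gate counts moves and not copies of
gates. -/
theorem wire_mid_zero {a : Code R (J + 2) n} (hk : a.kind = 0) (h0 : a.t ≠ 0)
    (hl : a.t ≠ Fin.last (R + 1)) (b : Code R (J + 2) n) :
    Wire a b ↔ ∃ v, b = { a with t := predLayer a.t, kind := 3, A := a.A.place a.i v, B := a.C } := by
  have ht : 0 < a.t.val := Nat.pos_of_ne_zero fun h => h0 (Fin.ext h)
  rw [Wire, if_neg hl]
  constructor
  · rintro (h | h | h | h | h)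
    · obtain ⟨-, h3, h4, h5, ⟨h6, h7, h8⟩, h9, h10⟩ := h
      refine ⟨b.A.2 a.i, Code.ext (Fin.ext ?_) h3 h6 (Prod.ext h9 (funext fun l => ?_)) h5 h7 h8⟩
      · simp only [predLayer]; omega
      · simp only [place, Function.update_apply]
        split_ifs with hl
        · rw [hl]
        · exact (h10 l).resolve_left hl
    all_goals exact absurd (hk.symm.trans h.1) (by decide)
  · rintro ⟨v, rfl⟩
    refine .inl ⟨hk, rfl, ?_, rfl, ⟨rfl, rfl, rfl⟩, rfl, fun l => ?_⟩
    · simp only [predLayer]; omega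
    · by_cases hl : l = a.i
      · exact .inl hl
      · exact .inr (by simp [place, Function.update_of_ne hl])

theorem value_pred {a : Code R (J + 2) n} (A B : Position (J + 2) n) :
    Value counting hN x { a with t := predLayer a.t, kind := 3, A := A, B := B } ↔
      differ counting hN x (a.t - 1) A B := by
  simp only [Value, if_neg (predLayer_ne_last a.t)]
  rfl

theorem consistent_zero {a : Code R (J + 2) n} (hk : a.kind = 0) :
    Value counting hN x a ↔
      Net.LocalValue Wire x (Value counting hN x) a (gateKind counting hN a) := by
  rw [Value, if_pos hk, Base, gateKind_zero hk]
  by_cases h0 : a.t = 0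
  · simp only [if_pos h0, Net.LocalValue]; rfl
  by_cases hl : a.t = Fin.last (R + 1)
  · simp only [if_neg h0, if_pos hl, Net.LocalValue]
  simp only [if_neg h0, if_neg hl]
  cases counting with
  | true =>
    simp only [if_true, Many, Net.LocalValue]
    have : {b | Wire a b ∧ Value true hN x b} =
        (fun v => { a with t := predLayer a.t, kind := 3, A := a.A.place a.i v, B := a.C }) ''
          {v | differ true hN x (a.t - 1) (a.A.place a.i v) a.C} := by
      ext b
      simp only [wire_mid_zero hk h0 hl, Set.mem_ofPred_eq, Set.mem_image]
      constructor
      · rintro ⟨⟨v, rfl⟩, hb⟩; exact ⟨v, (value_pred _ _).1 hb, rfl⟩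
      · rintro ⟨v, hv, rfl⟩; exact ⟨⟨v, rfl⟩, (value_pred _ _).2 hv⟩
    rw [this, Set.ncard_image_of_injective]
    intro u v huv
    have := congrFun (congrArg (fun b => b.A.2) huv) a.i
    simpa [place] using this
  | false =>
    simp only [Bool.false_eq_true, if_false, Many, Net.LocalValue]
    constructor
    · intro h b hb
      obtain ⟨v, rfl⟩ := (wire_mid_zero hk h0 hl b).1 hb
      exact (value_pred _ _).2 (h v)
    · intro h v
      exact (value_pred _ _).1 (h _ ((wire_mid_zero hk h0 hl _).2 ⟨v, rfl⟩))

theorem value_zero {a : Code R (J + 2) n} (hk : a.kind = 0) :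
    Value counting hN x a ↔ Base counting hN x a.t a.i a.A a.C a.m := by rw [Value, if_pos hk]

theorem value_one {a : Code R (J + 2) n} (hk : a.kind = 1) :
    Value counting hN x a ↔ ¬ Base counting hN x a.t a.i a.A a.C a.m := by
  rw [Value, if_neg (by rw [hk]; decide), if_pos hk]

theorem value_two {a : Code R (J + 2) n} (hk : a.kind = 2) :
    Value counting hN x a ↔ if a.t = Fin.last (R + 1) then ¬ differ counting hN x R a.A a.B
      else Base counting hN x a.t a.i a.A a.C a.m ∧ ¬ Base counting hN x a.t a.i a.B a.C a.m := by
  rw [Value, if_neg (by rw [hk]; decide), if_neg (by rw [hk]; decide), if_pos hk]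

theorem value_three {a : Code R (J + 2) n} (hk : a.kind = 3) :
    Value counting hN x a ↔ if a.t = Fin.last (R + 1) then
      ∃ g : Fin (J + 2) → Fin n, ¬ differ counting hN x R a.A (1, g)
    else differ counting hN x a.t a.A a.B := by
  rw [Value, if_neg (by rw [hk]; decide), if_neg (by rw [hk]; decide),
    if_neg (by rw [hk]; decide), if_pos hk]

theorem value_four {a : Code R (J + 2) n} (hk : a.kind = 4) :
    Value counting hN x a ↔ (a.t = Fin.last (R + 1) →
      Accepts counting (inputAdj hN x) (J + 2) R ∧ Header hN x) := by
  rw [Value, if_neg (by rw [hk]; decide), if_neg (by rw [hk]; decide),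
    if_neg (by rw [hk]; decide), if_neg (by rw [hk]; decide)]

theorem consistent_two {a : Code R (J + 2) n} (hk : a.kind = 2) :
    Value counting hN x a ↔
      Net.LocalValue Wire x (Value counting hN x) a (gateKind counting hN a) := by
  rw [value_two hk, gateKind_two hk]
  by_cases hl : a.t = Fin.last (R + 1)
  · simp only [if_pos hl, Net.LocalValue]
    rw [value_pred, hl]
    simp
  · simp only [if_neg hl, Wire, Net.LocalValue]
    constructor
    · rintro ⟨h1, h2⟩ b hb
      rcases hb with h | h | h | h | h
      · exact absurd (hk.symm.trans h.1) (by decide)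
      · obtain ⟨-, ht, ⟨hi, hC, hm⟩, -, ⟨hb, hA⟩ | ⟨hb, hA⟩⟩ := h
        · rwa [value_zero hb, ht, hi, hC, hm, hA]
        · rwa [value_one hb, ht, hi, hC, hm, hA]
      all_goals exact absurd (hk.symm.trans h.1) (by decide)
    · intro h
      refine ⟨?_, ?_⟩
      · exact (value_zero (a := { a with kind := 0 }) rfl).1 (h { a with kind := 0 }
          (.inr (.inl ⟨hk, rfl, ⟨rfl, rfl, rfl⟩, rfl, .inl ⟨rfl, rfl⟩⟩)))
      · exact (value_one (a := { a with kind := 1, A := a.B }) rfl).1 (h { a with kind := 1, A := a.B }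
          (.inr (.inl ⟨hk, rfl, ⟨rfl, rfl, rfl⟩, rfl, .inr ⟨rfl, rfl⟩⟩)))

/-- Gates of kind 0 in layer 0 read pebbles 0 and 1 only. Any other pair of pebbles is examined
through positions that have these two at the places in question. -/
theorem exists_projects (A B : Position (J + 2) n) (l l' : Fin (J + 2)) :
    ∃ P Q : Position (J + 2) n, Projects A B P Q ∧ P.2 0 = A.2 l ∧ P.2 1 = A.2 l' ∧
      Q.2 0 = B.2 l ∧ Q.2 1 = B.2 l' :=
  ⟨(A.1, fun p => if p = 0 then A.2 l else A.2 l'), (B.1, fun p => if p = 0 then B.2 l else B.2 l'),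
    ⟨rfl, rfl, l, l', by simp⟩, by simp⟩

theorem consistent_three {a : Code R (J + 2) n} (hk : a.kind = 3) :
    Value counting hN x a ↔
      Net.LocalValue Wire x (Value counting hN x) a (gateKind counting hN a) := by
  rw [value_three hk, gateKind_three hk]
  by_cases hl : a.t = Fin.last (R + 1)
  · have h0 : a.t ≠ 0 := by rw [hl]; exact (Fin.last_pos' (n := R + 1)).ne'
    have hn : ¬ (a.t = 0 ∧ Mismatch a.A a.B) := fun h => h0 h.1
    simp only [if_pos hl, if_neg hn, Wire, Net.LocalValue]
    constructor
    · rintro ⟨g, hg⟩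
      refine ⟨{ a with kind := 2, B := (1, g) }, ⟨rfl, .inl ⟨hk, rfl, rfl, rfl⟩⟩, ?_⟩
      rwa [value_two rfl, if_pos hl]
    · rintro ⟨b, ⟨ht, h | h | h | h⟩, hv⟩
      · obtain ⟨-, hb, hA, hB⟩ := h
        rw [value_two hb, ht, if_pos hl, hA] at hv
        exact ⟨b.B.2, by rwa [← hB]⟩
      all_goals exact absurd (hk.symm.trans h.1) (by decide)
  by_cases h0 : a.t = 0
  · have hbase : ∀ (i : Fin (J + 2)) A C m, Base counting hN x a.t i A C m ↔
        inputAdj hN x A.1 (A.2 0) (A.2 1) := fun i A C m => by rw [Base, if_pos h0]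
    have hz : a.t.val = 0 := by rw [h0]; rfl
    -- With different equality patterns the gate is an AND without wires, which is true.
    by_cases hm : Mismatch a.A a.B
    · simp only [if_neg hl, if_pos (And.intro h0 hm), Wire, Net.LocalValue]
      refine iff_of_true ?_ fun b hb => ?_
      · rw [hz]; exact .inl hm
      · rcases hb with h | h | h | h | h
        · exact absurd (hk.symm.trans h.1) (by decide)
        · exact absurd (hk.symm.trans h.1) (by decide)
        · exact absurd hm h.2.2.2.2.1
        · exact absurd h0 h.2.2.2.1
        · omega
    · have hn : ¬ (a.t = 0 ∧ Mismatch a.A a.B) := fun h => hm h.2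
      simp only [if_neg hl, if_neg hn, Wire, Net.LocalValue]
      rw [hz, differ, Differ]
      constructor
      · rintro (h | ⟨l, l', h⟩)
        · exact absurd h hm
        · obtain ⟨P, Q, hPQ, h1, h2, h3, h4⟩ := exists_projects a.A a.B l l'
          -- Kind 2 detects only "first yes, second no", so the two positions are swapped if the
          -- adjacency holds on the side of `B`.
          by_cases hA : inputAdj hN x a.A.1 (a.A.2 l) (a.A.2 l')
          · refine ⟨{ a with kind := 2, A := P, B := Q },
              .inr (.inr (.inl ⟨hk, rfl, rfl, h0, hm, .inl hPQ⟩)), ?_⟩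
            rw [value_two rfl, if_neg hl]
            simp only [hbase, hPQ.1, hPQ.2.1, h1, h2, h3, h4]
            tauto
          · obtain ⟨P, Q, hPQ, h1, h2, h3, h4⟩ := exists_projects a.B a.A l l'
            refine ⟨{ a with kind := 2, A := P, B := Q },
              .inr (.inr (.inl ⟨hk, rfl, rfl, h0, hm, .inr hPQ⟩)), ?_⟩
            rw [value_two rfl, if_neg hl]
            simp only [hbase, hPQ.1, hPQ.2.1, h1, h2, h3, h4]
            tauto
      · rintro ⟨b, h | h | h | h | h, hv⟩
        · exact absurd (hk.symm.trans h.1) (by decide)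
        · exact absurd (hk.symm.trans h.1) (by decide)
        · obtain ⟨-, hb, ht, -, -, hp⟩ := h
          rw [value_two hb, ht, if_neg hl, hbase, hbase] at hv
          rcases hp with ⟨hP, hQ, l, l', h1, h2, h3, h4⟩ | ⟨hP, hQ, l, l', h1, h2, h3, h4⟩ <;>
          · rw [hP, hQ, h1, h2, h3, h4] at hv
            exact .inr ⟨l, l', by tauto⟩
        · exact absurd h0 h.2.2.2.1
        · omega
  · have hn : ¬ (a.t = 0 ∧ Mismatch a.A a.B) := fun h => h0 h.1
    have hbase : ∀ (i : Fin (J + 2)) A C m, Base counting hN x a.t i A C m ↔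
        Many counting (differ counting hN x (a.t - 1)) A i C m := fun i A C m => by
      rw [Base, if_neg h0, if_neg hl]
    obtain ⟨s, hs⟩ : ∃ s, a.t.val = s + 1 :=
      Nat.exists_eq_succ_of_ne_zero fun h => h0 (Fin.ext h)
    simp only [if_neg hl, if_neg hn, Wire, Net.LocalValue]
    rw [hs, differ, Differ]
    rw [hs] at hbase
    simp only [Nat.add_sub_cancel] at hbase
    constructor
    · rintro (h | ⟨i, C, m, h⟩)
      · refine ⟨{ a with t := predLayer a.t, kind := 3 }, .inr (.inr (.inr (.inr
          ⟨hk, rfl, ?_, ⟨rfl, rfl, rfl⟩, rfl, rfl⟩))), ?_⟩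
        · simp only [predLayer]; omega
        · rw [value_pred, hs]
          exact h
      · by_cases hA : Many counting (differ counting hN x s) a.A i C m
        · refine ⟨{ a with kind := 2, i := i, C := C, m := m },
            .inr (.inr (.inr (.inl ⟨hk, rfl, rfl, h0, .inl ⟨rfl, rfl⟩⟩))), ?_⟩
          rw [value_two rfl, if_neg hl]
          simp only [hbase]
          exact ⟨hA, fun hB => h (iff_of_true hA hB)⟩
        · refine ⟨{ a with kind := 2, A := a.B, B := a.A, i := i, C := C, m := m },
            .inr (.inr (.inr (.inl ⟨hk, rfl, rfl, h0, .inr ⟨rfl, rfl⟩⟩))), ?_⟩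
          rw [value_two rfl, if_neg hl]
          simp only [hbase]
          exact ⟨by_contra fun hB => h (iff_of_false hA hB), hA⟩
    · rintro ⟨b, h | h | h | h | h, hv⟩
      · exact absurd (hk.symm.trans h.1) (by decide)
      · exact absurd (hk.symm.trans h.1) (by decide)
      · exact absurd h.2.2.2.1 h0
      · obtain ⟨-, hb, ht, -, hp⟩ := h
        rw [value_two hb, ht, if_neg hl, hbase, hbase] at hv
        rcases hp with ⟨hP, hQ⟩ | ⟨hP, hQ⟩ <;> rw [hP, hQ] at hv
        · exact .inr ⟨b.i, b.C, b.m, fun h => hv.2 (h.1 hv.1)⟩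
        · exact .inr ⟨b.i, b.C, b.m, fun h => hv.2 (h.2 hv.1)⟩
      · obtain ⟨-, hb, ht, -, hP, hQ⟩ := h
        have hbl : b.t ≠ Fin.last (R + 1) := fun h => by
          have := congrArg Fin.val h
          simp only [Fin.val_last] at this
          have := a.t.isLt
          omega
        have hbs : b.t.val = s := by omega
        rw [value_three hb, if_neg hbl, hP, hQ, hbs] at hv
        exact .inl hv

theorem consistent_four {a : Code R (J + 2) n} (hk : a.kind = 4) :
    Value counting hN x a ↔
      Net.LocalValue Wire x (Value counting hN x) a (gateKind counting hN a) := by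
  rw [value_four hk, gateKind_four hk]
  by_cases hl : a.t = Fin.last (R + 1)
  · have h0 : a.t ≠ 0 := by rw [hl]; exact (Fin.last_pos' (n := R + 1)).ne'
    have hbase : ∀ (i : Fin (J + 2)) A C m, Base counting hN x a.t i A C m ↔
        x (headerBit hN A.1 (A.2 0)) = true := fun i A C m => by
      rw [Base, if_neg h0, if_pos hl]
    simp only [hl, forall_const, Wire, Net.LocalValue, if_true]
    constructor
    · rintro ⟨hacc, hh1, hh2⟩ b ⟨ht, h | h | h | h⟩
      · exact absurd (hk.symm.trans h.1) (by decide)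
      · obtain ⟨-, hb, hA⟩ := h
        rw [value_three hb, ht, if_pos hl]
        obtain ⟨g, hg⟩ := hacc b.A.2
        exact ⟨g, by rwa [← hA] at hg⟩
      · obtain ⟨-, hb, hA⟩ := h
        rw [value_zero hb, ht, hbase, hA]
        exact hh1 _
      · obtain ⟨-, hb, hA⟩ := h
        rw [value_one hb, ht, hbase, hA, hh2]
        simp
    · intro h
      refine ⟨fun f => ?_, fun u => ?_, fun u => ?_⟩
      · have := h { a with kind := 3, A := (0, f) } ⟨rfl, .inr (.inl ⟨hk, rfl, rfl⟩)⟩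
        rwa [value_three rfl, if_pos hl] at this
      · have := h { a with kind := 0, A := (0, fun _ => u) } ⟨rfl, .inr (.inr (.inl ⟨hk, rfl, rfl⟩))⟩
        rwa [value_zero rfl, hbase] at this
      · have := h { a with kind := 1, A := (1, fun _ => u) } ⟨rfl, .inr (.inr (.inr ⟨hk, rfl, rfl⟩))⟩
        rw [value_one rfl, hbase] at this
        simpa using this
  -- Outside the last layer a gate of kind 4 is an AND without wires, hence true; no other gate
  -- reads it.
  · simp only [hl, false_imp_iff, Wire, Net.LocalValue, if_false, true_iff]
    rintro b (h | h | h | h | h) <;> exact absurd (hk.symm.trans h.1) (by decide)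

theorem consistent : (net counting hN R J).Consistent x (Value counting hN x) := by
  intro a
  have hk : a.kind = 0 ∨ a.kind = 1 ∨ a.kind = 2 ∨ a.kind = 3 ∨ a.kind = 4 := by
    generalize a.kind = q
    revert q; decide
  rcases hk with hk | hk | hk | hk | hk
  · exact consistent_zero hk
  · simp only [net]
    rw [value_one hk, gateKind_one hk]
    exact not_congr (value_zero (a := { a with kind := 0 }) rfl).symm
  · exact consistent_two hk
  · exact consistent_three hk
  · exact consistent_four hk

end Value

theorem length_pos (R J : ℕ) (hn : 0 < n) : 0 < (tuples (bounds R (J + 2) n)).length :=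
  List.length_pos_of_mem ((coding R (J + 2) n).enc_mem
    ⟨0, 0, 0, (0, fun _ => ⟨0, hn⟩), (0, fun _ => ⟨0, hn⟩), (0, fun _ => ⟨0, hn⟩), ⟨0, hn⟩⟩)

noncomputable def circuit (counting : Bool) (hN : 2 * n * n + 2 * n + 2 = N) (R J : ℕ) (hn : 0 < n) :
    Circuit N :=
  (net counting hN R J).toCircuit (coding R (J + 2) n) (length_pos R J hn)

/-- The output gate is the lexicographically last tuple. Its layer and its kind are maximal, since
raising them would give a larger tuple, and its value does not depend on the other entries. -/
theorem eval_circuit {counting : Bool} {hN : 2 * n * n + 2 * n + 2 = N} {hn : 0 < n}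
    {x : Fin N → Bool} : (circuit counting hN R J hn).eval x = true ↔
      Accepts counting (inputAdj hN x) (J + 2) R ∧ Header hN x := by
  rw [Circuit.eval]
  refine (Net.val_iff (h0 := length_pos R J hn) (topological counting hN R J)
    (consistent (J := J)) ⟨(tuples (bounds R (J + 2) n)).length - 1, _⟩).trans ?_
  set L : Fin (tuples (bounds R (J + 2) n)).length :=
    ⟨(tuples (bounds R (J + 2) n)).length - 1, _⟩ with hL
  set a := (coding R (J + 2) n).decode L with ha
  let b : Code R (J + 2) n := { a with t := Fin.last (R + 1), kind := 4 }
  have hle : ¬ (coding R (J + 2) n).enc a < (coding R (J + 2) n).enc b := by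
    rw [Coding.enc_lt_iff, ha, Coding.index_decode, hL, Fin.lt_def]
    have := ((coding R (J + 2) n).index b).isLt
    simp only; omega
  have ht : a.t = Fin.last (R + 1) := by
    by_contra hne
    exact hle (enc_lt (.inl (lt_of_le_of_ne (Fin.le_last _) hne)))
  have hk : a.kind = 4 := by
    by_contra hne
    refine hle (enc_lt (.inr ⟨ht, lt_of_le_of_ne (Fin.le_last a.kind) hne⟩))
  exact (value_four hk).trans (by simp [ht])

theorem circuit_isAC {hN : 2 * n * n + 2 * n + 2 = N} {hn : 0 < n} :
    (circuit false hN R J hn).IsAC := by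
  refine Net.toCircuit_isAC fun a m => ?_
  simp only [net, gateKind]
  split_ifs <;> simp_all

theorem depth_circuit_le {counting : Bool} {hN : 2 * n * n + 2 * n + 2 = N} {hn : 0 < n} :
    (circuit counting hN R J hn).depth ≤ 5 * R + 10 := by
  refine Finset.sup_le fun i _ => (Net.gateDepth_le (h := height)
    (fun _ _ h => height_lt (wire_lt h)) (fun _ _ h => height_lt (not_lt h)) i).trans ?_
  generalize (coding R (J + 2) n).decode i = a
  have := a.t.isLt
  have := a.kind.isLt
  unfold height
  omega

end Code

/-! ### Derived programs -/

inductive Cond : Type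
  | tt
  | test (t : Test)
  | not (c : Cond)
  | and (c d : Cond)
  | or (c d : Cond)

namespace Cond

def Holds (ρ : ℕ → ℕ) : Cond → Prop
  | tt => True
  | test t => t.Holds ρ
  | not c => ¬ c.Holds ρ
  | and c d => c.Holds ρ ∧ d.Holds ρ
  | or c d => c.Holds ρ ∨ d.Holds ρ

def eq (x y : ℕ) : Cond := test (.eq x y)

def lt (x y : ℕ) : Cond := test (.lt x y)

def any (m : ℕ) (f : Fin m → Cond) : Cond := (List.ofFn f).foldr or (not tt)

def all (m : ℕ) (f : Fin m → Cond) : Cond := (List.ofFn f).foldr and tt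

/-- Lexicographic comparison of two tuples of variables. -/
def lex : List ℕ → List ℕ → Cond
  | x :: xs, y :: ys => or (lt x y) (and (eq x y) (lex xs ys))
  | _, _ => not tt

variable {ρ : ℕ → ℕ}

@[simp] theorem holds_tt : tt.Holds ρ ↔ True := Iff.rfl
@[simp] theorem holds_not {c : Cond} : (not c).Holds ρ ↔ ¬ c.Holds ρ := Iff.rfl
@[simp] theorem holds_and {c d : Cond} : (and c d).Holds ρ ↔ c.Holds ρ ∧ d.Holds ρ := Iff.rfl
@[simp] theorem holds_or {c d : Cond} : (or c d).Holds ρ ↔ c.Holds ρ ∨ d.Holds ρ := Iff.rfl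
@[simp] theorem holds_eq {x y : ℕ} : (eq x y).Holds ρ ↔ ρ x = ρ y := Iff.rfl
@[simp] theorem holds_lt {x y : ℕ} : (lt x y).Holds ρ ↔ ρ x < ρ y := Iff.rfl

@[simp] theorem holds_any {m : ℕ} {f : Fin m → Cond} :
    (any m f).Holds ρ ↔ ∃ l, (f l).Holds ρ := by
  have : ∀ L : List Cond, (L.foldr or (not tt)).Holds ρ ↔ ∃ c ∈ L, c.Holds ρ := by
    intro L; induction L with
    | nil => simp
    | cons c L ih => simp [ih]
  simp [any, this, List.mem_ofFn]

@[simp] theorem holds_all {m : ℕ} {f : Fin m → Cond} :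
    (all m f).Holds ρ ↔ ∀ l, (f l).Holds ρ := by
  have : ∀ L : List Cond, (L.foldr and tt).Holds ρ ↔ ∀ c ∈ L, c.Holds ρ := by
    intro L; induction L with
    | nil => simp
    | cons c L ih => simp [ih]
  simp [all, this, List.mem_ofFn]

theorem holds_lex : ∀ xs ys : List ℕ, xs.length = ys.length →
    ((lex xs ys).Holds ρ ↔ xs.map ρ < ys.map ρ)
  | [], [], _ => by simp [lex]
  | x :: xs, y :: ys, h => by
    rw [lex, holds_or, holds_and, holds_lex xs ys (by simpa using h), List.map_cons, List.map_cons,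
      List.cons_lt_cons_iff, holds_lt, holds_eq]

end Cond

namespace Prog

def branch : Cond → Prog → Prog → Prog
  | .tt, P, _ => P
  | .test t, P, Q => ite t P Q
  | .not c, P, Q => branch c Q P
  | .and c d, P, Q => branch c (branch d P Q) Q
  | .or c d, P, Q => branch c P (branch d P Q)

open Classical in
theorem out_branch (c : Cond) (P Q : Prog) (n : ℕ) (ρ : ℕ → ℕ) :
    (branch c P Q).out n ρ = if c.Holds ρ then P.out n ρ else Q.out n ρ := by
  induction c generalizing P Q with
  | tt => simp [branch]
  | test t => rfl
  | not c ih => simp only [branch, ih, Cond.holds_not]; split_ifs <;> rfl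
  | and c d ih1 ih2 =>
    simp only [branch, ih1, ih2, Cond.holds_and]
    by_cases h1 : c.Holds ρ <;> by_cases h2 : d.Holds ρ <;> simp [h1, h2]
  | or c d ih1 ih2 =>
    simp only [branch, ih1, ih2, Cond.holds_or]
    by_cases h1 : c.Holds ρ <;> by_cases h2 : d.Holds ρ <;> simp [h1, h2]

def write : List Bool → Prog
  | [] => skip
  | b :: bs => seq (emit b) (write bs)

@[simp] theorem out_write (bs : List Bool) (n : ℕ) (ρ : ℕ → ℕ) : (write bs).out n ρ = bs := by
  induction bs with
  | nil => rfl
  | cons b bs ih => simp [write, out, ih]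

/-- Nested loops below the variables `ys`. -/
def nest : List ℕ → Prog → Prog
  | [], P => P
  | y :: ys, P => loop y (nest ys P)

/-- The values `ds` for the variables from `n` on. -/
def extend (ρ : ℕ → ℕ) : ℕ → List ℕ → ℕ → ℕ
  | _, [] => ρ
  | n, d :: ds => extend (Function.update ρ n d) (n + 1) ds

theorem extend_of_lt {x : ℕ} (ds : List ℕ) : ∀ (n : ℕ) (ρ : ℕ → ℕ), x < n →
    extend ρ n ds x = ρ x := by
  induction ds with
  | nil => intro n ρ _; rfl
  | cons d ds ih =>
    intro n ρ h
    rw [extend, ih _ _ (by omega), Function.update_of_ne h.ne]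

theorem extend_add (ds : List ℕ) : ∀ (n : ℕ) (ρ : ℕ → ℕ) (i : ℕ) (h : i < ds.length),
    extend ρ n ds (n + i) = ds[i] := by
  induction ds with
  | nil => intro n ρ i h; simp at h
  | cons d ds ih =>
    intro n ρ i h
    cases i with
    | zero => simp [extend, extend_of_lt]
    | succ i =>
      have := ih (n + 1) (Function.update ρ n d) i (by simpa using h)
      rw [extend, show n + (i + 1) = n + 1 + i by ring, this]
      rfl

/-- The bounds are variables below level `n`, so no loop changes the bound of another, and the
tuples range over a fixed box. -/
theorem out_nest (P : Prog) (ys : List ℕ) : ∀ (n : ℕ) (ρ : ℕ → ℕ), (∀ y ∈ ys, y < n) →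
    (nest ys P).out n ρ = (tuples (ys.map ρ)).flatMap fun ds =>
      P.out (n + ys.length) (extend ρ n ds) := by
  induction ys with
  | nil => intro n ρ _; simp [nest, tuples, extend]
  | cons y ys ih =>
    intro n ρ h
    simp only [nest, out, List.map_cons, tuples, List.flatMap_assoc, List.flatMap_map]
    refine List.flatMap_congr fun v _ => ?_
    rw [ih _ _ fun z hz => (h z (List.mem_cons_of_mem _ hz)).trans (Nat.lt_succ_self n)]
    have : ys.map (Function.update ρ n v) = ys.map ρ := List.map_congr_left fun z hz =>
      Function.update_of_ne (h z (List.mem_cons_of_mem _ hz)).ne _ _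
    rw [this, List.length_cons, show n + (ys.length + 1) = n + 1 + ys.length by ring]
    rfl

/-- Write as many ones as the product of the variables `ys`. -/
def ones (ys : List ℕ) : Prog := nest ys (emit true)

theorem out_ones {ys : List ℕ} {n : ℕ} {ρ : ℕ → ℕ} (h : ∀ y ∈ ys, y < n) :
    (ones ys).out n ρ = List.replicate (ys.map ρ).prod true := by
  rw [ones, out_nest _ _ _ _ h, ← length_tuples]
  generalize tuples (ys.map ρ) = I
  induction I with
  | nil => rfl
  | cons d I ih => rw [List.flatMap_cons, ih]; rfl

theorem out_count {P Q : Prog} {n m : ℕ} {ρ : ℕ → ℕ} (h : (P.out (n + 1) ρ).length = m)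
    (hm : m ≤ ρ 0) : (count P Q).out n ρ = Q.out (n + 1) (Function.update ρ n m) := by
  rw [out, h, min_eq_left hm]

open Classical in
theorem length_flatMap_ite {α : Type} (p : α → Prop) (m : ℕ) (l : List α) :
    (l.flatMap fun a => if p a then List.replicate m true else []).length =
      m * l.countP fun a => decide (p a) := by
  induction l with
  | nil => simp
  | cons a l ih =>
    rw [List.flatMap_cons, List.length_append, ih, List.countP_cons]
    by_cases h : p a <;> simp [h]; ring

end Prog

/-- The values from variable `v` on are `ds`. -/
def Reads (ρ : ℕ → ℕ) (v : ℕ) (ds : List ℕ) : Prop :=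
  ∀ i (h : i < ds.length), ρ (v + i) = ds[i]

theorem reads_extend (ρ : ℕ → ℕ) (n : ℕ) (ds : List ℕ) : Reads (Prog.extend ρ n ds) n ds :=
  fun i h => Prog.extend_add ds n ρ i h

theorem reads_append {ρ : ℕ → ℕ} {v : ℕ} {ds es : List ℕ} :
    Reads ρ v (ds ++ es) ↔ Reads ρ v ds ∧ Reads ρ (v + ds.length) es := by
  constructor
  · intro h
    refine ⟨fun i hi => ?_, fun i hi => ?_⟩
    · rw [h i (by simp; omega), List.getElem_append_left hi]
    · rw [add_assoc, h (ds.length + i) (by simp; omega), List.getElem_append_right (by omega)]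
      simp
  · rintro ⟨h1, h2⟩ i hi
    by_cases hlt : i < ds.length
    · rw [h1 i hlt, List.getElem_append_left hlt]
    · have := h2 (i - ds.length) (by simp at hi; omega)
      rw [List.getElem_append_right (by omega), ← this]
      congr 1; omega

theorem reads_singleton {ρ : ℕ → ℕ} {v d : ℕ} : Reads ρ v [d] ↔ ρ v = d := by
  constructor
  · intro h; exact h 0 (by simp)
  · intro h i hi
    obtain rfl : i = 0 := by simpa using hi
    exact h

theorem Reads.map_range {ρ : ℕ → ℕ} {v : ℕ} {ds : List ℕ} (h : Reads ρ v ds) :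
    (List.range' v ds.length).map ρ = ds := by
  refine List.ext_getElem (by simp) fun i h1 h2 => ?_
  simp [h i h2]

theorem Reads.congr {ρ σ : ℕ → ℕ} {v : ℕ} {ds : List ℕ} (h : Reads ρ v ds)
    (hσ : ∀ x, x < v + ds.length → σ x = ρ x) : Reads σ v ds :=
  fun i hi => by rw [hσ _ (by omega), h i hi]

open Position

/-! ### The program that writes the circuit -/

namespace Code

variable {N n R J : ℕ}

def ReadsPosition {j : ℕ} (ρ : ℕ → ℕ) (v : ℕ) (A : Position j n) : Prop :=
  ρ v = A.1 ∧ ∀ l : Fin j, ρ (v + 1 + l) = A.2 l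

/-- The variables from `v` on hold the tuple that encodes `a`. -/
structure ReadsCode (ρ : ℕ → ℕ) (v : ℕ) (a : Code R (J + 2) n) : Prop where
  t : ρ v = a.t
  kind : ρ (v + 1) = a.kind
  i : ρ (v + 2) = a.i
  A : ReadsPosition ρ (v + 3) a.A
  B : ReadsPosition ρ (v + (J + 6)) a.B
  C : ReadsPosition ρ (v + (2 * J + 9)) a.C
  m : ρ (v + (3 * J + 12)) = a.m

theorem readsPosition_of_reads {j : ℕ} {ρ : ℕ → ℕ} {v : ℕ} {A : Position j n}
    (h : Reads ρ v ((positionCoding j n).enc A)) : ReadsPosition ρ v A := by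
  have e : (positionCoding j n).enc A = [A.1.val] ++ List.ofFn fun l => (A.2 l).val := rfl
  rw [e, reads_append, reads_singleton] at h
  refine ⟨h.1, fun l => ?_⟩
  have := h.2 l (by simp)
  simpa using this

theorem length_enc_position {j : ℕ} (A : Position j n) :
    ((positionCoding j n).enc A).length = j + 1 := by
  rw [Coding.length_enc]; simp [positionBounds]

theorem length_enc (a : Code R (J + 2) n) : ((coding R (J + 2) n).enc a).length = 3 * J + 13 := by
  rw [Coding.length_enc]; simp [bounds, positionBounds]; ring

theorem readsCode_of_reads {ρ : ℕ → ℕ} {v : ℕ} {a : Code R (J + 2) n}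
    (h : Reads ρ v ((coding R (J + 2) n).enc a)) : ReadsCode ρ v a := by
  have e : (coding R (J + 2) n).enc a = [a.t.val] ++ ([a.kind.val] ++ ([a.i.val] ++
    ((positionCoding (J + 2) n).enc a.A ++ ((positionCoding (J + 2) n).enc a.B ++
      ((positionCoding (J + 2) n).enc a.C ++ [a.m.val]))))) := rfl
  rw [e] at h
  simp only [reads_append, reads_singleton, List.length_singleton, length_enc_position] at h
  obtain ⟨h1, h2, h3, h4, h5, h6, h7⟩ := h
  refine ⟨h1, h2, h3, readsPosition_of_reads h4, readsPosition_of_reads ?_,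
    readsPosition_of_reads ?_, ?_⟩
  · convert h5 using 1; ring
  · convert h6 using 1; ring
  · rw [← h7]; congr 1; ring

/-! The variables: `varCst c` holds the constant `c`, `varOrder` the order of the graphs,
`varLast` and `varLayers` the last layer and the number of layers, and the codes of the current
gate and of a possible predecessor start at `varGate` and `varPred`. -/

def varCst (c : ℕ) : ℕ := 2 + c
def varOrder (J : ℕ) : ℕ := J + 9
def varLast (J : ℕ) : ℕ := J + 11
def varLayers (J : ℕ) : ℕ := J + 12
def varGate (J : ℕ) : ℕ := J + 13
def varBefore (J : ℕ) : ℕ := 4 * J + 26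
def varPred (J : ℕ) : ℕ := 4 * J + 27

structure ReadsConsts (J n R t : ℕ) (ρ : ℕ → ℕ) : Prop where
  cst : ∀ c, c < J + 7 → ρ (varCst c) = c
  order : ρ (varOrder J) = n
  last : ρ (varLast J) = R + 1
  layers : ρ (varLayers J) = R + 2
  before : ρ (varBefore J) = t - 1

def condKind (v : ℕ) (c : Fin 5) : Cond := .eq (v + 1) (varCst c)

def condPosition (J v w : ℕ) : Cond :=
  .and (.eq v w) (.all (J + 2) fun l => .eq (v + 1 + l) (w + 1 + l))

def condIff (c d : Cond) : Cond := .or (.and c d) (.and (.not c) (.not d))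

def condMismatch (J v w : ℕ) : Cond := .any (J + 2) fun l => .any (J + 2) fun l' =>
  .not (condIff (.eq (v + 1 + l) (v + 1 + l')) (.eq (w + 1 + l) (w + 1 + l')))

def condProjects (J v w x y : ℕ) : Cond :=
  .and (.eq x v) (.and (.eq y w) (.any (J + 2) fun l => .any (J + 2) fun l' =>
    .and (.eq (x + 1) (v + 1 + l)) (.and (.eq (x + 1 + 1) (v + 1 + l'))
      (.and (.eq (y + 1) (w + 1 + l)) (.eq (y + 1 + 1) (w + 1 + l'))))))

def condParams (J a b : ℕ) : Cond :=
  .and (.eq (b + 2) (a + 2)) (.and (condPosition J (b + (2 * J + 9)) (a + (2 * J + 9)))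
    (.eq (b + (3 * J + 12)) (a + (3 * J + 12))))

/-- The variable `varBefore J` holds the truncated difference `t - 1`, so layer 0 has to be excluded
separately. -/
def condBefore (J a b : ℕ) : Cond := .and (.eq b (varBefore J)) (.lt (varCst 0) a)

def condInner (J a b : ℕ) : Cond :=
  .or (.and (condKind a 0) (.and (condKind b 3) (.and (condBefore J a b)
      (.and (condPosition J (b + (J + 6)) (a + (2 * J + 9))) (.and (condParams J a b)
        (.and (.eq (b + 3) (a + 3)) (.all (J + 2) fun l =>
          .or (.eq (varCst l) (a + 2)) (.eq (b + 3 + 1 + l) (a + 3 + 1 + l))))))))) <|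
  .or (.and (condKind a 2) (.and (.eq b a) (.and (condParams J a b)
      (.and (condPosition J (b + (J + 6)) (a + (J + 6)))
        (.or (.and (condKind b 0) (condPosition J (b + 3) (a + 3)))
          (.and (condKind b 1) (condPosition J (b + 3) (a + (J + 6))))))))) <|
  .or (.and (condKind a 3) (.and (condKind b 2) (.and (.eq b a) (.and (.eq a (varCst 0))
      (.and (.not (condMismatch J (a + 3) (a + (J + 6))))
        (.or (condProjects J (a + 3) (a + (J + 6)) (b + 3) (b + (J + 6)))
          (condProjects J (a + (J + 6)) (a + 3) (b + 3) (b + (J + 6))))))))) <|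
  .or (.and (condKind a 3) (.and (condKind b 2) (.and (.eq b a) (.and (.not (.eq a (varCst 0)))
      (.or (.and (condPosition J (b + 3) (a + 3)) (condPosition J (b + (J + 6)) (a + (J + 6))))
        (.and (condPosition J (b + 3) (a + (J + 6)))
          (condPosition J (b + (J + 6)) (a + 3)))))))) <|
  .and (condKind a 3) (.and (condKind b 3) (.and (condBefore J a b) (.and (condParams J a b)
      (.and (condPosition J (b + 3) (a + 3)) (condPosition J (b + (J + 6)) (a + (J + 6)))))))

def condLast (J a b : ℕ) : Cond :=
  .and (.eq b a) <|
  .or (.and (condKind a 3) (.and (condKind b 2) (.and (condPosition J (b + 3) (a + 3))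
    (.eq (b + (J + 6)) (varCst 1))))) <|
  .or (.and (condKind a 4) (.and (condKind b 3) (.eq (b + 3) (varCst 0)))) <|
  .or (.and (condKind a 4) (.and (condKind b 0) (.eq (b + 3) (varCst 0))))
    (.and (condKind a 4) (.and (condKind b 1) (.eq (b + 3) (varCst 1))))

def condWire (J : ℕ) : Cond :=
  .or (.and (.eq (varGate J) (varLast J)) (condLast J (varGate J) (varPred J)))
    (.and (.not (.eq (varGate J) (varLast J))) (condInner J (varGate J) (varPred J)))

section Holds

variable {ρ : ℕ → ℕ}

theorem holds_condKind {t v : ℕ} {a : Code R (J + 2) n} (hc : ReadsConsts J n R t ρ)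
    (ha : ReadsCode ρ v a) (c : Fin 5) : (condKind v c).Holds ρ ↔ a.kind = c := by
  rw [condKind, Cond.holds_eq, ha.kind, hc.cst _ (by omega), Fin.ext_iff]

theorem holds_condPosition {v w : ℕ} {A B : Position (J + 2) n} (hA : ReadsPosition ρ v A)
    (hB : ReadsPosition ρ w B) : (condPosition J v w).Holds ρ ↔ A = B := by
  simp only [condPosition, Cond.holds_and, Cond.holds_eq, Cond.holds_all, hA.1, hB.1, hA.2, hB.2,
    Prod.ext_iff, Fin.ext_iff, funext_iff]

theorem holds_condIff {c d : Cond} : (condIff c d).Holds ρ ↔ (c.Holds ρ ↔ d.Holds ρ) := by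
  simp only [condIff, Cond.holds_or, Cond.holds_and, Cond.holds_not]; tauto

theorem holds_condMismatch {v w : ℕ} {A B : Position (J + 2) n} (hA : ReadsPosition ρ v A)
    (hB : ReadsPosition ρ w B) : (condMismatch J v w).Holds ρ ↔ Mismatch A B := by
  simp only [condMismatch, Cond.holds_any, Cond.holds_not, holds_condIff, Cond.holds_eq, hA.2, hB.2,
    Mismatch, Fin.ext_iff]

theorem holds_condProjects {v w x y : ℕ} {A B P Q : Position (J + 2) n}
    (hA : ReadsPosition ρ v A) (hB : ReadsPosition ρ w B) (hP : ReadsPosition ρ x P)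
    (hQ : ReadsPosition ρ y Q) : (condProjects J v w x y).Holds ρ ↔ Projects A B P Q := by
  have hP0 := hP.2 0
  have hP1 := hP.2 1
  have hQ0 := hQ.2 0
  have hQ1 := hQ.2 1
  simp only [Fin.val_zero, Fin.val_one, add_zero] at hP0 hP1 hQ0 hQ1
  simp only [condProjects, Cond.holds_any, Cond.holds_and, Cond.holds_eq, hA.1, hB.1, hP.1, hQ.1,
    hA.2, hB.2, hP0, hP1, hQ0, hQ1, Projects, Fin.ext_iff]

theorem holds_condParams {v w : ℕ} {a b : Code R (J + 2) n} (ha : ReadsCode ρ v a)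
    (hb : ReadsCode ρ w b) : (condParams J v w).Holds ρ ↔ SameParams a b := by
  simp only [condParams, Cond.holds_and, Cond.holds_eq, holds_condPosition hb.C ha.C, ha.i, hb.i,
    ha.m, hb.m, SameParams, Fin.ext_iff]

theorem holds_condBefore {v w : ℕ} {a b : Code R (J + 2) n} (hc : ReadsConsts J n R a.t ρ)
    (ha : ReadsCode ρ v a) (hb : ReadsCode ρ w b) :
    (condBefore J v w).Holds ρ ↔ b.t.val + 1 = a.t := by
  simp only [condBefore, Cond.holds_and, Cond.holds_eq, Cond.holds_lt, ha.t, hb.t, hc.before,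
    hc.cst 0 (by omega)]
  omega

theorem holds_condInner {v w : ℕ} {a b : Code R (J + 2) n} (hc : ReadsConsts J n R a.t ρ)
    (ha : ReadsCode ρ v a) (hb : ReadsCode ρ w b) :
    (condInner J v w).Holds ρ ↔ InnerWire a b := by
  have h0 : a.t = 0 ↔ a.t.val = 0 := by rw [Fin.ext_iff]; rfl
  have hl : ∀ l : Fin (J + 2), ρ (varCst l) = l := fun l => hc.cst l (by omega)
  simp only [condInner, Cond.holds_or, Cond.holds_and, Cond.holds_not, Cond.holds_eq,
    Cond.holds_all, holds_condKind hc ha, holds_condKind hc hb, holds_condBefore hc ha hb,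
    holds_condParams ha hb, holds_condPosition hb.B ha.C, holds_condPosition hb.B ha.B,
    holds_condPosition hb.A ha.A, holds_condPosition hb.A ha.B, holds_condPosition hb.B ha.A,
    holds_condMismatch ha.A ha.B, holds_condProjects ha.A ha.B hb.A hb.B,
    holds_condProjects ha.B ha.A hb.A hb.B, ha.t, hb.t, hc.cst 0 (by omega), hl, ha.A.1, hb.A.1,
    ha.A.2, hb.A.2, ha.i, InnerWire, SamePositions, Swapped, ← Fin.ext_iff, h0, ne_eq]

theorem holds_condLast {v w : ℕ} {a b : Code R (J + 2) n} (hc : ReadsConsts J n R a.t ρ)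
    (ha : ReadsCode ρ v a) (hb : ReadsCode ρ w b) :
    (condLast J v w).Holds ρ ↔ LastWire a b := by
  have h0 : ∀ s : Fin 2, s = 0 ↔ s.val = 0 := fun s => Fin.ext_iff
  have h1 : ∀ s : Fin 2, s = 1 ↔ s.val = 1 := fun s => Fin.ext_iff
  simp only [condLast, Cond.holds_or, Cond.holds_and, Cond.holds_eq, holds_condKind hc ha,
    holds_condKind hc hb, holds_condPosition hb.A ha.A, ha.t, hb.t, hc.cst 0 (by omega),
    hc.cst 1 (by omega), hb.A.1, hb.B.1, LastWire, ← Fin.ext_iff, h0, h1]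

theorem holds_last {a : Code R (J + 2) n} (hc : ReadsConsts J n R a.t ρ)
    (ha : ReadsCode ρ (varGate J) a) :
    (Cond.eq (varGate J) (varLast J)).Holds ρ ↔ a.t = Fin.last (R + 1) := by
  rw [Cond.holds_eq, ha.t, hc.last, Fin.ext_iff, Fin.val_last]

theorem holds_first {a : Code R (J + 2) n} (hc : ReadsConsts J n R a.t ρ)
    (ha : ReadsCode ρ (varGate J) a) :
    (Cond.eq (varGate J) (varCst 0)).Holds ρ ↔ a.t = 0 := by
  rw [Cond.holds_eq, ha.t, hc.cst 0 (by omega), Fin.ext_iff]; rfl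

theorem holds_condWire {a b : Code R (J + 2) n} (hc : ReadsConsts J n R a.t ρ)
    (ha : ReadsCode ρ (varGate J) a) (hb : ReadsCode ρ (varPred J) b) :
    (condWire J).Holds ρ ↔ Wire a b := by
  rw [condWire, Cond.holds_or, Cond.holds_and, Cond.holds_and, Cond.holds_not, holds_last hc ha,
    holds_condLast hc ha hb, holds_condInner hc ha hb, Wire]
  split_ifs with h <;> simp [h]

end Holds

open Prog

def positionVars (J : ℕ) : List ℕ := [varCst 2] ++ List.replicate (J + 2) (varOrder J)

def boundVars (J : ℕ) : List ℕ :=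
  [varLayers J] ++ ([varCst 5] ++ ([varCst (J + 2)] ++ (positionVars J ++ (positionVars J ++
    (positionVars J ++ [varOrder J])))))

/-- Write the row of the current gate. -/
def rowProg (J : ℕ) : Prog :=
  nest (boundVars J) (branch
    (.lex (List.range' (varPred J) (3 * J + 13)) (List.range' (varGate J) (3 * J + 13)))
    (branch (condWire J) (emit true) (emit false)) skip)

/-- Write a negation of the gate whose code is in the variables `target`. -/
def notProg (J : ℕ) (target : List ℕ) : Prog :=
  seq (write [false, false, true]) (seq (nest (boundVars J) (branch
    (.lex (List.range' (varPred J) (3 * J + 13)) target) (emit true) skip)) (emit false))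

/-- Each summand of the bit number in `adjBit` is a product of variables, or the constant 2, and is
written in unary. -/
def adjProg (J : ℕ) : Prog :=
  seq (ones [varCst 2, varOrder J]) <| seq (write [true, true]) <|
  seq (ones [varGate J + 3, varOrder J, varOrder J]) <|
  seq (ones [varGate J + 3 + 1, varOrder J]) <| seq (ones [varGate J + 3 + 1 + 1]) (emit false)

def headerProg (J : ℕ) : Prog :=
  seq (branch (.eq (varGate J + 3) (varCst 0)) (ones [varGate J + 3 + 1]) (ones [varOrder J]))
    (emit false)

def restVars (J : ℕ) : List ℕ := List.range' (varGate J + 2) (3 * J + 11)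

def gateProg (counting : Bool) (J : ℕ) : Prog :=
  branch (condKind (varGate J) 0)
    (branch (.eq (varGate J) (varCst 0)) (seq (write [false, false, false]) (adjProg J))
      (branch (.eq (varGate J) (varLast J)) (seq (write [false, false, false]) (headerProg J))
        (if counting then seq (write [true, false, false]) (seq (seq (ones [varGate J + (3 * J + 12)])
          (write [true, false])) (rowProg J))
        else seq (write [false, true, false]) (rowProg J)))) <|
  branch (condKind (varGate J) 1) (notProg J (varGate J :: varCst 0 :: restVars J)) <|
  branch (condKind (varGate J) 2)
    (branch (.eq (varGate J) (varLast J)) (notProg J (varBefore J :: varCst 3 :: restVars J))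
      (seq (write [false, true, false]) (rowProg J))) <|
  branch (condKind (varGate J) 3)
    (branch (.and (.eq (varGate J) (varCst 0))
        (condMismatch J (varGate J + 3) (varGate J + (J + 6))))
      (seq (write [false, true, false]) (rowProg J)) (seq (write [false, true, true]) (rowProg J)))
    (seq (write [false, true, false]) (rowProg J))

section Out

variable {ρ : ℕ → ℕ} {a : Code R (J + 2) n}

theorem map_boundVars {t : ℕ} (hc : ReadsConsts J n R t ρ) :
    (boundVars J).map ρ = bounds R (J + 2) n := by
  simp [boundVars, positionVars, bounds, positionBounds, hc.layers, hc.order,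
    hc.cst 5 (by omega), hc.cst 2 (by omega), hc.cst (J + 2) (by omega)]

theorem lt_of_mem_boundVars {y : ℕ} (h : y ∈ boundVars J) : y < varGate J := by
  simp [boundVars, positionVars] at h
  simp only [varLayers, varCst, varOrder, varGate] at *
  omega

theorem length_boundVars : (boundVars J).length = 3 * J + 13 := by
  simp [boundVars, positionVars]; ring

theorem readsConsts_congr {t : ℕ} {σ : ℕ → ℕ} (hc : ReadsConsts J n R t ρ)
    (h : ∀ x, x < varPred J → σ x = ρ x) : ReadsConsts J n R t σ := by
  unfold varPred at h
  refine ⟨fun c hc' => ?_, ?_, ?_, ?_, ?_⟩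
  · rw [h _ (by unfold varCst; omega), hc.cst c hc']
  · rw [h _ (by unfold varOrder; omega), hc.order]
  · rw [h _ (by unfold varLast; omega), hc.last]
  · rw [h _ (by unfold varLayers; omega), hc.layers]
  · rw [h _ (by unfold varBefore; omega), hc.before]

variable (hc : ReadsConsts J n R a.t ρ)
  (ha : Reads ρ (varGate J) ((coding R (J + 2) n).enc a))

include hc ha in
open Classical in
theorem out_rowProg (counting : Bool) (hN : 2 * n * n + 2 * n + 2 = N) :
    (rowProg J).out (varPred J) ρ = (net counting hN R J).row (coding R (J + 2) n) a := by
  have hlt : varGate J < varPred J := by unfold varGate varPred; omega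
  rw [rowProg, out_nest _ _ _ _ fun y hy => (lt_of_mem_boundVars hy).trans hlt,
    map_boundVars hc, Net.row]
  refine List.flatMap_congr fun ds hds => ?_
  obtain ⟨b, rfl⟩ := ((coding R (J + 2) n).mem_iff ds).1 hds
  set σ := extend ρ (varPred J) ((coding R (J + 2) n).enc b) with hσ
  have hb : Reads σ (varPred J) ((coding R (J + 2) n).enc b) := reads_extend _ _ _
  have hσρ : ∀ x, x < varPred J → σ x = ρ x := fun x hx => extend_of_lt _ _ _ hx
  have ha' : Reads σ (varGate J) ((coding R (J + 2) n).enc a) := ha.congr fun x hx =>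
    hσρ x (by rw [length_enc] at hx; unfold varGate at hx; unfold varPred; omega)
  have hc' := readsConsts_congr hc hσρ
  have hma := ha'.map_range
  have hmb := hb.map_range
  rw [length_enc] at hma hmb
  rw [out_branch, out_branch, Cond.holds_lex _ _ (by simp), hma, hmb,
    holds_condWire hc' (readsCode_of_reads ha') (readsCode_of_reads hb)]
  have he : (∃ b', (coding R (J + 2) n).enc b' = (coding R (J + 2) n).enc b ∧
      (net counting hN R J).wire a b') ↔ Wire a b :=
    ⟨fun ⟨b', h, hw⟩ => (coding R (J + 2) n).inj h ▸ hw, fun h => ⟨b, rfl, h⟩⟩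
  simp only [he]
  split_ifs <;> simp_all [out]

include hc in
theorem out_notProg {b : Code R (J + 2) n} {target : List ℕ}
    (ht : target.map ρ = (coding R (J + 2) n).enc b) (hlt : ∀ y ∈ target, y < varPred J) :
    (notProg J target).out (varPred J) ρ = [false, false, true] ++
      (((tuples (bounds R (J + 2) n)).flatMap fun ds =>
        if ds < (coding R (J + 2) n).enc b then [true] else []) ++ [false]) := by
  have hlt' : varGate J < varPred J := by unfold varGate varPred; omega
  rw [notProg, out, out_write, out, out_nest _ _ _ _ fun y hy =>
    (lt_of_mem_boundVars hy).trans hlt', map_boundVars hc]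
  congr 2
  refine List.flatMap_congr fun ds hds => ?_
  obtain ⟨b', rfl⟩ := ((coding R (J + 2) n).mem_iff ds).1 hds
  have hb : Reads (extend ρ (varPred J) ((coding R (J + 2) n).enc b')) (varPred J)
    ((coding R (J + 2) n).enc b') := reads_extend _ _ _
  have hmb := hb.map_range
  have hmt : target.map (extend ρ (varPred J) ((coding R (J + 2) n).enc b')) = target.map ρ :=
    List.map_congr_left fun y hy => extend_of_lt _ _ _ (hlt y hy)
  have hlen := congrArg List.length ht
  rw [List.length_map, length_enc] at hlen
  rw [length_enc] at hmb
  rw [out_branch, Cond.holds_lex _ _ (by simp [hlen]), hmb, hmt, ht]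
  split_ifs <;> rfl

theorem enc_cons_cons (a : Code R (J + 2) n) : ∃ l, l.length = 3 * J + 11 ∧
    ∀ t kind, (coding R (J + 2) n).enc { a with t := t, kind := kind } =
      t.val :: kind.val :: l := by
  refine ⟨((coding R (J + 2) n).enc a).drop 2, ?_, fun t kind => rfl⟩
  rw [List.length_drop, length_enc]; omega

include ha in
theorem map_restVars (t : Fin (R + 2)) (kind : Fin 5) :
    (coding R (J + 2) n).enc { a with t := t, kind := kind } =
      t.val :: kind.val :: (restVars J).map ρ := by
  obtain ⟨l, hl, hl'⟩ := enc_cons_cons a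
  have h0 := hl' a.t a.kind
  have h1 : Reads ρ (varGate J) ([a.t.val, a.kind.val] ++ l) := by
    have : (coding R (J + 2) n).enc a = [a.t.val, a.kind.val] ++ l := h0
    rwa [← this]
  have h2 := (reads_append.1 h1).2.map_range
  rw [hl']
  rw [hl] at h2
  rw [restVars]
  exact congrArg (fun l => t.val :: kind.val :: l) h2.symm

theorem lt_of_mem_restVars {y : ℕ} (h : y ∈ restVars J) : y < varPred J := by
  simp only [restVars, List.mem_range'_1, varGate] at h
  unfold varPred; omega

include hc ha in
theorem out_gateProg (counting : Bool) (hN : 2 * n * n + 2 * n + 2 = N) :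
    (gateProg counting J).out (varPred J) ρ =
      (net counting hN R J).gateCode (coding R (J + 2) n) a := by
  have ha' := readsCode_of_reads ha
  have hrow := out_rowProg hc ha counting hN
  have hnet : (net counting hN R J).kind a = gateKind counting hN a := rfl
  have hk : a.kind = 0 ∨ a.kind = 1 ∨ a.kind = 2 ∨ a.kind = 3 ∨ a.kind = 4 := by
    generalize a.kind = q
    revert q; decide
  have hcst : ∀ c, c < J + 7 → varCst c < varPred J := fun c h => by
    unfold varCst varPred; omega
  have hGP : ∀ x, x ≤ 3 * J + 12 → varGate J + x < varPred J := fun x h => by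
    unfold varGate varPred; omega
  have hO : varOrder J < varPred J := by unfold varOrder varPred; omega
  rw [gateProg, Net.gateCode, hnet]
  simp only [out_branch, holds_condKind hc ha', holds_first hc ha', holds_last hc ha']
  rcases hk with hk | hk | hk | hk | hk
  · rw [gateKind_zero hk, if_pos hk]
    by_cases h0 : a.t = 0
    · have hA0 := ha'.A.2 0
      have hA1 := ha'.A.2 1
      simp only [Fin.val_zero, Fin.val_one, add_zero] at hA0 hA1
      simp only [if_pos h0, adjProg, out, out_write, unary, adjBit]
      rw [out_ones (by simp; exact ⟨hcst 2 (by omega), hO⟩),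
        out_ones (by simp; exact ⟨hGP 3 (by omega), hO⟩),
        out_ones (by simp; exact ⟨hGP 4 (by omega), hO⟩), out_ones (by simp; exact hGP 5 (by omega))]
      simp only [List.map_cons, List.map_nil, List.prod_cons, List.prod_nil, hA0, hA1, ha'.A.1,
        hc.order, hc.cst 2 (by omega), mul_one]
      rw [show [true, true] = List.replicate 2 true from rfl]
      simp only [← List.append_assoc, List.append_cancel_right_eq, List.replicate_append_replicate]
      simp only [List.append_cancel_left_eq]
      congr 1; ring
    · by_cases hl : a.t = Fin.last (R + 1)
      · have hA0 := ha'.A.2 0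
        simp only [Fin.val_zero, add_zero] at hA0
        simp only [if_neg h0, if_pos hl, headerProg, out, out_write, unary, headerBit, out_branch,
          Cond.holds_eq, ha'.A.1, hc.cst 0 (by omega)]
        rw [out_ones (by simp; exact hGP 4 (by omega)), out_ones (by simpa using hO)]
        simp only [List.map_cons, List.map_nil, List.prod_cons, List.prod_nil, hA0, hc.order, mul_one]
        have : a.A.1.val = 0 ↔ a.A.1 = 0 := by rw [Fin.ext_iff]; rfl
        simp only [this]
        split_ifs <;> rfl
      · simp only [if_neg h0, if_neg hl]
        cases counting with
        | true =>
          simp only [if_true, out, out_write, hrow]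
          rw [out_ones (by simp; exact hGP (3 * J + 12) (by omega))]
          simp only [List.map_cons, List.map_nil, List.prod_cons, List.prod_nil, ha'.m, mul_one,
            unary, List.replicate_succ']
          simp
        | false => simp [out, hrow]
  · rw [gateKind_one hk, if_neg (by rw [hk]; decide), if_pos hk]
    refine out_notProg hc ?_ fun y hy => ?_
    · have := map_restVars ha a.t 0
      rw [List.map_cons, List.map_cons, ha'.t, hc.cst 0 (by omega)]
      exact this.symm
    · simp only [List.mem_cons] at hy
      rcases hy with rfl | rfl | hy
      · exact hGP 0 (by omega)
      · exact hcst 0 (by omega)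
      · exact lt_of_mem_restVars hy
  · rw [gateKind_two hk, if_neg (by rw [hk]; decide), if_neg (by rw [hk]; decide), if_pos hk]
    by_cases hl : a.t = Fin.last (R + 1)
    · simp only [if_pos hl]
      refine out_notProg hc ?_ fun y hy => ?_
      · have := map_restVars ha (predLayer a.t) 3
        rw [List.map_cons, List.map_cons, hc.before, hc.cst 3 (by omega)]
        exact this.symm
      · simp only [List.mem_cons] at hy
        rcases hy with rfl | rfl | hy
        · unfold varBefore varPred; omega
        · exact hcst 3 (by omega)
        · exact lt_of_mem_restVars hy
    · simp [if_neg hl, out, hrow]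
  · rw [gateKind_three hk, if_neg (by rw [hk]; decide), if_neg (by rw [hk]; decide),
      if_neg (by rw [hk]; decide), if_pos hk]
    have hm : (Cond.and (.eq (varGate J) (varCst 0))
        (condMismatch J (varGate J + 3) (varGate J + (J + 6)))).Holds ρ ↔
        a.t = 0 ∧ Mismatch a.A a.B := by
      rw [Cond.holds_and, holds_first hc ha', holds_condMismatch ha'.A ha'.B]
    by_cases h : a.t = 0 ∧ Mismatch a.A a.B
    · simp only [if_pos h, if_pos (hm.2 h), out, out_write, hrow]
    · simp only [if_neg h, if_neg (mt hm.1 h), out, out_write, hrow]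
  · rw [gateKind_four hk, if_neg (by rw [hk]; decide), if_neg (by rw [hk]; decide),
      if_neg (by rw [hk]; decide), if_neg (by rw [hk]; decide)]
    simp [out, hrow]

end Out

end Code

/-! ### The parameters of the circuit, as functions of the length of the input -/

/-- The order of the graphs in inputs of length `N = 2 * n * n + 2 * n + 2`. -/
def order (N : ℕ) : ℕ := (List.range (N + 1)).countP fun a => decide (2 * a * a + 2 * a + 2 < N)

-- For positive `N` there are `Nat.log 2 N + 1` powers of two up to `N`; counting them replaces the
-- computation of a logarithm.
open Classical in
noncomputable def rounds (c N : ℕ) : ℕ :=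
  c * (List.range (N + 1)).countP fun a => decide (∃ i, a = 2 ^ i)

theorem order_le (N : ℕ) : order N ≤ N + 1 := by
  rw [order]
  simpa using List.countP_le_length (p := fun a => decide (2 * a * a + 2 * a + 2 < N))
    (l := List.range (N + 1))

theorem order_eq {n N : ℕ} (h : 2 * n * n + 2 * n + 2 = N) : order N = n := by
  change Nat.count (fun a => 2 * a * a + 2 * a + 2 < N) (N + 1) = n
  rw [Nat.count_eq_card_filter_range]
  have : (Finset.range (N + 1)).filter (fun a => 2 * a * a + 2 * a + 2 < N) = Finset.range n := by
    ext a
    simp only [Finset.mem_filter, Finset.mem_range]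
    constructor
    · rintro ⟨-, ha⟩
      by_contra! hle
      have := Nat.mul_le_mul hle hle
      nlinarith
    · intro ha
      have := Nat.mul_le_mul ha.le ha.le
      constructor <;> nlinarith
  rw [this, Finset.card_range]

theorem rounds_zero (c : ℕ) : rounds c 0 = 0 := by
  simpa [rounds] using fun i h => absurd h (Nat.two_pow_pos i).ne

theorem rounds_of_pos (c : ℕ) {N : ℕ} (hN : 0 < N) : rounds c N = c * (Nat.log 2 N + 1) := by
  classical
  rw [rounds]
  congr 1
  have h : Nat.count (fun a => ∃ i, a = 2 ^ i) (N + 1) = Nat.log 2 N + 1 := by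
    rw [Nat.count_eq_card_filter_range]
    have : (Finset.range (N + 1)).filter (fun a => ∃ i, a = 2 ^ i) =
        (Finset.range (Nat.log 2 N + 1)).image (2 ^ ·) := by
      ext a
      simp only [Finset.mem_filter, Finset.mem_range, Finset.mem_image]
      constructor
      · rintro ⟨ha, i, rfl⟩
        exact ⟨i, Nat.lt_succ_of_le (Nat.le_log_of_pow_le one_lt_two (by omega)), rfl⟩
      · rintro ⟨i, hi, rfl⟩
        exact ⟨Nat.lt_succ_of_le (Nat.pow_le_of_le_log hN.ne' (by omega)), i, rfl⟩
    rw [this, Finset.card_image_of_injective _ (Nat.pow_right_injective le_rfl), Finset.card_range]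
  rw [← h, Nat.count]

theorem rounds_le (c N : ℕ) : rounds c N ≤ c * (Nat.log 2 N + 1) := by
  rcases Nat.eq_zero_or_pos N with rfl | hN
  · simp [rounds_zero]
  · exact (rounds_of_pos c hN).le

/-! ### The program -/

namespace Prog

/-- Bind the next `m` variables to the numbers from `c` on. -/
def consts : ℕ → ℕ → Prog → Prog
  | _, 0, Q => Q
  | c, m + 1, Q => count (write (List.replicate c true)) (consts (c + 1) m Q)

theorem out_consts (Q : Prog) : ∀ (m c n : ℕ) (ρ : ℕ → ℕ), 0 < n → c + m ≤ ρ 0 + 1 →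
    (consts c m Q).out n ρ = Q.out (n + m) (extend ρ n (List.range' c m)) := by
  intro m
  induction m with
  | zero => intro c n ρ _ _; rfl
  | succ m ih =>
    intro c n ρ hn h
    rw [consts, out_count (m := c) (by simp) (by omega), ih _ _ _ (by omega)
      (by rw [Function.update_of_ne hn.ne]; omega), List.range'_succ, extend]
    congr 1; omega

end Prog

namespace Code

open Prog

/-- Write `2 * y * y + 2 * y + 3` ones. -/
def lengthProg (y : ℕ) : Prog :=
  seq (ones [varCst 2, y, y]) (seq (ones [varCst 2, y]) (write [true, true, true]))

/-- As variable `1` holds `N + 1`, the length to be compared with it is written with one additional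
bit. The truncation does not disturb the comparison, provided that variable `0` is at least `N + 1`.
-/
def orderProg (J : ℕ) : Prog :=
  loop 1 (count (lengthProg (J + 10)) (ite (.lt (J + 11) 1) (emit true) skip))

def lastProg (c J : ℕ) : Prog :=
  seq (loop 1 (ite (.pow2 (J + 12)) (write (List.replicate c true)) skip)) (emit true)

def beforeProg (J : ℕ) : Prog :=
  loop (varGate J) (ite (.lt (varCst 0) (varPred J)) (emit true) skip)

/-- Write the circuit for graphs of positive order. -/
def circuitProg (counting : Bool) (c J : ℕ) : Prog :=
  count (lastProg c J) (count (seq (ones [varLast J]) (emit true))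
    (nest (boundVars J) (count (beforeProg J) (gateProg counting J))))

/-- The words `[false, true, false]` and `[false, true, true]` encode a single AND or OR gate
without predecessors, that is, the constants true and false. -/
def familyProg (counting : Bool) (c J : ℕ) : Prog :=
  consts 0 (J + 7) <| count (orderProg J) <| count (lengthProg (varOrder J)) <|
    ite (.eq (J + 10) 1) (ite (.eq (varOrder J) (varCst 0)) (write [false, true, false])
      (circuitProg counting c J)) (write [false, true, true])

variable {ρ : ℕ → ℕ} {J N n c : ℕ}

theorem length_lengthProg {y l : ℕ} (hy : y < l) (hl : varCst 2 < l) (h2 : ρ (varCst 2) = 2) :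
    ((lengthProg y).out l ρ).length = 2 * ρ y * ρ y + 2 * ρ y + 3 := by
  rw [lengthProg, out, out, out_write, out_ones (by simp; omega), out_ones (by simp; omega)]
  simp [h2]; ring

theorem length_orderProg (h1 : ρ 1 = N + 1) (h0 : N + 1 ≤ ρ 0) (h2 : ρ (varCst 2) = 2) :
    ((orderProg J).out (J + 10) ρ).length = order N := by
  have h : ∀ v, (count (lengthProg (J + 10)) (ite (.lt (J + 11) 1) (emit true) skip)).out
      (J + 10 + 1) (Function.update ρ (J + 10) v) =
      if 2 * v * v + 2 * v + 2 < N then List.replicate 1 true else [] := fun v => by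
    rw [out, length_lengthProg (by omega) (by unfold varCst; omega)
      (by rw [Function.update_of_ne (by unfold varCst; omega), h2])]
    simp only [out, Test.Holds, Function.update_self]
    rw [Function.update_of_ne (by omega : (1 : ℕ) ≠ J + 10 + 1),
      Function.update_of_ne (by omega : (1 : ℕ) ≠ J + 10),
      Function.update_of_ne (by omega : (0 : ℕ) ≠ J + 10), h1]
    refine if_congr ?_ rfl rfl
    omega
  rw [orderProg, out]
  simp only [h]
  rw [h1]
  have := length_flatMap_ite (fun v => 2 * v * v + 2 * v + 2 < N) 1 (List.range (N + 1))
  rw [one_mul] at this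
  rw [order]
  convert this

theorem length_lastProg (h1 : ρ 1 = N + 1) :
    ((lastProg c J).out (J + 12) ρ).length = rounds c N + 1 := by
  classical
  rw [lastProg, out, out, out, h1]
  have := length_flatMap_ite (fun v => ∃ i, v = 2 ^ i) c (List.range (N + 1))
  simp only [out, Test.Holds, Function.update_self, out_write, List.length_append, this, rounds]
  rfl

theorem length_beforeProg (h0 : ρ (varCst 0) = 0) :
    ((beforeProg J).out (varPred J) ρ).length = ρ (varGate J) - 1 := by
  classical
  have hne : varCst 0 ≠ varPred J := by unfold varCst varPred; omega
  have h : ∀ v, (ite (.lt (varCst 0) (varPred J)) (emit true) skip).out (varPred J + 1)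
      (Function.update ρ (varPred J) v) = if 0 < v then List.replicate 1 true else [] := fun v => by
    simp only [out, Test.Holds, Function.update_self]
    rw [Function.update_of_ne hne, h0]
    rfl
  rw [beforeProg, out]
  simp only [h]
  generalize ρ (varGate J) = t
  induction t with
  | zero => rfl
  | succ t ih =>
    rw [List.range_succ, List.flatMap_append, List.length_append, ih]
    rcases Nat.eq_zero_or_pos t with rfl | ht
    · rfl
    · simp [ht]; omega

open Classical in
theorem out_circuitProg {R : ℕ} (hn : 2 * n * n + 2 * n + 2 = N) (hR : rounds c N = R)
    (hcst : ∀ d, d < J + 7 → ρ (varCst d) = d) (hO : ρ (varOrder J) = n) (h1 : ρ 1 = N + 1)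
    (h0 : R + 2 ≤ ρ 0) (counting : Bool) :
    ∃ g : List ℕ → List Bool,
      (circuitProg counting c J).out (J + 11) ρ = (tuples (bounds R (J + 2) n)).flatMap g ∧
      ∀ a, g ((coding R (J + 2) n).enc a) =
        (net counting hn R J).gateCode (coding R (J + 2) n) a := by
  rw [circuitProg, out_count (m := R + 1) (by rw [length_lastProg h1, hR]) (by omega)]
  set σ := Function.update ρ (J + 11) (R + 1) with hσ
  have hσ' : ∀ x, x < J + 11 → σ x = ρ x := fun x hx => Function.update_of_ne hx.ne _ _
  have hσl : σ (varLast J) = R + 1 := Function.update_self ..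
  rw [out_count (m := R + 2) (by
      rw [out, out_ones (by simp [varLast])]; simp [hσl, out])
    (by rw [hσ' 0 (by omega)]; exact h0)]
  set τ := Function.update σ (J + 11 + 1) (R + 2) with hτ
  have hτ' : ∀ x, x < J + 12 → τ x = σ x := fun x hx => Function.update_of_ne hx.ne _ _
  have hl : τ (varLayers J) = R + 2 := Function.update_self ..
  have hτc : ∀ d, d < J + 7 → τ (varCst d) = d := fun d hd => by
    rw [hτ' _ (by unfold varCst; omega), hσ' _ (by unfold varCst; omega), hcst d hd]
  have hτO : τ (varOrder J) = n := by
    rw [hτ' _ (by unfold varOrder; omega), hσ' _ (by unfold varOrder; omega), hO]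
  have hb : (boundVars J).map τ = bounds R (J + 2) n := by
    simp [boundVars, positionVars, bounds, positionBounds, hl, hτO, hτc 5 (by omega),
      hτc 2 (by omega), hτc (J + 2) (by omega)]
  rw [out_nest _ _ (J + 11 + 1 + 1) _ fun y hy => lt_of_mem_boundVars hy, hb, length_boundVars]
  refine ⟨_, rfl, fun a => ?_⟩
  set υ := extend τ (J + 11 + 1 + 1) ((coding R (J + 2) n).enc a) with hυ
  have hυ' : ∀ x, x < J + 13 → υ x = τ x := fun x hx => extend_of_lt _ _ _ hx
  have ha : Reads υ (varGate J) ((coding R (J + 2) n).enc a) := reads_extend _ _ _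
  have hlevel : J + 11 + 1 + 1 + (3 * J + 13) = varBefore J := by unfold varBefore; ring
  have ht := (readsCode_of_reads ha).t
  have hc0 : υ (varCst 0) = 0 := by rw [hυ' _ (by unfold varCst; omega), hτc 0 (by omega)]
  rw [hlevel, out_count (m := a.t - 1) (by
      rw [show varBefore J + 1 = varPred J by unfold varBefore varPred; ring,
        length_beforeProg hc0, ht])
    (by rw [hυ' 0 (by omega), hτ' 0 (by omega), hσ' 0 (by omega)]; omega)]
  have hu : ∀ x, x < varBefore J → Function.update υ (varBefore J) (a.t - 1) x = υ x :=
    fun x hx => Function.update_of_ne hx.ne _ _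
  refine out_gateProg (R := R) ⟨fun d hd => ?_, ?_, ?_, ?_, Function.update_self ..⟩
    (ha.congr fun x hx => hu x ?_) counting hn
  · rw [hu _ (by unfold varCst varBefore; omega), hυ' _ (by unfold varCst; omega), hτc d hd]
  · rw [hu _ (by unfold varOrder varBefore; omega), hυ' _ (by unfold varOrder; omega), hτO]
  · rw [hu _ (by unfold varLast varBefore; omega), hυ' _ (by unfold varLast; omega),
      hτ' _ (by unfold varLast; omega), hσl]
  · rw [hu _ (by unfold varLayers varBefore; omega), hυ' _ (by unfold varLayers; omega), hl]
  · rw [length_enc] at hx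
    unfold varGate at hx
    unfold varBefore
    omega

end Code

/-! ### The circuit family -/

/-- A circuit with constant output. -/
def Circuit.const (N : ℕ) (b : Bool) : Circuit N where
  size := 1
  size_pos := Nat.one_pos
  gate _ := if b then .and fun _ => false else .or fun _ => false

theorem Circuit.eval_const {N : ℕ} (b : Bool) (x : Fin N → Bool) : (const N b).eval x = b := by
  cases b <;> rw [eval, val] <;> simp [const]

theorem Circuit.isAC_const (N : ℕ) (b : Bool) : (const N b).IsAC := by
  intro i m w
  cases b <;> simp [const]

theorem Circuit.depth_const_le (N : ℕ) (b : Bool) : (const N b).depth ≤ 1 := by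
  refine Finset.sup_le fun i _ => ?_
  cases b <;> rw [gateDepth] <;> simp [const]

theorem Circuit.encode_const (N : ℕ) (b : Bool) :
    (const N b).encode = [false, true, !b] := by
  cases b <;> simp [encode, const, Gate.encode, List.ofFn_succ]

/-- Isomorphic graphs give inputs of length `2 * n * n + 2 * n + 2`; all other lengths are rejected.
Length 2 occurs for the pair of empty graphs only, which have no positions with pebbles, and is
accepted outright. -/
noncomputable def family (counting : Bool) (c J N : ℕ) : Circuit N :=
  if h : 2 * order N * order N + 2 * order N + 2 = N then
    if hn : 0 < order N then Code.circuit counting h (rounds c N) J hn else .const N true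
  else .const N false

open Prog in
theorem out_familyProg (counting : Bool) (c J N : ℕ) :
    (Code.familyProg counting c J).out 2 (initial (c + J + 10) N) =
      (family counting c J N).encode := by
  have hK : initial (c + J + 10) N 0 = (c + J + 10) * (N + 1) := rfl
  have hK1 : initial (c + J + 10) N 1 = N + 1 := rfl
  have hKc : (c + J + 10) * (N + 1) = c * (N + 1) + J * (N + 1) + 10 * N + 10 := by ring
  have hJN : J ≤ J * (N + 1) := Nat.le_mul_of_pos_right _ (Nat.succ_pos N)
  have hO := order_le N
  have hR : rounds c N ≤ c * (N + 1) := by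
    rw [rounds]
    exact Nat.mul_le_mul_left _ ((List.countP_le_length).trans (by simp))
  rw [Code.familyProg, out_consts _ _ _ _ _ (by omega) (by rw [hK]; omega)]
  set ρ := extend (initial (c + J + 10) N) 2 (List.range' 0 (J + 7)) with hρ
  have hc : ∀ d, d < J + 7 → ρ (Code.varCst d) = d := fun d hd => by
    have := extend_add (List.range' 0 (J + 7)) 2 (initial (c + J + 10) N) d (by simpa using hd)
    rw [List.getElem_range', one_mul, zero_add] at this
    exact this
  have h0 : ρ 0 = (c + J + 10) * (N + 1) := extend_of_lt _ _ _ (by omega)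
  have h1 : ρ 1 = N + 1 := extend_of_lt _ _ _ (by omega)
  rw [show 2 + (J + 7) = J + 9 by ring, out_count (m := order N)
    (Code.length_orderProg h1 (by rw [h0]; omega) (hc 2 (by omega))) (by rw [h0]; omega)]
  set σ := Function.update ρ (J + 9) (order N) with hσ
  have hσ' : ∀ x, x < J + 9 → σ x = ρ x := fun x hx => Function.update_of_ne hx.ne _ _
  have hσO : σ (Code.varOrder J) = order N := Function.update_self ..
  rw [out, Code.length_lengthProg (by unfold Code.varOrder; omega) (by unfold Code.varCst; omega)
    (by rw [hσ' _ (by unfold Code.varCst; omega), hc 2 (by omega)]), hσO, hσ' 0 (by omega), h0]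
  set τ := Function.update σ (J + 9 + 1) (min (2 * order N * order N + 2 * order N + 3)
    ((c + J + 10) * (N + 1))) with hτ
  have hτ' : ∀ x, x < J + 10 → τ x = σ x := fun x hx => Function.update_of_ne hx.ne _ _
  have hτl : τ (J + 10) = min (2 * order N * order N + 2 * order N + 3)
    ((c + J + 10) * (N + 1)) := Function.update_self ..
  have hτ1 : τ 1 = N + 1 := by rw [hτ' _ (by omega), hσ' _ (by omega), h1]
  have hτ0 : τ 0 = (c + J + 10) * (N + 1) := by rw [hτ' _ (by omega), hσ' _ (by omega), h0]
  have hτO : τ (Code.varOrder J) = order N := by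
    rw [hτ' _ (by unfold Code.varOrder; omega), hσO]
  have hτc : ∀ d, d < J + 7 → τ (Code.varCst d) = d := fun d hd => by
    rw [hτ' _ (by unfold Code.varCst; omega), hσ' _ (by unfold Code.varCst; omega), hc d hd]
  -- The cap `(c + J + 10) * (N + 1)` is larger than `N + 1`, so a truncated value cannot pass the
  -- equality test.
  have ht : (Test.eq (J + 10) 1).Holds τ ↔ 2 * order N * order N + 2 * order N + 2 = N := by
    rw [Test.Holds, hτl, hτ1]
    generalize 2 * order N * order N = q
    omega
  have ht0 : (Test.eq (Code.varOrder J) (Code.varCst 0)).Holds τ ↔ ¬ 0 < order N := by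
    rw [Test.Holds, hτO, hτc 0 (by omega)]; omega
  rw [out, out, out_write, out_write, family]
  by_cases h : 2 * order N * order N + 2 * order N + 2 = N
  · rw [if_pos (ht.2 h), dif_pos h]
    by_cases hn : 0 < order N
    · rw [if_neg (fun h' => ht0.1 h' hn), dif_pos hn]
      obtain ⟨g, hg, hg'⟩ := Code.out_circuitProg (c := c) (J := J) h rfl hτc hτO hτ1
        (by rw [hτ0]; omega) counting
      rw [hg]
      exact (Net.encode_toCircuit (Code.topological counting h (rounds c N) J) hg').symm
    · rw [if_pos (ht0.2 hn), dif_neg hn, Circuit.encode_const]; rfl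
  · rw [if_neg (mt ht.1 h), dif_neg h, Circuit.encode_const]; rfl

theorem logspaceUniform_family (counting : Bool) (c J : ℕ) :
    LogspaceUniform (family counting c J) := by
  obtain ⟨M, d, h⟩ := (Code.familyProg counting c J).exists_transducer (K := c + J + 10) (by omega)
  exact ⟨M, d, fun N => by rw [← out_familyProg]; exact h N⟩

open Position

/-! ### Size and depth -/

theorem size_circuit {n N R J : ℕ} (counting : Bool) (hN : 2 * n * n + 2 * n + 2 = N)
    (hn : 0 < n) : (Code.circuit counting hN R J hn).size =
      (R + 2) * (5 * ((J + 2) * ((2 * n ^ (J + 2)) * ((2 * n ^ (J + 2)) *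
        ((2 * n ^ (J + 2)) * n))))) := by
  change (tuples (Code.bounds R (J + 2) n)).length = _
  simp only [length_tuples, Code.bounds, Code.positionBounds, List.prod_append,
    List.prod_singleton, List.prod_replicate]

theorem size_family_le (counting : Bool) (c J : ℕ) :
    ∃ d : ℕ, ∀ N, (family counting c J N).size ≤ N ^ d + d := by
  -- The summands account for the number of layers, the constant factor `40 * (J + 2)` with `40 = 5
  -- * 2 ^ 3`, and the power of `n`. Constants go into the exponent by `a ≤ N ^ a` for `N ≥ 2`.
  refine ⟨(2 * c + 3) + (40 * (J + 2) + (3 * (J + 2) + 1)), fun N => ?_⟩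
  by_cases h : 2 * order N * order N + 2 * order N + 2 = N
  · by_cases hn : 0 < order N
    · rw [family, dif_pos h, dif_pos hn, size_circuit]
      generalize order N = n at h hn
      have hN : 2 ≤ N := by rw [← h]; omega
      have hnN : n ≤ N := by rw [← h]; generalize 2 * n * n = q; omega
      have self_le : ∀ a : ℕ, a ≤ N ^ a := fun a => (Nat.lt_pow_self (by omega)).le
      have h1 : rounds c N + 2 ≤ N ^ (2 * c + 3) := by
        have hl : Nat.log 2 N ≤ N := Nat.log_le_self 2 N
        have h2 := rounds_le c N
        have h3 : c * (Nat.log 2 N + 1) ≤ c * (2 * N) := Nat.mul_le_mul_left _ (by omega)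
        calc rounds c N + 2 ≤ (2 * c + 2) * N := by
              have : c * (2 * N) = 2 * c * N := by ring
              rw [add_mul]; omega
          _ ≤ N ^ (2 * c + 2) * N := Nat.mul_le_mul_right _ (self_le _)
          _ = N ^ (2 * c + 3) := by ring
      calc _ = (rounds c N + 2) * (40 * (J + 2) * n ^ (3 * (J + 2) + 1)) := by ring
        _ ≤ N ^ (2 * c + 3) * (N ^ (40 * (J + 2)) * N ^ (3 * (J + 2) + 1)) :=
          Nat.mul_le_mul h1 (Nat.mul_le_mul (self_le _) (Nat.pow_le_pow_left hnN _))
        _ = N ^ ((2 * c + 3) + (40 * (J + 2) + (3 * (J + 2) + 1))) := by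
          rw [← pow_add, ← pow_add]
        _ ≤ _ := Nat.le_add_right _ _
    · rw [family, dif_pos h, dif_neg hn]
      change 1 ≤ _; omega
  · rw [family, dif_neg h]
    change 1 ≤ _; omega

theorem depth_family_le (counting : Bool) (c J N : ℕ) :
    (family counting c J N).depth ≤ (5 * c + 10) * Nat.log 2 N ^ 1 + (5 * c + 10) := by
  by_cases h : 2 * order N * order N + 2 * order N + 2 = N
  · by_cases hn : 0 < order N
    · rw [family, dif_pos h, dif_pos hn]
      refine Code.depth_circuit_le.trans ?_
      have := rounds_le c N
      rw [pow_one]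
      nlinarith
    · rw [family, dif_pos h, dif_neg hn]
      exact (Circuit.depth_const_le N _).trans (by omega)
  · rw [family, dif_neg h]
    exact (Circuit.depth_const_le N _).trans (by omega)

theorem isAC_family (c J N : ℕ) : (family false c J N).IsAC := by
  rw [family]
  split_ifs
  · exact Code.circuit_isAC
  · exact Circuit.isAC_const N _
  · exact Circuit.isAC_const N _

/-! ### The bits of an encoded pair of graphs -/

theorem length_adjBits {n : ℕ} (G : SimpleGraph (Fin n)) : (adjBits G).length = n * n := by
  classical
  simp [adjBits, List.length_flatten, List.map_ofFn, Function.comp_def]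

open Classical in
theorem getElem?_adjBits {n : ℕ} (G : SimpleGraph (Fin n)) (u v : Fin n) :
    (adjBits G)[u * n + v]? = some (decide (G.Adj u v)) := by
  have h := List.ofFn_mul fun p : Fin (n * n) => decide (G.Adj p.divNat p.modNat)
  have hlt : u.val * n + v < n * n := by
    have := Nat.mul_le_mul_right n u.isLt
    rw [Nat.succ_mul] at this
    omega
  have key : ∀ u v : Fin n, ∀ h : u.val * n + v < n * n,
      (⟨u * n + v, h⟩ : Fin (n * n)) = Fin.mkDivMod u v := fun u v _ => by
    ext; simp [mul_comm]
  have h' : adjBits G = List.ofFn fun p : Fin (n * n) => decide (G.Adj p.divNat p.modNat) := by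
    rw [h, adjBits]
    simp only [key, Fin.divNat_mkDivMod, Fin.modNat_mkDivMod]
  rw [h', List.getElem?_ofFn, dif_pos hlt, key, Fin.divNat_mkDivMod, Fin.modNat_mkDivMod]

section EncodePair

variable {n m : ℕ} (G : SimpleGraph (Fin n)) (H : SimpleGraph (Fin m))

theorem length_encodePair : (encodePair G H).length = n + m + 2 + n * n + m * m := by
  simp [encodePair, unary, length_adjBits]; ring

theorem getElem?_encodePair_of_lt {p : ℕ} (hp : p < n) : (encodePair G H)[p]? = some true := by
  rw [encodePair, List.append_assoc, List.append_assoc, unary, List.append_assoc,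
    List.getElem?_append_left (by simpa using hp), List.getElem?_replicate, if_pos hp]

theorem getElem?_encodePair_self : (encodePair G H)[n]? = some false := by
  rw [encodePair, List.append_assoc, List.append_assoc, unary, List.append_assoc,
    List.getElem?_append_right (by simp)]
  simp

open Classical in
theorem getElem?_encodePair_left (u v : Fin n) :
    (encodePair G H)[n + m + 2 + (u * n + v)]? = some (decide (G.Adj u v)) := by
  have hlt : u.val * n + v < n * n := by
    have := Nat.mul_le_mul_right n u.isLt
    rw [Nat.succ_mul] at this
    omega
  have h1 : (unary n ++ unary m).length = n + m + 2 := by simp [unary]; ring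
  rw [encodePair, List.append_assoc, List.getElem?_append_right (by omega), h1,
    Nat.add_sub_cancel_left, List.getElem?_append_left (by rw [length_adjBits]; exact hlt),
    getElem?_adjBits]

open Classical in
theorem getElem?_encodePair_right (u v : Fin m) :
    (encodePair G H)[n + m + 2 + n * n + (u * m + v)]? = some (decide (H.Adj u v)) := by
  have h1 : (unary n ++ unary m ++ adjBits G).length = n + m + 2 + n * n := by
    simp [unary, length_adjBits]; ring
  rw [encodePair, List.getElem?_append_right (by omega), h1, Nat.add_sub_cancel_left,
    getElem?_adjBits]

end EncodePair

/-- Two graphs of the same order. -/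
def pair {n : ℕ} (G H : SimpleGraph (Fin n)) (s : Fin 2) : SimpleGraph (Fin n) :=
  if s = 0 then G else H

theorem inputAdj_encodePair {n : ℕ} (G H : SimpleGraph (Fin n))
    (hN : 2 * n * n + 2 * n + 2 = (encodePair G H).length) :
    Code.inputAdj hN (encodePair G H).get = fun s => (pair G H s).Adj := by
  classical
  funext s u v
  have key : ∀ {p : Fin (encodePair G H).length} {b : Bool},
      (encodePair G H)[p.val]? = some b → (encodePair G H).get p = b := fun {p b} h => by
    rw [List.get_eq_getElem]
    exact (List.getElem?_eq_some_iff.1 h).2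
  have hs : s = 0 ∨ s = 1 := by revert s; decide
  rw [Code.inputAdj]
  rcases hs with rfl | rfl
  · rw [key (b := decide (G.Adj u v))]
    · simp [pair]
    · rw [← getElem?_encodePair_left G H u v]
      congr 1
      simp only [Code.adjBit, Fin.val_zero]; ring
  · rw [key (b := decide (H.Adj u v))]
    · simp [pair]
    · rw [← getElem?_encodePair_right G H u v]
      congr 1
      simp only [Code.adjBit, Fin.val_one]; ring

/-- The header bits pin down the order of the first graph. The length `n + m + 2 + n * n + m * m` is
strictly increasing in `m`, which then determines the order of the second. -/
theorem header_encodePair_iff {n m o : ℕ} (G : SimpleGraph (Fin n)) (H : SimpleGraph (Fin m))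
    (ho : 0 < o) (hN : 2 * o * o + 2 * o + 2 = (encodePair G H).length) :
    Code.Header hN (encodePair G H).get ↔ o = n ∧ o = m := by
  have hlen := length_encodePair G H
  have key : ∀ {p : ℕ} {b : Bool} (hp : p < (encodePair G H).length),
      (encodePair G H)[p]? = some b → (encodePair G H).get ⟨p, hp⟩ = b := fun {p b} hp h => by
    rw [List.get_eq_getElem]
    exact (List.getElem?_eq_some_iff.1 h).2
  have hlt : ∀ p, p ≤ o → p < (encodePair G H).length := fun p hp => by
    rw [← hN]; generalize 2 * o * o = q; omega
  have h0 : ∀ u : Fin o, Code.headerBit hN 0 u = ⟨u, hlt u u.isLt.le⟩ := fun u => by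
    ext; simp [Code.headerBit]
  have h1 : ∀ u : Fin o, Code.headerBit hN 1 u = ⟨o, hlt o le_rfl⟩ := fun u => by
    ext; simp [Code.headerBit]
  simp only [Code.Header, h0, h1]
  constructor
  · rintro ⟨ht, hf⟩
    have hon : o = n := by
      rcases lt_trichotomy o n with h | h | h
      · have := key (hlt o le_rfl) (getElem?_encodePair_of_lt G H h)
        rw [hf ⟨0, ho⟩] at this
        cases this
      · exact h
      · have := key (hlt n h.le) (getElem?_encodePair_self G H)
        rw [ht ⟨n, h⟩] at this
        cases this
    refine ⟨hon, ?_⟩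
    subst hon
    rw [hlen] at hN
    rcases lt_trichotomy o m with h | h | h
    · nlinarith
    · exact h
    · nlinarith
  · rintro ⟨rfl, rfl⟩
    exact ⟨fun u => key _ (getElem?_encodePair_of_lt G H u.isLt),
      fun u => key _ (getElem?_encodePair_self G H)⟩

/-! ### Correctness -/

theorem family_eq {counting : Bool} {c J n N : ℕ} (h : 2 * n * n + 2 * n + 2 = N) (hn : 0 < n) :
    family counting c J N = Code.circuit counting h (rounds c N) J hn := by
  obtain rfl := order_eq h
  rw [family, dif_pos h, dif_pos hn]

theorem eval_family {n m : ℕ} (counting : Bool) (c J : ℕ) (G : SimpleGraph (Fin n))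
    (H : SimpleGraph (Fin m)) :
    (family counting c J (encodePair G H).length).eval (encodePair G H).get = true ↔
      (n = 0 ∧ m = 0) ∨ ∃ h : m = n, 0 < n ∧
        Accepts counting (fun s => (pair G (h ▸ H) s).Adj) (J + 2)
          (rounds c (encodePair G H).length) := by
  have hlen := length_encodePair G H
  by_cases h : ∃ o, 2 * o * o + 2 * o + 2 = (encodePair G H).length
  · obtain ⟨o, ho⟩ := h
    rcases Nat.eq_zero_or_pos o with rfl | hpos
    · have h0 : n = 0 ∧ m = 0 := by omega
      have hord := order_eq (n := 0) ho
      rw [family, dif_pos (by rw [hord]; exact ho), dif_neg (by rw [hord]; exact lt_irrefl 0), Circuit.eval_const]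
      simp [h0]
    · rw [family_eq ho hpos, Code.eval_circuit, header_encodePair_iff G H hpos ho]
      constructor
      · rintro ⟨hacc, rfl, rfl⟩
        rw [inputAdj_encodePair] at hacc
        exact .inr ⟨rfl, hpos, hacc⟩
      · rintro (⟨rfl, rfl⟩ | ⟨rfl, hn, hacc⟩)
        · rw [hlen] at ho; omega
        · obtain rfl : o = m := by
            rw [← order_eq ho]
            exact order_eq (by rw [hlen]; ring)
          rw [inputAdj_encodePair]
          exact ⟨hacc, rfl, rfl⟩
  · have hne : ¬ 2 * order (encodePair G H).length * order (encodePair G H).length +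
        2 * order (encodePair G H).length + 2 = (encodePair G H).length := fun h' => h ⟨_, h'⟩
    rw [family, dif_neg hne, Circuit.eval_const]
    refine iff_of_false (by simp) ?_
    rintro (⟨rfl, rfl⟩ | ⟨rfl, -, -⟩)
    · exact h ⟨0, by rw [hlen]⟩
    · exact h ⟨m, by rw [hlen]; ring⟩

/-- Isomorphic pairs are accepted for any number of rounds. The class enters only in the rejection
of non-isomorphic pairs, and there only through the first graph. -/
theorem decides_family {counting : Bool} {c J : ℕ} {C : (n : ℕ) → Set (SimpleGraph (Fin n))}
    (hC : ∀ (n N : ℕ) (G H : SimpleGraph (Fin n)), G ∈ C n → 0 < n → n ≤ N →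
      Accepts counting (fun s => (pair G H s).Adj) (J + 2) (rounds c N) → Nonempty (G ≃g H)) :
    Decides 1 (family counting c J) (graphIsomorphism C) := by
  refine ⟨logspaceUniform_family counting c J, size_family_le counting c J,
    ⟨5 * c + 10, depth_family_le counting c J⟩, ?_, ?_⟩
  · rintro x ⟨n, m, G, H, -, -, ⟨e⟩, rfl⟩
    rw [eval_family]
    obtain rfl : m = n := by simpa using (Fintype.card_congr e.toEquiv).symm
    rcases Nat.eq_zero_or_pos m with h | h
    · exact .inl ⟨h, h⟩
    · exact .inr ⟨rfl, h, accepts_of_iso (G := pair G H) e _⟩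
  · rintro x ⟨n, m, G, H, hG, -, hne, rfl⟩
    rw [Bool.eq_false_iff, ne_eq, eval_family]
    rintro (⟨rfl, rfl⟩ | ⟨rfl, hpos, hacc⟩)
    · exact hne.elim ⟨Equiv.refl _, fun {u} => u.elim0⟩
    · refine not_isEmpty_iff.2 (hC _ _ G H hG hpos ?_ hacc) hne
      rw [length_encodePair]; omega

theorem log_le_rounds (c : ℕ) {n N : ℕ} (hn : 0 < n) (hnN : n ≤ N) :
    c * Nat.log 2 n ≤ rounds c N := by
  rw [rounds_of_pos c (hn.trans_le hnN)]
  exact Nat.mul_le_mul_left _ ((Nat.log_mono_right hnN).trans (Nat.le_succ _))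

/-- The number `k + n₀ + 2` of pebbles is at least `k + 1`, as the defining sentence requires, and
at least `n₀`, so that graphs of order at most `n₀` can be pebbled completely. The rounds suffice
because the order is at most the input length. -/
theorem nonempty_iso_of_accepts {counting : Bool} {k c n₀ n N : ℕ} {G H : SimpleGraph (Fin n)}
    (h : n₀ ≤ n → ∃ φ : Formula (k + 1), φ.Defines G ∧ φ.depth ≤ c * Nat.log 2 n ∧
      (counting = false → φ.CountFree)) (hn : 0 < n) (hnN : n ≤ N)
    (hacc : Accepts counting (fun s => (pair G H s).Adj) (k + n₀ + 2) (rounds c N)) :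
    Nonempty (G ≃g H) := by
  rcases le_total n₀ n with hle | hle
  · obtain ⟨φ, hφ, hd, hc⟩ := h hle
    exact iso_of_accepts (G := pair G H) hn (by omega) hφ
      (hd.trans (log_le_rounds c hn hnN)) hc hacc
  · exact iso_of_accepts_of_le (G := pair G H) hn (by omega) hacc

end GraphIso

theorem corollary3p3 (k : ℕ) (hk : 2 ≤ k) (C : (n : ℕ) → Set (SimpleGraph (Fin n))) :
    ((∃ c n₀ : ℕ, ∀ n, n₀ ≤ n → ∀ G ∈ C n,
        GraphIso.countingDepth (k + 1) G ≤ ((c * Nat.log 2 n : ℕ) : ℕ∞)) →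
      GraphIso.graphIsomorphism C ∈ GraphIso.TC 1) ∧
    ((∃ c n₀ : ℕ, ∀ n, n₀ ≤ n → ∀ G ∈ C n,
        GraphIso.logicalDepth (k + 1) G ≤ ((c * Nat.log 2 n : ℕ) : ℕ∞)) →
      GraphIso.graphIsomorphism C ∈ GraphIso.AC 1) := by
  constructor
  · rintro ⟨c, n₀, h⟩
    refine ⟨GraphIso.family true c (k + n₀), GraphIso.decides_family fun n N G H hG hn hnN hacc =>
      GraphIso.nonempty_iso_of_accepts (fun hle => ?_) hn hnN hacc⟩
    obtain ⟨φ, hφ, hd⟩ := GraphIso.exists_defines_of_countingDepth_le (h n hle G hG)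
    exact ⟨φ, hφ, hd, fun h => absurd h (by decide)⟩
  · rintro ⟨c, n₀, h⟩
    refine ⟨GraphIso.family false c (k + n₀), GraphIso.isAC_family c _, GraphIso.decides_family
      fun n N G H hG hn hnN hacc => GraphIso.nonempty_iso_of_accepts (fun hle => ?_) hn hnN hacc⟩
    obtain ⟨φ, hφ, hd⟩ := GraphIso.exists_defines_of_logicalDepth_le (h n hle G hG)
    exact ⟨φ, hφ.1, hd, fun _ => hφ.2⟩
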